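/- Let $F/\mathbb{Q}_p$ be a finite extension with ring of integers $\mathcal{O}$, maximal ideal $\mathfrak{p}=\varpi\mathcal{O}$, residue field of cardinality $q$, absolute value normalised by $|\varpi|=q^{-1}$, and different $\varpi^{\delta}\mathcal{O}$. Let $\psi=\psi_0\circ\mathrm{Tr}_{F/\mathbb{Q}_p}$, where $\psi_0$ is a character of $\mathbb{Q}_p$ with kernel exactly $\mathbb{Z}_p$. Let $n\ge 1$, $G=\mathrm{GL}_{2n}(F)$, $B$ its upper triangular Borel subgroup, $w_m$ the antidiagonal permutation matrix of size $m$, and $J\subset \mathrm{GL}_{2n}(\mathcal{O})$ the subgroup of matrices that are block upper triangular (blocks of size $n$) modulo $\mathfrak{p}$. Let $\theta_1,\dots,\theta_{2n}:F^\times\to\mathbb{C}^\times$ be unramified characters with $\theta_i\theta_{n+i}=\eta$ for $1\le i\le n$. With $\delta_B(t)=|t_1|^{2n-1}|t_2|^{2n-3}\cdots|t_{2n}|^{1-2n}$ put $$\alpha=[\delta_B^{1/2}\theta]\big(\mathrm{diag}(1,\dots,1,\varpi,\dots,\varpi)\big)=q^{n^2/2}\,\theta_{n+1}(\varpi)\cdots\theta_{2n}(\varpi).$$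 There is a unique $J$-invariant function $F_0$ in the normalised induction $\mathrm{Ind}_B^G\theta$ that is supported on $Bw_{2n}J$ and satisfies $F_0(w_{2n})=\alpha^{\delta}q^{-\delta n^2}$. Let $$W_0(g)=\int_{\mathrm{GL}_n(\mathcal{O})}\int_{M_n(F)}F_0\left[\begin{pmatrix}&1\\1&\end{pmatrix}\begin{pmatrix}1&X\\&1\end{pmatrix}\begin{pmatrix}k&\\&k\end{pmatrix}g\right]\psi(-\mathrm{tr}\,X)\,\eta(\det k)^{-1}\,dX\,dk$$ ($\mathrm{vol}(M_n(\mathcal{O}))=\mathrm{vol}(\mathrm{GL}_n(\mathcal{O}))=1$). Let $u=\begin{pmatrix}1&w_n\\&1\end{pmatrix}$ and $t=\mathrm{diag}(\varpi,\dots,\varpi,1,\dots,1)$ (with $n$ entries equal to $\varpi$), and for a finite-order character $\chi$ of $F^\times$ of conductor $\mathfrak{p}^{\beta'}$ let $\beta=\max(1,\beta')$ and $$\tau(\chi)=q^{\beta'}(1-q^{-1})\int_{\mathcal{O}^\times}\chi(c\varpi^{-\beta'-\delta})\psi(c\varpi^{-\beta'-\delta})\,d^\times c,\qquad \mathrm{vol}(\mathcal{O}^\times)=1.$$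 Let $dh$ be a Haar measure on $\mathrm{GL}_n(F)$ and $c(dh)=\mathrm{vol}(I_n,dh)\,q^{\frac{n(n-1)}{2}+\delta\frac{n(n+1)}{2}}$, where $I_n\subset\mathrm{GL}_n(\mathcal{O})$ is the upper triangular Iwahori subgroup. Consider $$\zeta(s)=\zeta\big(s,(u^{-1}t^{\beta})\cdot W_0,\chi\big)=\int_{\mathrm{GL}_n(F)}W_0\left[\begin{pmatrix}h&\\&1\end{pmatrix}u^{-1}t^{\beta}\right]\chi(\det h)\,|\det h|^{s-1/2}\,dh .$$ The integral defining $W_0$ converges absolutely at all points $\begin{pmatrix}h&\\&1\end{pmatrix}u^{-1}t^{\beta}$; the integral defining $\zeta(s)$ converges absolutely if $|\theta_i(\varpi)|q^{-\mathrm{Re}(s)}<1$ for all $n<i\le 2n$; and there, as well as for the meromorphic continuation of $\zeta$ to $s\in\mathbb{C}$, $$\zeta(s)=c(dh)\cdot q^{\beta n(s-\frac n2)+\delta n(s-\frac n2-1)}\cdot\chi(\det(-w_n))\cdot Q(\pi,\chi,s),$$ $$Q(\pi,\chi,s)=\begin{cases}q^{-\beta n}\dfrac{q^n}{(q-1)^n}\,\tau(\chi)^n&\chi\text{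 ramified},\\[2mm]\dfrac{\chi(\varpi)^{-n(\delta+1)}}{(1-q)^n}\displaystyle\prod_{i=n+1}^{2n}\dfrac{1-\theta_i(\varpi)\chi(\varpi)q^{1-s}}{1-\theta_i(\varpi)\chi(\varpi)q^{-s}}&\chi\text{ unramified}.\end{cases}$$ In particular the factor $c(dh)$ is $1$ when $dh$ is normalised by $\mathrm{vol}(I_n,dh)=q^{-\frac{n(n-1)}{2}-\delta\frac{n(n+1)}{2}}$. -/

import Mathlib

open scoped NormedField Valued
open MeasureTheory

noncomputable section

namespace ParahoricZeta

section LocalField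

variable {F : Type*} [NontriviallyNormedField F] [IsUltrametricDist F]

/-- `ϖ` generates the maximal ideal of the ring of integers `𝒪[F] = {x | ‖x‖ ≤ 1}`. -/
def IsUniformizer (ϖ : Fˣ) : Prop :=
  ∃ w : 𝒪[F], (w : F) = (ϖ : F) ∧ 𝓂[F] = Ideal.span {w}

variable (F) in
/-- The cardinality `q` of the residue field. -/
def resCard : ℕ := Nat.card 𝓀[F]

/-- The absolute value of `F` normalised by `|ϖ| = q⁻¹`: the power of the given norm with this
property (see `normAbs_uniformizer`). -/
def normAbs (ϖ : Fˣ) (x : F) : ℝ :=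
  ‖x‖ ^ (Real.log (resCard F) / (-Real.log ‖(ϖ : F)‖))

theorem normAbs_uniformizer (ϖ : Fˣ) (h1 : ‖(ϖ : F)‖ < 1) (hq : 0 < resCard F) :
    normAbs ϖ (ϖ : F) = (resCard F : ℝ)⁻¹ := by
  have h0 : 0 < ‖(ϖ : F)‖ := norm_pos_iff.mpr ϖ.ne_zero
  have hl : Real.log ‖(ϖ : F)‖ ≠ 0 := (Real.log_neg h0 h1).ne
  have hq' : (0 : ℝ) < resCard F := by exact_mod_cast hq
  rw [normAbs, Real.rpow_def_of_pos h0, ← Real.exp_log (inv_pos.mpr hq'), Real.log_inv]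
  congr 1
  field_simp

/-- The different of `F / ℚ_p` is `ϖ ^ δ 𝒪`; equivalently (and by definition of the different) the
trace dual `{x | Tr (x 𝒪) ⊆ ℤ_p}` of `𝒪` is `ϖ ^ (-δ) 𝒪`. -/
def IsDifferentExponent (p : ℕ) [Fact p.Prime] [NormedAlgebra ℚ_[p] F] (ϖ : Fˣ) (δ : ℕ) : Prop :=
  ∀ x : F, (∀ y ∈ 𝒪[F], ‖Algebra.trace ℚ_[p] F (x * y)‖ ≤ 1) ↔ x * (ϖ : F) ^ δ ∈ 𝒪[F]

/-- A character of `F` of the form `ψ₀ ∘ Tr`, for `ψ₀` a character of `ℚ_p`. -/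
def traceChar {p : ℕ} [Fact p.Prime] [NormedAlgebra ℚ_[p] F] (ψ₀ : AddChar ℚ_[p] ℂ) (x : F) : ℂ :=
  ψ₀ (Algebra.trace ℚ_[p] F x)

variable (F) in
/-- The units `𝒪ˣ`, as a subset of `Fˣ`. -/
def unitSet : Set Fˣ := {c | ‖(c : F)‖ = 1}

/-- A character of `Fˣ` is unramified if it is trivial on `𝒪ˣ`. -/
def IsUnramified (χ : Fˣ →* ℂˣ) : Prop := ∀ c ∈ unitSet F, χ c = 1

/-- `𝒪ˣ` for `b = 0`, and `1 + 𝔭 ^ b` for `b ≥ 1`. -/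
def higherUnits (ϖ : Fˣ) (b : ℕ) : Set Fˣ :=
  {c | c ∈ unitSet F ∧ ‖(c : F) - 1‖ ≤ ‖(ϖ : F)‖ ^ b}

/-- `χ` has conductor `𝔭 ^ b`. -/
def HasConductor (ϖ : Fˣ) (χ : Fˣ →* ℂˣ) (b : ℕ) : Prop :=
  (∀ c ∈ higherUnits ϖ b, χ c = 1) ∧ ∀ b' < b, ¬ ∀ c ∈ higherUnits ϖ b', χ c = 1

/-- The Gauss sum
`q ^ b (1 - q⁻¹) ∫_{𝒪ˣ} χ (c ϖ ^ (-b-δ)) ψ (c ϖ ^ (-b-δ)) dˣc` of a character of conductor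
`𝔭 ^ b`; `dˣc` is meant to be the Haar measure giving `𝒪ˣ` volume `1`. -/
def localGaussSum [MeasurableSpace F] (dc : Measure Fˣ) (ϖ : Fˣ) (δ b : ℕ) (ψ : F → ℂ)
    (χ : Fˣ →* ℂˣ) : ℂ :=
  (resCard F : ℂ) ^ b * (1 - (resCard F : ℂ)⁻¹) *
    ∫ c in unitSet F, (χ (c * ϖ ^ (-(b + δ : ℤ))) : ℂ) * ψ (c * ϖ ^ (-(b + δ : ℤ)) : Fˣ) ∂dc

end LocalField

section Matrices

variable {F : Type*} [NontriviallyNormedField F] [IsUltrametricDist F] {n : ℕ}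

/-! The index set of `GL_{2n}` is `Fin n ⊕ Fin n`, in which `inl i` (for `i = 0, …, n-1`) is the
index `i + 1` and `inr i` is the index `n + i + 1`. -/

/-- The matrix `[[h, 0], [0, k]]`. -/
def blockDiag (h k : GL (Fin n) F) : GL (Fin n ⊕ Fin n) F where
  val := Matrix.fromBlocks h.val 0 0 k.val
  inv := Matrix.fromBlocks h.inv 0 0 k.inv
  val_inv := by simp [Matrix.fromBlocks_multiply, Matrix.fromBlocks_one]
  inv_val := by simp [Matrix.fromBlocks_multiply, Matrix.fromBlocks_one]

/-- The matrix `[[1, X], [0, 1]]`. -/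
def unip (X : Matrix (Fin n) (Fin n) F) : GL (Fin n ⊕ Fin n) F where
  val := Matrix.fromBlocks 1 X 0 1
  inv := Matrix.fromBlocks 1 (-X) 0 1
  val_inv := by simp [Matrix.fromBlocks_multiply, Matrix.fromBlocks_one]
  inv_val := by simp [Matrix.fromBlocks_multiply, Matrix.fromBlocks_one]

variable (F n) in
/-- The matrix `[[0, 1], [1, 0]]`. -/
def blockSwap : GL (Fin n ⊕ Fin n) F where
  val := Matrix.fromBlocks 0 1 1 0
  inv := Matrix.fromBlocks 0 1 1 0
  val_inv := by simp [Matrix.fromBlocks_multiply, Matrix.fromBlocks_one]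
  inv_val := by simp [Matrix.fromBlocks_multiply, Matrix.fromBlocks_one]

variable (F n) in
/-- The antidiagonal permutation matrix as a matrix. -/
def antidiag : Matrix (Fin n) (Fin n) F := Matrix.of fun i j => if j = i.rev then 1 else 0

theorem antidiag_mul_antidiag : antidiag F n * antidiag F n = 1 := by
  ext i j
  rw [Matrix.mul_apply, Finset.sum_eq_single i.rev]
  · simp [antidiag, Matrix.one_apply, eq_comm]
  · intro k _ hk
    simp [antidiag, hk]
  · simp

variable (F n) in
/-- The longest Weyl element `w_n` of `GL_n`. -/
def wLong : GL (Fin n) F where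
  val := antidiag F n
  inv := antidiag F n
  val_inv := antidiag_mul_antidiag
  inv_val := antidiag_mul_antidiag

variable (F n) in
/-- The longest Weyl element `w_{2n} = [[0, w_n], [w_n, 0]]` of `GL_{2n}`. -/
def wLong₂ : GL (Fin n ⊕ Fin n) F where
  val := Matrix.fromBlocks 0 (antidiag F n) (antidiag F n) 0
  inv := Matrix.fromBlocks 0 (antidiag F n) (antidiag F n) 0
  val_inv := by simp [Matrix.fromBlocks_multiply, antidiag_mul_antidiag, Matrix.fromBlocks_one]
  inv_val := by simp [Matrix.fromBlocks_multiply, antidiag_mul_antidiag, Matrix.fromBlocks_one]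

variable (F n) in
/-- `u = [[1, w_n], [0, 1]]`. -/
def uMat : GL (Fin n ⊕ Fin n) F := unip (antidiag F n)

variable (n) in
/-- `t_{𝔭,n} = diag (ϖ, …, ϖ, 1, …, 1)`. -/
def tMat (ϖ : Fˣ) : GL (Fin n ⊕ Fin n) F :=
  blockDiag (Matrix.GeneralLinearGroup.scalar (Fin n) ϖ) 1

/-- The diagonal matrix with entries `t`. -/
def torus (t : Fin n ⊕ Fin n → Fˣ) : GL (Fin n ⊕ Fin n) F where
  val := Matrix.diagonal fun i => (t i : F)
  inv := Matrix.diagonal fun i => ((t i)⁻¹ : Fˣ)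
  val_inv := by simp
  inv_val := by simp

variable (F n) in
/-- The upper triangular unipotent matrices in `GL_{2n}(F)`. -/
def upperUnip : Set (GL (Fin n ⊕ Fin n) F) :=
  {v | Matrix.BlockTriangular v.val toLex ∧ ∀ i, v.val i i = 1}

variable (F n) in
/-- `K_n = GL_n(𝒪)`, as a subset of `GL_n(F)`. -/
def maxCompact : Set (GL (Fin n) F) :=
  Set.range (Matrix.GeneralLinearGroup.map (n := Fin n) (algebraMap 𝒪[F] F))

variable (F n) in
/-- The (upper triangular) Iwahori subgroup of `GL_n(𝒪)`, as a subset of `GL_n(F)`. -/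
def iwahori : Set (GL (Fin n) F) :=
  {g | ∃ g₀ : GL (Fin n) 𝒪[F], Matrix.GeneralLinearGroup.map (algebraMap 𝒪[F] F) g₀ = g ∧
    ∀ i j, j < i → g₀.val i j ∈ 𝓂[F]}

variable (F n) in
/-- The parahoric subgroup `J`: the elements of `GL_{2n}(𝒪)` that are block upper triangular
modulo `𝔭`. -/
def parahoric : Set (GL (Fin n ⊕ Fin n) F) :=
  {g | ∃ g₀ : GL (Fin n ⊕ Fin n) 𝒪[F],
    Matrix.GeneralLinearGroup.map (algebraMap 𝒪[F] F) g₀ = g ∧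
    ∀ i j, g₀.val (Sum.inr i) (Sum.inl j) ∈ 𝓂[F]}

end Matrices

section Shalika

variable {F : Type*} [NontriviallyNormedField F] [IsUltrametricDist F] {n : ℕ}

/-- The zero-based position of an index of `GL_{2n}`. -/
def pos : Fin n ⊕ Fin n → ℕ := Sum.elim (fun i => (i : ℕ)) (fun i => n + i)

/-- `(δ_B ^ (1/2) θ)(t)`, where `δ_B(t) = |t_1|^(2n-1) |t_2|^(2n-3) ⋯ |t_{2n}|^(1-2n)`. -/
def inducingChar (ϖ : Fˣ) (θ : Fin n ⊕ Fin n → Fˣ →* ℂˣ) (t : Fin n ⊕ Fin n → Fˣ) : ℂ :=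
  ∏ i, ((normAbs ϖ (t i : F) ^ ((2 * (n : ℝ) - 1 - 2 * (pos i : ℝ)) / 2) : ℝ) : ℂ) * (θ i (t i) : ℂ)

/-- `α_{𝔭,n} = [δ_B ^ (1/2) θ] (diag (1, …, 1, ϖ, …, ϖ))`. -/
def alphaN (ϖ : Fˣ) (θ : Fin n ⊕ Fin n → Fˣ →* ℂˣ) : ℂ :=
  inducingChar ϖ θ (Sum.elim (fun _ => 1) (fun _ => ϖ))

/-- `f` is the `J`-invariant element of the normalised induction `Ind_B^G θ` that is supported on
the cell `B w_{2n} J` and takes the value `α_{𝔭,n} ^ δ q ^ (-δ n²)` at `w_{2n}`. -/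
structure IsNormalisedVector (ϖ : Fˣ) (δ : ℕ) (θ : Fin n ⊕ Fin n → Fˣ →* ℂˣ)
    (f : GL (Fin n ⊕ Fin n) F → ℂ) : Prop where
  equivariant : ∀ (t : Fin n ⊕ Fin n → Fˣ), ∀ v ∈ upperUnip F n, ∀ g,
    f (torus t * v * g) = inducingChar ϖ θ t * f g
  invariant : ∀ g, ∀ j ∈ parahoric F n, f (g * j) = f g
  support : ∀ g, f g ≠ 0 →
    ∃ t, ∃ v ∈ upperUnip F n, ∃ j ∈ parahoric F n, g = torus t * v * wLong₂ F n * j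
  value : f (wLong₂ F n) = alphaN ϖ θ ^ δ * ((resCard F : ℂ) ^ (δ * n ^ 2))⁻¹

/-- The integrand of the Ash–Ginzburg integral
`∫_{K_n} ∫_{M_n} f([[0,1],[1,0]] [[1,X],[0,1]] [[k,0],[0,k]] g) ψ(-tr X) η(det k)⁻¹ dX dk`. -/
def shalikaIntegrand (ψ : F → ℂ) (η : Fˣ →* ℂˣ) (f : GL (Fin n ⊕ Fin n) F → ℂ)
    (g : GL (Fin n ⊕ Fin n) F) (k : GL (Fin n) F) (X : Matrix (Fin n) (Fin n) F) : ℂ :=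
  f (blockSwap F n * unip X * blockDiag k k * g) * ψ (-X.trace) *
    ((η (Matrix.GeneralLinearGroup.det k))⁻¹ : ℂˣ)

/-- The Ash–Ginzburg integral `S_ψ^η(f)(g)`. -/
def shalikaFun [MeasurableSpace (Matrix (Fin n) (Fin n) F)] (dk : Measure (GL (Fin n) F))
    (dX : Measure (Matrix (Fin n) (Fin n) F)) (ψ : F → ℂ) (η : Fˣ →* ℂˣ)
    (f : GL (Fin n ⊕ Fin n) F → ℂ) (g : GL (Fin n ⊕ Fin n) F) : ℂ :=
  ∫ k in maxCompact F n, ∫ X, shalikaIntegrand ψ η f g k X ∂dX ∂dk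

/-- The action of `GL_{2n}(F)` on functions by right translation. -/
def rightTranslate (g : GL (Fin n ⊕ Fin n) F) (W : GL (Fin n ⊕ Fin n) F → ℂ) :
    GL (Fin n ⊕ Fin n) F → ℂ := fun x => W (x * g)

/-- The integrand of the Friedberg–Jacquet zeta integral
`∫_{GL_n(F)} W([[h,0],[0,1]]) χ(det h) |det h|^(s-1/2) dh`. -/
def zetaIntegrand (ϖ : Fˣ) (s : ℂ) (W : GL (Fin n ⊕ Fin n) F → ℂ) (χ : Fˣ →* ℂˣ)
    (h : GL (Fin n) F) : ℂ :=
  W (blockDiag h 1) * (χ (Matrix.GeneralLinearGroup.det h) : ℂ) *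
    ((normAbs ϖ (Matrix.GeneralLinearGroup.det h : F) : ℝ) : ℂ) ^ (s - 1 / 2)

/-- The Friedberg–Jacquet zeta integral, where it converges. -/
def zetaIntegral [MeasurableSpace (Matrix (Fin n) (Fin n) F)] (dh : Measure (GL (Fin n) F))
    (ϖ : Fˣ) (s : ℂ) (W : GL (Fin n ⊕ Fin n) F → ℂ) (χ : Fˣ →* ℂˣ) : ℂ :=
  ∫ h, zetaIntegrand ϖ s W χ h ∂dh

/-- `Z` is a local zeta function `s ↦ ζ(s, W, χ)`: it is meromorphic on `ℂ`, and in some right half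
plane it is given by the absolutely convergent zeta integral. -/
def IsLocalZeta [MeasurableSpace (Matrix (Fin n) (Fin n) F)] (dh : Measure (GL (Fin n) F))
    (ϖ : Fˣ) (W : GL (Fin n ⊕ Fin n) F → ℂ) (χ : Fˣ →* ℂˣ) (Z : ℂ → ℂ) : Prop :=
  MeromorphicOn Z Set.univ ∧
    ∃ σ : ℝ, ∀ s : ℂ, σ < s.re →
      Integrable (zetaIntegrand ϖ s W χ) dh ∧ Z s = zetaIntegral dh ϖ s W χ

/-- The factor `Q(π, χ, s)`, for `χ` of conductor `𝔭 ^ b` with Gauss sum `τ`. -/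
def Qfactor (ϖ : Fˣ) (δ b : ℕ) (θ : Fin n ⊕ Fin n → Fˣ →* ℂˣ) (χ : Fˣ →* ℂˣ) (τ : ℂ) (s : ℂ) : ℂ :=
  if b = 0 then
    ((χ ϖ : ℂ) ^ (n * (δ + 1)))⁻¹ / (1 - (resCard F : ℂ)) ^ n *
      ∏ i : Fin n, (1 - (θ (Sum.inr i) ϖ : ℂ) * (χ ϖ : ℂ) * (resCard F : ℂ) ^ (1 - s)) /
        (1 - (θ (Sum.inr i) ϖ : ℂ) * (χ ϖ : ℂ) * (resCard F : ℂ) ^ (-s))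
  else
    ((resCard F : ℂ) ^ (max 1 b * n))⁻¹ * ((resCard F : ℂ) ^ n / ((resCard F : ℂ) - 1) ^ n) * τ ^ n

/-- The expression
`q ^ (β n (s - n/2) + δ n (s - n/2 - 1)) χ(det (-w_n)) Q(π, χ, s)` with `β = max(1, b)`. -/
def zetaFormula (ϖ : Fˣ) (δ b : ℕ) (θ : Fin n ⊕ Fin n → Fˣ →* ℂˣ) (χ : Fˣ →* ℂˣ) (τ : ℂ)
    (s : ℂ) : ℂ :=
  (resCard F : ℂ) ^ (((max 1 b : ℕ) : ℂ) * n * (s - n / 2) + (δ : ℂ) * n * (s - n / 2 - 1)) *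
    (χ (Matrix.GeneralLinearGroup.det (-(wLong F n))) : ℂ) * Qfactor ϖ δ b θ χ τ s

variable (F n) in
/-- The constant `vol(I_n) q ^ (n(n-1)/2 + δ n(n+1)/2)`, where `I_n` is the Iwahori subgroup of
`GL_n`. It depends only on `F`, `n` and the normalisation of the Haar measure `dh` on `GL_n(F)`. -/
def volFactor [MeasurableSpace (Matrix (Fin n) (Fin n) F)] (dh : Measure (GL (Fin n) F))
    (δ : ℕ) : ℂ :=
  (dh.real (iwahori F n) : ℂ) *
    (resCard F : ℂ) ^ ((n : ℂ) * (n - 1) / 2 + (δ : ℂ) * n * (n + 1) / 2)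

end Shalika

end ParahoricZeta

end

open ParahoricZeta

set_option linter.unusedSectionVars false

namespace ParahoricZeta

/-! ### Norms and the valuation -/

section LocalFieldBasics

variable {F : Type*} [NontriviallyNormedField F] [IsUltrametricDist F] {ϖ : Fˣ}

/-! The function `W₀` has a closed form at the points that occur. By `shalika_matrix_identity` the
argument of `F₀` there is `blockDiag k g * blockSwap * unip Z`, where `g = k h ϖ^β`, `Z = g⁻¹ (X -
A) k` and `A = k h w_n k⁻¹`. Since `F₀` lives on the cell `B w_{2n} J`, it vanishes unless `Z` is
integral (`integral_of_mem_cell`), that is, unless `X` lies in the coset `A + g M_n(𝒪)`. The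
integral over `X` is therefore an additive character integrated over a lattice coset. By
orthogonality it is `ψ(-tr(h w_n)) |det g|^n` if `g` has entries in `ϖ^(-δ) 𝒪`, and `0` otherwise
(`shalikaFun_eq`).

In the zeta integral the substitution `h ↦ k⁻¹ h` moves the average over `K = GL_n(𝒪)` from `F₀` to
the characters (`unfold_zeta`). It becomes the matrix Gauss integral `gaussKernel`, the integral
over `k ∈ K` of `χ(det k) ψ(tr(k h))`. The remaining integrand is right `K`-invariant, so only upper
triangular `h` matter, and on these `F₀` sees only the diagonal `t`. The entries of `h` above the
diagonal range over a box of radius `|ϖ|^(-β-δ)`, and integrating over them forces the entries of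
`k` below the diagonal into `𝔭^β` (`setIntegral_gaussKernel`). For such `k` the determinant agrees
with the product of the diagonal modulo `𝔭^β`, a difference that `χ` does not detect. Averaging over
diagonal unit matrices then splits the kernel into one-dimensional ones
(`setIntegral_iwahoriLevel`), and the zeta integral becomes a product of `n` Tate integrals over
`Fˣ` (`zeta_eq_prod_tate`).

Each Tate integral is a sum over valuations `≥ -(β + δ)`. For ramified `χ` only the lowest valuation
survives and gives the Gauss sum (`tate_ramified`). For unramified `χ` the kernel is `-1/(q - 1)` at
the lowest valuation and `1` above it, and the geometric series gives the quotient of Euler factors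
(`tate_unramified`).

The constant compares the volume of the matrices in `K` that are upper triangular modulo `𝔭^β` with
that of the Iwahori subgroup (`measure_iwahori`). The powers of the `θ_i(ϖ)` cancel because `F₀` is
normalised by `α^δ`. The right-hand side is meromorphic, so any continuation agrees with it by the
identity theorem (`eq_codiscrete_of_halfPlane`). -/

theorem mem_integer_iff {x : F} : x ∈ 𝒪[F] ↔ ‖x‖ ≤ 1 := Valued.integer.mem_iff

theorem mem_maximalIdeal_iff {x : 𝒪[F]} : x ∈ 𝓂[F] ↔ ‖(x : F)‖ < 1 := by
  rw [Valued.maximalIdeal, IsLocalRing.mem_maximalIdeal, mem_nonunits_iff,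
    Valuation.Integer.not_isUnit_iff_valuation_lt_one]
  exact Iff.rfl

theorem IsUniformizer.norm_lt_one (hϖ : IsUniformizer ϖ) : ‖(ϖ : F)‖ < 1 := by
  obtain ⟨w, hw, h⟩ := hϖ
  rw [← hw, ← mem_maximalIdeal_iff, h]
  exact Ideal.mem_span_singleton_self w

theorem norm_units_pos (x : Fˣ) : 0 < ‖(x : F)‖ := norm_pos_iff.mpr x.ne_zero

theorem IsUniformizer.norm_le_of_lt_one (hϖ : IsUniformizer ϖ) {x : F} (hx : ‖x‖ < 1) :
    ‖x‖ ≤ ‖(ϖ : F)‖ := by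
  obtain ⟨w, hw, h⟩ := hϖ
  have hm : (⟨x, mem_integer_iff.2 hx.le⟩ : 𝒪[F]) ∈ 𝓂[F] := mem_maximalIdeal_iff.2 hx
  rw [h, Ideal.mem_span_singleton] at hm
  obtain ⟨c, hc⟩ := hm
  have : x = w * c := congrArg Subtype.val hc
  rw [this, norm_mul, hw]
  exact mul_le_of_le_one_right (norm_nonneg _) (mem_integer_iff.1 c.2)

/-- Every nonzero element has the norm of an integral power of a uniformiser. -/
theorem IsUniformizer.exists_norm_eq_zpow (hϖ : IsUniformizer ϖ) (x : Fˣ) :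
    ∃ m : ℤ, ‖(x : F)‖ = ‖(ϖ : F)‖ ^ m := by
  have h0 := norm_units_pos ϖ
  have h1 := hϖ.norm_lt_one
  obtain ⟨m, hm1, hm2⟩ := exists_mem_Ioc_zpow (norm_units_pos x) (one_lt_inv_iff₀.2 ⟨h0, h1⟩)
  refine ⟨-(m + 1), ?_⟩
  rw [inv_zpow'] at hm1 hm2
  have hz : ‖(ϖ : F)‖ ^ (-(m + 1)) ≠ 0 := (zpow_pos h0 _).ne'
  have hq : ‖(x : F) / (ϖ : F) ^ (-(m + 1))‖ ≤ 1 := by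
    rw [norm_div, norm_zpow]
    exact div_le_one_of_le₀ hm2 (zpow_pos h0 _).le
  -- There is no norm strictly between `‖ϖ‖` and `1`, so a quotient of norm less than `1` would
  -- contradict the choice of the exponent.
  rcases hq.lt_or_eq with h | h
  · exfalso
    have h2 := hϖ.norm_le_of_lt_one h
    rw [norm_div, norm_zpow, div_le_iff₀ (zpow_pos h0 _), ← zpow_one_add₀ h0.ne'] at h2
    exact absurd hm1 (not_lt.2 (h2.trans_eq (by congr 1; ring)))
  · rw [norm_div, norm_zpow, div_eq_one_iff_eq hz] at h
    exact h

theorem norm_zpow_strictAnti (hϖ : IsUniformizer ϖ) :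
    StrictAnti fun m : ℤ => ‖(ϖ : F)‖ ^ m :=
  zpow_right_strictAnti₀ (norm_units_pos ϖ) hϖ.norm_lt_one

/-- The normalised valuation of `F`, as a function on `Fˣ`. -/
noncomputable def ord (hϖ : IsUniformizer ϖ) (x : Fˣ) : ℤ := (hϖ.exists_norm_eq_zpow x).choose

theorem norm_eq_zpow_ord (hϖ : IsUniformizer ϖ) (x : Fˣ) :
    ‖(x : F)‖ = ‖(ϖ : F)‖ ^ ord hϖ x := (hϖ.exists_norm_eq_zpow x).choose_spec

theorem ord_eq_of_norm (hϖ : IsUniformizer ϖ) {x : Fˣ} {m : ℤ}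
    (h : ‖(x : F)‖ = ‖(ϖ : F)‖ ^ m) : ord hϖ x = m :=
  (norm_zpow_strictAnti hϖ).injective ((norm_eq_zpow_ord hϖ x).symm.trans h)

theorem ord_zpow (hϖ : IsUniformizer ϖ) (m : ℤ) : ord hϖ (ϖ ^ m) = m :=
  ord_eq_of_norm hϖ (by simp)

theorem ord_eq_iff (hϖ : IsUniformizer ϖ) {x y : Fˣ} :
    ord hϖ x = ord hϖ y ↔ ‖(x : F)‖ = ‖(y : F)‖ := by
  refine ⟨fun h => ?_, fun h => ord_eq_of_norm hϖ (h.trans (norm_eq_zpow_ord hϖ y))⟩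
  rw [norm_eq_zpow_ord hϖ x, norm_eq_zpow_ord hϖ y, h]

theorem IsUnramified.map_eq {χ : Fˣ →* ℂˣ} (hχ : IsUnramified χ) {x y : Fˣ}
    (h : ‖(x : F)‖ = ‖(y : F)‖) : χ x = χ y := by
  have : χ (x / y) = 1 := hχ _ (by
    simp [unitSet, h])
  rwa [map_div, div_eq_one] at this

theorem norm_mul_apply_le {l m n : Type*} [Fintype m] {A : Matrix l m F} {B : Matrix m n F}
    {a b : ℝ} (ha : 0 ≤ a) (hb : 0 ≤ b) (hA : ∀ i j, ‖A i j‖ ≤ a) (hB : ∀ i j, ‖B i j‖ ≤ b)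
    (i : l) (j : n) : ‖(A * B) i j‖ ≤ a * b := by
  rw [Matrix.mul_apply]
  refine IsUltrametricDist.norm_sum_le_of_forall_le_of_nonneg (by positivity) fun k _ => ?_
  rw [norm_mul]
  exact mul_le_mul (hA _ _) (hB _ _) (norm_nonneg _) ha

end LocalFieldBasics

/-! ### The residue field and volumes of fractional ideals -/

section ResidueField

variable {F : Type*} [NontriviallyNormedField F] [IsUltrametricDist F] {ϖ : Fˣ} [ProperSpace F]

theorem isOpen_norm_le {r : ℝ} (hr : 0 < r) : IsOpen {x : F | ‖x‖ ≤ r} := by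
  have := IsUltrametricDist.isOpen_closedBall (0 : F) hr.ne'
  simpa [Metric.closedBall, dist_zero_right] using this

theorem isCompact_norm_le (r : ℝ) : IsCompact {x : F | ‖x‖ ≤ r} := by
  have := isCompact_closedBall (0 : F) r
  simpa [Metric.closedBall, dist_zero_right] using this

instance finite_residueField : Finite 𝓀[F] := by
  have hc : CompactSpace 𝒪[F] := by
    refine (isCompact_iff_compactSpace (s := (𝒪[F] : Set F))).1 ?_
    convert isCompact_norm_le (F := F) 1 using 1
    ext x
    exact mem_integer_iff
  have ho : IsOpen ((Submodule.toAddSubgroup 𝓂[F] : AddSubgroup 𝒪[F]) : Set 𝒪[F]) := by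
    have : ((Submodule.toAddSubgroup 𝓂[F] : AddSubgroup 𝒪[F]) : Set 𝒪[F])
        = (fun x : 𝒪[F] => ‖(x : F)‖) ⁻¹' Set.Iio 1 := by
      ext x; exact mem_maximalIdeal_iff
    rw [this]
    exact isOpen_Iio.preimage (continuous_norm.comp continuous_subtype_val)
  exact AddSubgroup.quotient_finite_of_isOpen _ ho

variable (F) in
theorem two_le_resCard : 2 ≤ resCard F := by
  have := Fintype.ofFinite 𝓀[F]
  rw [resCard, Nat.card_eq_fintype_card]
  exact Fintype.one_lt_card

variable [MeasurableSpace F] [BorelSpace F]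

/-- The ring of integers is the disjoint union of `q` translates of its maximal ideal. -/
theorem measure_norm_le_one_eq (μ : Measure F) [μ.IsAddHaarMeasure] :
    μ {x | ‖x‖ ≤ 1} = resCard F * μ {x | ‖x‖ < 1} := by
  have hU : {x : F | ‖x‖ ≤ 1} =
      ⋃ a : 𝓀[F], (fun x => ((Quotient.out a : 𝒪[F]) : F) + x) '' {x | ‖x‖ < 1} := by
    ext x
    simp only [Set.mem_ofPred_eq, Set.mem_iUnion, Set.mem_image]
    constructor
    · intro hx
      let y : 𝒪[F] := ⟨x, mem_integer_iff.2 hx⟩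
      refine ⟨(IsLocalRing.residue 𝒪[F] y), x - ((Quotient.out (IsLocalRing.residue 𝒪[F] y) : 𝒪[F]) : F),
        ?_, by ring⟩
      have h1 : y - Quotient.out (IsLocalRing.residue 𝒪[F] y) ∈ 𝓂[F] := by
        rw [← Ideal.Quotient.eq]
        exact (Quotient.out_eq _).symm
      exact mem_maximalIdeal_iff.1 h1
    · rintro ⟨a, z, hz, rfl⟩
      exact (IsUltrametricDist.norm_add_le_max _ _).trans
        (max_le (mem_integer_iff.1 (Quotient.out a).2) hz.le)
  have hball : IsOpen {x : F | ‖x‖ < 1} := isOpen_lt continuous_norm continuous_const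
  have := Fintype.ofFinite 𝓀[F]
  rw [hU, measure_iUnion]
  · simp only [Set.image_add_left, measure_preimage_add]
    rw [tsum_fintype, Finset.sum_const, resCard, Nat.card_eq_fintype_card, Finset.card_univ,
      nsmul_eq_mul]
  · intro a b hab
    rw [Function.onFun, Set.disjoint_left]
    rintro _ ⟨x, hx, rfl⟩ ⟨y, hy, hxy⟩
    refine hab ?_
    rw [← Quotient.out_eq a, ← Quotient.out_eq b]
    refine Ideal.Quotient.eq.2 (mem_maximalIdeal_iff.2 ?_)
    have h2 : ((Quotient.out a - Quotient.out b : 𝒪[F]) : F) = y - x := by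
      simp only [AddSubgroupClass.coe_sub]
      linear_combination -hxy
    rw [h2]
    rw [sub_eq_add_neg]
    exact (IsUltrametricDist.norm_add_le_max _ _).trans_lt (max_lt hy (by rwa [norm_neg]))
  · intro a
    simp only [Set.image_add_left]
    exact (hball.preimage (continuous_const_add _)).measurableSet

/-- Multiplication by `ϖ^(-m)` reduces this to `m = 0`. The pushforward of `μ` is again a Haar
measure, so its scaling factor need not be known. -/
theorem measure_norm_le_zpow_succ (hϖ : IsUniformizer ϖ) (μ : Measure F) [μ.IsAddHaarMeasure]
    (m : ℤ) : μ {x | ‖x‖ ≤ ‖(ϖ : F)‖ ^ m} =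
      resCard F * μ {x | ‖x‖ ≤ ‖(ϖ : F)‖ ^ (m + 1)} := by
  have h0 := norm_units_pos ϖ
  let e : F ≃ₜ+ F := ContinuousAddEquiv.mulLeft (ϖ ^ (-m) : Fˣ)
  have he : ∀ x, ‖e x‖ = (‖(ϖ : F)‖ ^ m)⁻¹ * ‖x‖ := fun x => by
    change ‖((ϖ ^ (-m) : Fˣ) : F) * x‖ = _
    simp
  have hh : (μ.map e).IsAddHaarMeasure := e.isAddHaarMeasure_map μ
  have h := measure_norm_le_one_eq (μ.map e)
  have hm : Measurable e := e.continuous.measurable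
  rw [Measure.map_apply hm (isClosed_le continuous_norm continuous_const).measurableSet,
    Measure.map_apply hm (isOpen_lt continuous_norm continuous_const).measurableSet] at h
  have hp : 0 < ‖(ϖ : F)‖ ^ m := zpow_pos h0 m
  have h1 : e ⁻¹' {x | ‖x‖ ≤ 1} = {x | ‖x‖ ≤ ‖(ϖ : F)‖ ^ m} := by
    ext x
    simp only [Set.mem_preimage, Set.mem_ofPred_eq, he]
    rw [inv_mul_le_iff₀ hp, mul_one]
  have h2 : e ⁻¹' {x | ‖x‖ < 1} = {x | ‖x‖ ≤ ‖(ϖ : F)‖ ^ (m + 1)} := by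
    ext x
    simp only [Set.mem_preimage, Set.mem_ofPred_eq]
    rw [zpow_add_one₀ h0.ne', ← inv_mul_le_iff₀ hp, ← he]
    exact ⟨hϖ.norm_le_of_lt_one, fun h => h.trans_lt hϖ.norm_lt_one⟩
  rwa [h1, h2] at h

/-- The volume of a fractional ideal, for the Haar measure giving `𝒪` volume `1`. -/
theorem measure_norm_le_zpow (hϖ : IsUniformizer ϖ) (μ : Measure F) [μ.IsAddHaarMeasure]
    (hμ : μ {x | ‖x‖ ≤ 1} = 1) (m : ℤ) :
    μ {x | ‖x‖ ≤ ‖(ϖ : F)‖ ^ m} = (resCard F : ENNReal) ^ (-m) := by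
  have hq0 : (resCard F : ENNReal) ≠ 0 := by
    have := two_le_resCard F
    simp; omega
  have hqt : (resCard F : ENNReal) ≠ ⊤ := ENNReal.natCast_ne_top _
  induction m using Int.induction_on with
  | zero => simpa using hμ
  | succ i ih =>
    rw [measure_norm_le_zpow_succ hϖ] at ih
    rw [neg_add, ENNReal.zpow_add hq0 hqt, ← ih, mul_comm, ← mul_assoc, zpow_neg_one,
      ENNReal.inv_mul_cancel hq0 hqt, one_mul]
  | pred i ih =>
    rw [measure_norm_le_zpow_succ hϖ, sub_add_cancel, ih, neg_sub, sub_neg_eq_add,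
      add_comm (1 : ℤ), ENNReal.zpow_add hq0 hqt, zpow_one, mul_comm]
    simp

end ResidueField

/-! ### The normalised absolute value -/

section NormalisedAbs

variable {F : Type*} [NontriviallyNormedField F] [IsUltrametricDist F] {ϖ : Fˣ}

theorem normAbs_mul (x y : F) : normAbs ϖ (x * y) = normAbs ϖ x * normAbs ϖ y := by
  rw [normAbs, norm_mul, Real.mul_rpow (norm_nonneg _) (norm_nonneg _)]; rfl

theorem normAbs_pos (x : Fˣ) : 0 < normAbs ϖ (x : F) := Real.rpow_pos_of_pos (norm_units_pos x) _

theorem normAbs_eq_of_norm {x y : F} (h : ‖x‖ = ‖y‖) : normAbs ϖ x = normAbs ϖ y := by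
  rw [normAbs, normAbs, h]

theorem normAbs_of_norm_one {x : F} (h : ‖x‖ = 1) : normAbs ϖ x = 1 := by
  rw [normAbs, h, Real.one_rpow]

theorem normAbs_prod {ι : Type*} (s : Finset ι) (t : ι → F) :
    normAbs ϖ (∏ i ∈ s, t i) = ∏ i ∈ s, normAbs ϖ (t i) := by
  classical
  induction s using Finset.induction_on with
  | empty => simp [normAbs]
  | insert a s ha ih => rw [Finset.prod_insert ha, Finset.prod_insert ha, normAbs_mul, ih]

theorem continuous_normAbs_units : Continuous fun x : Fˣ => normAbs ϖ (x : F) :=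
  (continuous_norm.comp Units.continuous_val).rpow_const fun x =>
    Or.inl (norm_units_pos x).ne'

variable [ProperSpace F]

theorem normAbs_eq_zpow (hϖ : IsUniformizer ϖ) (x : Fˣ) :
    normAbs ϖ (x : F) = (resCard F : ℝ) ^ (-ord hϖ x) := by
  have h2 : 0 < resCard F := by have := two_le_resCard F; omega
  rw [zpow_neg, ← inv_zpow, ← normAbs_uniformizer ϖ hϖ.norm_lt_one h2, normAbs, normAbs,
    norm_eq_zpow_ord hϖ x, ← Real.rpow_intCast, ← Real.rpow_intCast, ← Real.rpow_mul (norm_nonneg _),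
    ← Real.rpow_mul (norm_nonneg _), mul_comm]

theorem measure_norm_le_units [MeasurableSpace F] [BorelSpace F] (hϖ : IsUniformizer ϖ)
    (μ : Measure F) [μ.IsAddHaarMeasure] (hμ : μ {x | ‖x‖ ≤ 1} = 1) (t : Fˣ) :
    μ {x | ‖x‖ ≤ ‖(t : F)‖} = ENNReal.ofReal (normAbs ϖ (t : F)) := by
  have h2 : 0 < resCard F := by have := two_le_resCard F; omega
  rw [norm_eq_zpow_ord hϖ t, measure_norm_le_zpow hϖ μ hμ, normAbs_eq_zpow hϖ]
  have h3 : (0 : ℝ) < resCard F := by exact_mod_cast h2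
  obtain ⟨k, hk | hk⟩ := Int.eq_nat_or_neg (-ord hϖ t)
  · rw [hk, zpow_natCast, zpow_natCast, ENNReal.ofReal_pow h3.le, ENNReal.ofReal_natCast]
  · rw [hk, zpow_neg, ENNReal.zpow_neg, zpow_natCast, zpow_natCast, ENNReal.ofReal_inv_of_pos (by positivity),
      ENNReal.ofReal_pow h3.le, ENNReal.ofReal_natCast]

end NormalisedAbs

end ParahoricZeta

namespace ParahoricZeta

/-! ### Orthogonality of characters -/

section AdditiveCharacters

variable {V : Type*} [AddCommGroup V] [MeasurableSpace V] [MeasurableAdd V]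
  (μ : Measure V) [μ.IsAddLeftInvariant]

open Classical in
/-- Orthogonality: the integral of a character over a subgroup. -/
theorem setIntegral_char (H : AddSubgroup V) (hH : MeasurableSet (H : Set V)) {e : V → ℂ}
    (he : ∀ x y, e (x + y) = e x * e y) :
    ∫ x in (H : Set V), e x ∂μ = if ∀ x ∈ H, e x = 1 then (μ.real (H : Set V) : ℂ) else 0 := by
  split_ifs with h
  · rw [setIntegral_congr_fun hH (g := fun _ => (1 : ℂ)) (fun x hx => h x hx)]
    simp
  · push Not at h
    obtain ⟨a, ha, hne⟩ := h
    -- Translation by an `a` with `e a ≠ 1` multiplies the integral by `e a`, which forces it to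
    -- vanish.
    have h1 : ∫ x in (H : Set V), e x ∂μ = e a * ∫ x in (H : Set V), e x ∂μ := by
      rw [← integral_indicator hH, ← integral_const_mul]
      nth_rw 1 [← integral_add_left_eq_self _ a]
      congr 1
      ext x
      by_cases hx : x ∈ H
      · have : a + x ∈ H := H.add_mem ha hx
        simp [Set.indicator, hx, this, he]
      · have : a + x ∉ H := fun h' => hx (by simpa using H.add_mem (H.neg_mem ha) h')
        simp [Set.indicator, hx, this]
    have h2 : (e a - 1) * ∫ x in (H : Set V), e x ∂μ = 0 := by linear_combination -h1
    exact (mul_eq_zero.1 h2).resolve_left (sub_ne_zero.2 hne)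

/-- The integral of a character over a coset of a subgroup. -/
theorem setIntegral_char_coset (H : AddSubgroup V) (hH : MeasurableSet (H : Set V)) {e : V → ℂ}
    (he : ∀ x y, e (x + y) = e x * e y) (a : V) :
    ∫ x in {x | x - a ∈ H}, e x ∂μ = e a * ∫ x in (H : Set V), e x ∂μ := by
  have hm : MeasurableSet {x | x - a ∈ H} := by
    have : {x | x - a ∈ H} = (fun x => -a + x) ⁻¹' (H : Set V) := by
      ext x; simp [sub_eq_neg_add]
    rw [this]
    exact measurable_const_add (-a) hH
  rw [← integral_indicator hm, ← integral_indicator hH, ← integral_const_mul,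
    ← integral_add_left_eq_self _ a]
  congr 1
  ext x
  by_cases hx : x ∈ H <;> simp [Set.indicator, hx, he]

end AdditiveCharacters

/-! ### Automorphisms and Haar measure -/

section HaarAutomorphism

variable {V : Type*} [AddCommGroup V] [TopologicalSpace V] [IsTopologicalAddGroup V]
  [LocallyCompactSpace V] [SecondCountableTopology V] [MeasurableSpace V] [BorelSpace V]
  (μ : Measure V) [μ.IsAddHaarMeasure]

/-- An automorphism scales Haar measure by a positive constant. -/
theorem exists_measure_preimage_eq (e : V ≃ₜ+ V) :
    ∃ c : ENNReal, c ≠ 0 ∧ c ≠ ⊤ ∧ ∀ A : Set V, MeasurableSet A → μ (e ⁻¹' A) = c * μ A := by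
  have hh : (μ.map e).IsAddHaarMeasure := e.isAddHaarMeasure_map μ
  refine ⟨(μ.map e).addHaarScalarFactor μ, ?_, ENNReal.coe_ne_top, fun A hA => ?_⟩
  · exact_mod_cast (Measure.addHaarScalarFactor_pos_of_isAddHaarMeasure _ _).ne'
  · have hm : Measurable e := e.continuous.measurable
    rw [← Measure.map_apply hm hA]
    nth_rw 1 [Measure.isAddLeftInvariant_eq_smul (μ.map e) μ]
    rw [Measure.smul_apply, ENNReal.smul_def, smul_eq_mul]

/-- An automorphism stabilising a set of positive finite volume preserves Haar measure. -/
theorem measurePreserving_of_preimage_eq (e : V ≃ₜ+ V) {A : Set V} (hA : MeasurableSet A)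
    (h0 : μ A ≠ 0) (ht : μ A ≠ ⊤) (h : e ⁻¹' A = A) : MeasurePreserving e μ μ := by
  obtain ⟨c, -, -, hc⟩ := exists_measure_preimage_eq μ e
  have h1 : c = 1 := by
    have := hc A hA
    rw [h] at this
    exact (ENNReal.mul_eq_right h0 ht).1 this.symm
  have hm : Measurable e := e.continuous.measurable
  refine ⟨hm, Measure.ext fun s hs => ?_⟩
  rw [Measure.map_apply hm hs, hc s hs, h1, one_mul]

/-- A conjugate of an automorphism scales Haar measure by the same constant. -/
theorem measurePreserving_of_conj {e d : V ≃ₜ+ V}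
    (h : MeasurePreserving (fun x => d (e (d.symm x))) μ μ) : MeasurePreserving e μ μ := by
  obtain ⟨c, hc0, hct, hc⟩ := exists_measure_preimage_eq μ d
  have hm : Measurable e := e.continuous.measurable
  refine ⟨hm, Measure.ext fun s hs => ?_⟩
  rw [Measure.map_apply hm hs]
  have hd : Measurable d.symm := d.symm.continuous.measurable
  have h1 : ∀ A : Set V, MeasurableSet A → μ A = c * μ (d.symm ⁻¹' A) := fun A hA => by
    rw [← hc _ (hd hA)]
    congr 1
    ext x
    simp
  have hes : MeasurableSet (e ⁻¹' s) := hm hs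
  rw [h1 _ hes, h1 s hs]
  congr 1
  rw [← h.measure_preimage (hd hs).nullMeasurableSet]
  congr 1
  ext x
  simp

end HaarAutomorphism

/-! ### Comparing measures on cosets of an open subgroup -/

section LocallyConstant

variable {G : Type*} [Group G] [TopologicalSpace G] [IsTopologicalGroup G] {H : Subgroup G}

theorem isOpen_of_mul_mem (hH : IsOpen (H : Set G)) {S : Set G}
    (hS : ∀ g ∈ S, ∀ k ∈ H, g * k ∈ S) : IsOpen S := by
  have hd : DiscreteTopology (G ⧸ H) := QuotientGroup.discreteTopology hH
  have : S = (QuotientGroup.mk : G → G ⧸ H) ⁻¹' ((QuotientGroup.mk : G → G ⧸ H) '' S) := by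
    refine (Set.subset_preimage_image _ _).antisymm ?_
    rintro x ⟨y, hy, hxy⟩
    have := hS y hy _ (QuotientGroup.eq.1 hxy)
    simpa using this
  rw [this]
  exact (isOpen_discrete _).preimage QuotientGroup.continuous_mk

theorem continuous_of_mul_eq (hH : IsOpen (H : Set G)) {E : Type*} [TopologicalSpace E]
    {f : G → E} (hf : ∀ g, ∀ k ∈ H, f (g * k) = f g) : Continuous f :=
  ⟨fun s _ => isOpen_of_mul_mem hH fun g hg k hk => by
    change f (g * k) ∈ s
    rw [hf g k hk]; exact hg⟩

end LocallyConstant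

section Cosets

variable {G : Type*} [Group G] [TopologicalSpace G] [IsTopologicalGroup G]
  [SecondCountableTopology G] [MeasurableSpace G] [BorelSpace G] {H : Subgroup G}

/-- The quotient by an open subgroup is discrete and, by second countability, countable. A measure
on it is thus determined by the masses of points, which are the measures of cosets. This avoids
comparing `m₁` and `m₂` on any finer set. -/
theorem map_mk_eq_of_cosets (hH : IsOpen (H : Set G)) {m₁ m₂ : Measure G} {c : ENNReal}
    (h : ∀ g, m₁ {x | g⁻¹ * x ∈ H} = c * m₂ {x | g⁻¹ * x ∈ H}) :
    m₁.map (QuotientGroup.mk : G → G ⧸ H) = c • m₂.map (QuotientGroup.mk : G → G ⧸ H) := by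
  have hd : DiscreteTopology (G ⧸ H) := QuotientGroup.discreteTopology hH
  have hc : Countable (G ⧸ H) := TopologicalSpace.separableSpace_iff_countable.1 inferInstance
  have hm : Measurable (QuotientGroup.mk : G → G ⧸ H) := measurable_quotient_mk''
  have hs : ∀ a : G ⧸ H, MeasurableSet {a} := fun a => by
    rw [measurableSet_quotient]
    exact ((isOpen_discrete {a}).preimage QuotientGroup.continuous_mk).measurableSet
  refine Measure.ext_of_singleton fun a => ?_
  obtain ⟨g, rfl⟩ := QuotientGroup.mk_surjective a
  have hp : (QuotientGroup.mk : G → G ⧸ H) ⁻¹' {QuotientGroup.mk g} = {x | g⁻¹ * x ∈ H} := by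
    ext x
    simp only [Set.mem_preimage, Set.mem_singleton_iff, Set.mem_ofPred_eq]
    rw [eq_comm, QuotientGroup.eq]
  rw [Measure.smul_apply, Measure.map_apply hm (hs _), Measure.map_apply hm (hs _), hp, h,
    smul_eq_mul]

theorem stronglyMeasurable_quotient (hH : IsOpen (H : Set G)) {E : Type*} [TopologicalSpace E]
    [MeasurableSpace E] [TopologicalSpace.PseudoMetrizableSpace E] [BorelSpace E]
    [SecondCountableTopology E] (f : G ⧸ H → E) : StronglyMeasurable f := by
  have hd : DiscreteTopology (G ⧸ H) := QuotientGroup.discreteTopology hH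
  refine Measurable.stronglyMeasurable fun s _ => ?_
  rw [measurableSet_quotient]
  exact ((isOpen_discrete (f ⁻¹' s)).preimage QuotientGroup.continuous_mk).measurableSet

theorem integrable_of_cosets (hH : IsOpen (H : Set G)) {m₁ m₂ : Measure G} {c : ENNReal}
    (hc : c ≠ ⊤) (h : ∀ g, m₁ {x | g⁻¹ * x ∈ H} = c * m₂ {x | g⁻¹ * x ∈ H}) {f : G → ℂ}
    (hf : ∀ g, ∀ k ∈ H, f (g * k) = f g) (hi : Integrable f m₂) : Integrable f m₁ := by
  have hm : Measurable (QuotientGroup.mk : G → G ⧸ H) := measurable_quotient_mk''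
  let f' : G ⧸ H → ℂ := Quotient.lift f fun a b hab => by
    have := hf a _ (QuotientGroup.leftRel_apply.1 hab)
    simpa using this.symm
  have hff : f = f' ∘ QuotientGroup.mk := rfl
  have hsm : StronglyMeasurable f' := stronglyMeasurable_quotient hH f'
  rw [hff, ← integrable_map_measure hsm.aestronglyMeasurable hm.aemeasurable] at hi ⊢
  rw [map_mk_eq_of_cosets hH h]
  exact hi.smul_measure hc

theorem integral_eq_of_cosets (hH : IsOpen (H : Set G)) {m₁ m₂ : Measure G} {c : ENNReal}
    (h : ∀ g, m₁ {x | g⁻¹ * x ∈ H} = c * m₂ {x | g⁻¹ * x ∈ H}) {f : G → ℂ}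
    (hf : ∀ g, ∀ k ∈ H, f (g * k) = f g) : ∫ x, f x ∂m₁ = c.toReal * ∫ x, f x ∂m₂ := by
  have hm : Measurable (QuotientGroup.mk : G → G ⧸ H) := measurable_quotient_mk''
  let f' : G ⧸ H → ℂ := Quotient.lift f fun a b hab => by
    have := hf a _ (QuotientGroup.leftRel_apply.1 hab)
    simpa using this.symm
  have hsm : StronglyMeasurable f' := stronglyMeasurable_quotient hH f'
  have h1 : ∀ m : Measure G, ∫ x, f x ∂m = ∫ y, f' y ∂(m.map (QuotientGroup.mk : G → G ⧸ H)) :=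
    fun m => (integral_map hm.aemeasurable hsm.aestronglyMeasurable).symm
  rw [h1, h1, map_mk_eq_of_cosets hH h, integral_smul_measure, Complex.real_smul]

/-- The proportionality is assumed only on cosets inside `S`. Restricting both measures to `S` makes
it hold on every coset, since those that miss `S` become null. -/
theorem measure_eq_of_cosets (hH : IsOpen (H : Set G)) {m₁ m₂ : Measure G} {c : ENNReal}
    {S : Set G} (hS : ∀ g ∈ S, ∀ k ∈ H, g * k ∈ S)
    (h : ∀ g ∈ S, m₁ {x | g⁻¹ * x ∈ H} = c * m₂ {x | g⁻¹ * x ∈ H}) : m₁ S = c * m₂ S := by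
  have hSm : MeasurableSet S := (isOpen_of_mul_mem hH hS).measurableSet
  have key : ∀ g, (m₁.restrict S) {x | g⁻¹ * x ∈ H} = c * (m₂.restrict S) {x | g⁻¹ * x ∈ H} := by
    intro g
    rw [Measure.restrict_apply' hSm, Measure.restrict_apply' hSm]
    rcases ({x | g⁻¹ * x ∈ H} ∩ S).eq_empty_or_nonempty with he | ⟨x, hx, hxS⟩
    · rw [he]; simp
    · have hg : g ∈ S := by
        have := hS x hxS _ (H.inv_mem hx)
        simpa using this
      have : {x | g⁻¹ * x ∈ H} ∩ S = {x | g⁻¹ * x ∈ H} := by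
        refine Set.inter_eq_left.2 fun y hy => ?_
        have := hS g hg _ hy
        simpa using this
      rw [this, h g hg]
  have := congrArg (fun m => m Set.univ) (map_mk_eq_of_cosets hH key)
  have hm : Measurable (QuotientGroup.mk : G → G ⧸ H) := measurable_quotient_mk''
  simpa [Measure.map_apply hm MeasurableSet.univ] using this

end Cosets

section CompactSubgroup

variable {G : Type*} [Group G] [TopologicalSpace G] [IsTopologicalGroup G]
  [SecondCountableTopology G] [MeasurableSpace G] [BorelSpace G] {K : Subgroup G}
  (m : Measure G) [m.IsMulLeftInvariant]

theorem measurePreserving_mul_left_restrict (hK : MeasurableSet (K : Set G)) {a : G}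
    (ha : a ∈ K) : MeasurePreserving (a * ·) (m.restrict K) (m.restrict K) := by
  have h := (measurePreserving_mul_left m a).restrict_preimage hK
  have : (a * ·) ⁻¹' (K : Set G) = K := by
    ext x
    exact K.mul_mem_cancel_left ha
  rwa [this] at h

/-- The restriction of a Haar measure to a compact subgroup is invariant under inversion. -/
theorem map_inv_restrict (hK : MeasurableSet (K : Set G)) (h0 : m K ≠ 0) (ht : m K ≠ ⊤) :
    (m.restrict K).map (·⁻¹) = m.restrict K := by
  have hfin : IsFiniteMeasure (m.restrict K) := ⟨by simpa using lt_top_iff_ne_top.2 ht⟩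
  refine Measure.ext_of_lintegral _ fun f hf => ?_
  rw [lintegral_map hf measurable_inv]
  have hl : ∀ {a : G}, a ∈ K → ∀ g : G → ENNReal, Measurable g →
      ∫⁻ x in K, g (a * x) ∂m = ∫⁻ x in K, g x ∂m := fun ha g hg =>
    (measurePreserving_mul_left_restrict m hK ha).lintegral_comp hg
  -- The double integral of `f (a⁻¹ b)` is evaluated in both orders by left invariance alone: one
  -- gives the integral of `f b`, the other that of `f a⁻¹`.
  have e1 : ∫⁻ a in K, ∫⁻ b in K, f (a⁻¹ * b) ∂m ∂m = m K * ∫⁻ b in K, f b ∂m := by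
    rw [setLIntegral_congr_fun hK (g := fun _ => ∫⁻ b in K, f b ∂m)
      (fun a ha => hl (K.inv_mem ha) f hf)]
    simp [mul_comm]
  have e2 : ∫⁻ b in K, ∫⁻ a in K, f (a⁻¹ * b) ∂m ∂m = m K * ∫⁻ a in K, f a⁻¹ ∂m := by
    rw [setLIntegral_congr_fun hK (g := fun _ => ∫⁻ a in K, f a⁻¹ ∂m)]
    · simp [mul_comm]
    · intro b hb
      have := hl (K.inv_mem hb) (fun x => f x⁻¹) (hf.comp measurable_inv)
      simpa using this
  rw [lintegral_lintegral_swap] at e1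
  · rw [e2] at e1
    exact (ENNReal.mul_right_inj h0 ht).1 e1
  · exact (hf.comp (by fun_prop : Measurable fun p : G × G => p.1⁻¹ * p.2)).aemeasurable

end CompactSubgroup

end ParahoricZeta

namespace ParahoricZeta

/-! ### The topology of the general linear group -/

section GLTopology

variable {F : Type*} [NontriviallyNormedField F] [IsUltrametricDist F] {ι : Type*} [Fintype ι]
  [DecidableEq ι]

/-- By Cramer's formula inversion is continuous where the determinant is nonzero, so the topology of
the unit group is the subspace topology. The Borel structure, second countability and local
compactness of the group are all inherited through this embedding. -/
theorem GL_isOpenEmbedding_val :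
    Topology.IsOpenEmbedding (Units.val : GL ι F → Matrix ι ι F) := by
  have hd : Continuous fun A : Matrix ι ι F => A.det := continuous_id.matrix_det
  have hu : ∀ A : Matrix ι ι F, IsUnit A ↔ A.det ≠ 0 := fun A => by
    rw [Matrix.isUnit_iff_isUnit_det, isUnit_iff_ne_zero]
  refine ⟨Units.isEmbedding_val_mk' (f := fun A => A⁻¹) ?_ fun u => (Matrix.coe_units_inv u).symm, ?_⟩
  · have : (fun A : Matrix ι ι F => A⁻¹) = fun A => A.det⁻¹ • A.adjugate := by
      ext1 A
      rw [Matrix.inv_def, Ring.inverse_eq_inv']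
    rw [this]
    exact (hd.continuousOn.inv₀ fun A hA => (hu A).1 hA).smul
      (continuous_id.matrix_adjugate).continuousOn
  · have : Set.range (Units.val : GL ι F → Matrix ι ι F) = {A | A.det ≠ 0} := by
      ext A
      exact hu A
    rw [this]
    exact isOpen_ne_fun hd continuous_const

instance GL_borelSpace [MeasurableSpace (Matrix ι ι F)]
    [BorelSpace (Matrix ι ι F)] : BorelSpace (GL ι F) := by
  refine ⟨?_⟩
  have h1 := (GL_isOpenEmbedding_val (F := F) (ι := ι)).eq_induced
  rw [h1, borel_comap, ← BorelSpace.measurable_eq (α := Matrix ι ι F)]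
  rfl

instance matrix_secondCountable [ProperSpace F] : SecondCountableTopology (Matrix ι ι F) :=
  inferInstanceAs (SecondCountableTopology (ι → ι → F))

instance matrix_locallyCompact [ProperSpace F] : LocallyCompactSpace (Matrix ι ι F) :=
  inferInstanceAs (LocallyCompactSpace (ι → ι → F))

instance GL_secondCountable [ProperSpace F] : SecondCountableTopology (GL ι F) :=
  (GL_isOpenEmbedding_val (F := F) (ι := ι)).isEmbedding.secondCountableTopology

instance GL_locallyCompact [ProperSpace F] : LocallyCompactSpace (GL ι F) :=
  (GL_isOpenEmbedding_val (F := F) (ι := ι)).locallyCompactSpace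

theorem continuous_GL_apply (i j : ι) : Continuous fun g : GL ι F => g.val i j :=
  (Units.continuous_val (M := Matrix ι ι F)).matrix_elem i j

theorem continuous_GL_inv_apply (i j : ι) : Continuous fun g : GL ι F => (g⁻¹).val i j :=
  (continuous_GL_apply i j).comp continuous_inv

theorem continuous_GL_of_val {X : Type*} [TopologicalSpace X] {f : X → GL ι F}
    (h : Continuous fun x => (f x).val) : Continuous f :=
  (GL_isOpenEmbedding_val (F := F) (ι := ι)).isEmbedding.continuous_iff.2 h

theorem continuous_GL_det : Continuous fun g : GL ι F => Matrix.GeneralLinearGroup.det g := by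
  rw [Units.continuous_iff]
  refine ⟨Continuous.matrix_det Units.continuous_val, ?_⟩
  have : (fun g : GL ι F => ((Matrix.GeneralLinearGroup.det g)⁻¹).val) =
      fun g : GL ι F => (g⁻¹).val.det := by
    ext g
    rw [← map_inv]; rfl
  exact this ▸ (Continuous.matrix_det (Units.continuous_val.comp continuous_inv))

end GLTopology

/-! ### Integral matrices and congruence subgroups -/

section IntegralMatrices

variable {F : Type*} [NontriviallyNormedField F] [IsUltrametricDist F] {ι : Type*} [Fintype ι]
  [DecidableEq ι]

theorem norm_det_le_one {A : Matrix ι ι F} (hA : ∀ i j, ‖A i j‖ ≤ 1) : ‖A.det‖ ≤ 1 := by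
  rw [Matrix.det_apply']
  refine IsUltrametricDist.norm_sum_le_of_forall_le_of_nonneg zero_le_one fun σ _ => ?_
  rw [norm_mul, norm_prod]
  have h1 : ‖((Equiv.Perm.sign σ : ℤ) : F)‖ ≤ 1 := by
    rcases Int.units_eq_one_or (Equiv.Perm.sign σ) with h | h <;> simp [h]
  exact mul_le_one₀ h1 (Finset.prod_nonneg fun _ _ => norm_nonneg _)
    (Finset.prod_le_one (fun _ _ => norm_nonneg _) fun _ _ => hA _ _)

variable (F ι) in
/-- `GL(𝒪)` as a subgroup of `GL(F)`. -/
noncomputable def intGL : Subgroup (GL ι F) :=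
  (Matrix.GeneralLinearGroup.map (n := ι) (algebraMap 𝒪[F] F)).range

theorem mem_intGL_iff {g : GL ι F} :
    g ∈ intGL F ι ↔ (∀ i j, ‖g.val i j‖ ≤ 1) ∧ ∀ i j, ‖(g⁻¹).val i j‖ ≤ 1 := by
  constructor
  · rintro ⟨g₀, rfl⟩
    refine ⟨fun i j => mem_integer_iff.1 (g₀.val i j).2, fun i j => ?_⟩
    rw [← map_inv]
    exact mem_integer_iff.1 ((g₀⁻¹).val i j).2
  · rintro ⟨h1, h2⟩
    let A : Matrix ι ι 𝒪[F] := fun i j => ⟨g.val i j, mem_integer_iff.2 (h1 i j)⟩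
    let B : Matrix ι ι 𝒪[F] := fun i j => ⟨(g⁻¹).val i j, mem_integer_iff.2 (h2 i j)⟩
    have hinj : Function.Injective fun M : Matrix ι ι 𝒪[F] => M.map (algebraMap 𝒪[F] F) :=
      Matrix.map_injective Subtype.val_injective
    have hA : A.map (algebraMap 𝒪[F] F) = g.val := rfl
    have hB : B.map (algebraMap 𝒪[F] F) = (g⁻¹).val := rfl
    refine ⟨⟨A, B, hinj ?_, hinj ?_⟩, Units.ext rfl⟩
    · simp only [Matrix.map_mul, hA, hB]
      rw [g.mul_inv]; simp
    · simp only [Matrix.map_mul, hA, hB]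
      rw [g.inv_mul]; simp

theorem norm_det_of_mem_intGL {g : GL ι F} (hg : g ∈ intGL F ι) : ‖g.val.det‖ = 1 := by
  have h1 := norm_det_le_one (mem_intGL_iff.1 hg).1
  have h2 := norm_det_le_one (mem_intGL_iff.1 hg).2
  have h3 : ‖g.val.det‖ * ‖(g⁻¹).val.det‖ = 1 := by
    rw [← norm_mul, ← Matrix.det_mul, g.mul_inv, Matrix.det_one, norm_one]
  nlinarith [norm_nonneg g.val.det, norm_nonneg (g⁻¹).val.det]

/-- The inverse is the adjugate, whose entries are determinants of integral matrices, divided by a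
determinant of norm `1`. -/
theorem mem_intGL_of_det {g : GL ι F} (h : ∀ i j, ‖g.val i j‖ ≤ 1) (hd : ‖g.val.det‖ = 1) :
    g ∈ intGL F ι := by
  refine mem_intGL_iff.2 ⟨h, fun i j => ?_⟩
  rw [Matrix.coe_units_inv, Matrix.inv_def, Matrix.smul_apply, smul_eq_mul, norm_mul,
    Ring.inverse_eq_inv', norm_inv, hd, inv_one, one_mul, Matrix.adjugate_apply]
  refine norm_det_le_one fun k l => ?_
  rw [Matrix.updateRow_apply]
  split_ifs
  · rw [Pi.single_apply]; split_ifs <;> simp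
  · exact h k l

theorem isOpen_intGL [ProperSpace F] : IsOpen (intGL F ι : Set (GL ι F)) := by
  have : (intGL F ι : Set (GL ι F)) =
      (⋂ i, ⋂ j, {g : GL ι F | ‖g.val i j‖ ≤ 1}) ∩ ⋂ i, ⋂ j, {g : GL ι F | ‖(g⁻¹).val i j‖ ≤ 1} := by
    ext g
    simp [mem_intGL_iff]
  rw [this]
  refine IsOpen.inter (isOpen_iInter_of_finite fun i => isOpen_iInter_of_finite fun j => ?_)
    (isOpen_iInter_of_finite fun i => isOpen_iInter_of_finite fun j => ?_)
  · exact (isOpen_norm_le one_pos).preimage (continuous_GL_apply i j)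
  · exact (isOpen_norm_le one_pos).preimage (continuous_GL_inv_apply i j)

theorem isCompact_integral_matrices [ProperSpace F] (κ : Type*) [Finite κ] (r : ℝ) :
    IsCompact {A : Matrix ι κ F | ∀ i j, ‖A i j‖ ≤ r} := by
  have : {A : Matrix ι κ F | ∀ i j, ‖A i j‖ ≤ r} =
      Set.pi Set.univ fun _ : ι => Set.pi Set.univ fun _ : κ => {x : F | ‖x‖ ≤ r} := by
    ext A
    exact ⟨fun h i _ j _ => h i j, fun h i j => h i trivial j trivial⟩
  rw [this]
  exact isCompact_univ_pi fun _ => isCompact_univ_pi fun _ => isCompact_norm_le r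

theorem isCompact_intGL [ProperSpace F] : IsCompact (intGL F ι : Set (GL ι F)) := by
  have he := GL_isOpenEmbedding_val (F := F) (ι := ι)
  have h1 : (intGL F ι : Set (GL ι F)) = (Units.val : GL ι F → Matrix ι ι F) ⁻¹'
      ({A : Matrix ι ι F | ∀ i j, ‖A i j‖ ≤ 1} ∩ {A | ‖A.det‖ = 1}) := by
    ext g
    exact ⟨fun h => ⟨(mem_intGL_iff.1 h).1, norm_det_of_mem_intGL h⟩,
      fun h => mem_intGL_of_det h.1 h.2⟩
  rw [h1, he.isInducing.isCompact_preimage_iff]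
  · refine (isCompact_integral_matrices ι 1).inter_right ?_
    exact isClosed_eq (continuous_norm.comp (Continuous.matrix_det continuous_id)) continuous_const
  · intro A hA
    have hd : IsUnit A.det := by
      refine isUnit_iff_ne_zero.2 fun h => ?_
      have := hA.2
      simp [h] at this
    exact ((Matrix.isUnit_iff_isUnit_det A).2 hd)

/-- The principal congruence subgroup of matrices congruent to `1` up to `r`. -/
noncomputable def congruenceGL (F : Type*) [NontriviallyNormedField F] [IsUltrametricDist F] (ι : Type*)
    [Fintype ι] [DecidableEq ι] {r : ℝ} (hr : 0 ≤ r) : Subgroup (GL ι F) where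
  carrier := {g | g ∈ intGL F ι ∧ ∀ i j, ‖(g.val - 1) i j‖ ≤ r}
  one_mem' := ⟨one_mem _, fun i j => by simpa using hr⟩
  mul_mem' := by
    rintro a b ⟨ha, ha'⟩ ⟨hb, hb'⟩
    refine ⟨mul_mem ha hb, fun i j => ?_⟩
    have : (a * b).val - 1 = (a.val - 1) * b.val + (b.val - 1) := by
      rw [Units.val_mul]; noncomm_ring
    rw [this, Matrix.add_apply]
    refine (IsUltrametricDist.norm_add_le_max _ _).trans (max_le ?_ (hb' i j))
    simpa using norm_mul_apply_le hr zero_le_one ha' (mem_intGL_iff.1 hb).1 i j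
  inv_mem' := by
    rintro a ⟨ha, ha'⟩
    refine ⟨inv_mem ha, fun i j => ?_⟩
    have : (a⁻¹).val - 1 = -((a.val - 1) * (a⁻¹).val) := by
      rw [sub_mul, a.mul_inv]; simp
    rw [this, Matrix.neg_apply, norm_neg]
    simpa using norm_mul_apply_le hr zero_le_one ha' (mem_intGL_iff.1 ha).2 i j

theorem mem_congruenceGL_iff {r : ℝ} {hr : 0 ≤ r} {g : GL ι F} :
    g ∈ congruenceGL F ι hr ↔ g ∈ intGL F ι ∧ ∀ i j, ‖(g.val - 1) i j‖ ≤ r := Iff.rfl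

theorem isOpen_congruenceGL [ProperSpace F] {r : ℝ} (hr : 0 < r) :
    IsOpen (congruenceGL F ι hr.le : Set (GL ι F)) := by
  have : (congruenceGL F ι hr.le : Set (GL ι F)) =
      (intGL F ι : Set (GL ι F)) ∩ ⋂ i, ⋂ j, {g : GL ι F | ‖(g.val - 1) i j‖ ≤ r} := by
    ext g
    simp [mem_congruenceGL_iff]
  rw [this]
  refine isOpen_intGL.inter (isOpen_iInter_of_finite fun i => isOpen_iInter_of_finite fun j => ?_)
  exact (isOpen_norm_le hr).preimage
    ((continuous_GL_apply i j).sub (continuous_const (y := (1 : Matrix ι ι F) i j)))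

end IntegralMatrices

section FrozenSubgroups

variable {F : Type*} [NontriviallyNormedField F] [IsUltrametricDist F] {n : ℕ}

theorem maxCompact_eq : maxCompact F n = (intGL F (Fin n) : Set (GL (Fin n) F)) := rfl

theorem mem_iwahori_iff {g : GL (Fin n) F} :
    g ∈ iwahori F n ↔ g ∈ intGL F (Fin n) ∧ ∀ i j, j < i → ‖g.val i j‖ < 1 := by
  constructor
  · rintro ⟨g₀, rfl, h⟩
    exact ⟨⟨g₀, rfl⟩, fun i j hij => mem_maximalIdeal_iff.1 (h i j hij)⟩
  · rintro ⟨⟨g₀, rfl⟩, h⟩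
    exact ⟨g₀, rfl, fun i j hij => mem_maximalIdeal_iff.2 (h i j hij)⟩

theorem mem_parahoric_iff {g : GL (Fin n ⊕ Fin n) F} :
    g ∈ parahoric F n ↔ g ∈ intGL F (Fin n ⊕ Fin n) ∧
      ∀ i j, ‖g.val (Sum.inr i) (Sum.inl j)‖ < 1 := by
  constructor
  · rintro ⟨g₀, rfl, h⟩
    exact ⟨⟨g₀, rfl⟩, fun i j => mem_maximalIdeal_iff.1 (h i j)⟩
  · rintro ⟨⟨g₀, rfl⟩, h⟩
    exact ⟨g₀, rfl, fun i j => mem_maximalIdeal_iff.2 (h i j)⟩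

end FrozenSubgroups

end ParahoricZeta

namespace ParahoricZeta

/-! ### Upper triangular matrices and the Iwasawa decomposition -/

section UpperTriangular

variable {F : Type*} [NontriviallyNormedField F] [IsUltrametricDist F] {n : ℕ}

/-- The positions strictly above the diagonal. -/
abbrev StrictPair (n : ℕ) := {p : Fin n × Fin n // p.1 < p.2}

/-- The upper triangular matrix with diagonal `t` and strictly upper triangular entries `y`. -/
def upMat (t : Fin n → Fˣ) (y : StrictPair n → F) : Matrix (Fin n) (Fin n) F :=
  Matrix.of fun i j => if h : i < j then y ⟨(i, j), h⟩ else if i = j then (t i : F) else 0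

theorem upMat_diag (t : Fin n → Fˣ) (y : StrictPair n → F) (i : Fin n) : upMat t y i i = t i := by
  simp [upMat]

theorem upMat_of_lt (t : Fin n → Fˣ) (y : StrictPair n → F) {i j : Fin n} (h : i < j) :
    upMat t y i j = y ⟨(i, j), h⟩ := by
  simp [upMat, h]

theorem upMat_blockTriangular (t : Fin n → Fˣ) (y : StrictPair n → F) :
    (upMat t y).BlockTriangular id := by
  intro i j h
  have h : j < i := h
  simp [upMat, h.not_gt, h.ne']

theorem det_upMat (t : Fin n → Fˣ) (y : StrictPair n → F) : (upMat t y).det = ∏ i, (t i : F) := by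
  rw [Matrix.det_of_isUpperTriangular (upMat_blockTriangular t y)]
  simp [upMat_diag]

/-- `upMat` as an invertible matrix. -/
noncomputable def upGL (t : Fin n → Fˣ) (y : StrictPair n → F) : GL (Fin n) F :=
  Matrix.GeneralLinearGroup.mkOfDetNeZero (upMat t y) (by
    rw [det_upMat]
    exact Finset.prod_ne_zero_iff.2 fun i _ => (t i).ne_zero)

theorem upGL_val (t : Fin n → Fˣ) (y : StrictPair n → F) : (upGL t y).val = upMat t y := rfl

theorem eq_upGL {g : GL (Fin n) F} {t : Fin n → Fˣ} {y : StrictPair n → F}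
    (h0 : ∀ i j, j < i → g.val i j = 0) (h1 : ∀ i, g.val i i = t i)
    (h2 : ∀ p : StrictPair n, g.val p.1.1 p.1.2 = y p) : g = upGL t y := by
  refine Units.ext ?_
  ext i j
  rw [upGL_val]
  rcases lt_trichotomy i j with h | rfl | h
  · rw [upMat_of_lt t y h]; exact h2 ⟨(i, j), h⟩
  · rw [upMat_diag, h1]
  · rw [h0 i j h, upMat_blockTriangular t y h]

variable (F n) in
/-- The group of invertible upper triangular matrices. -/
noncomputable def upperGL : Subgroup (GL (Fin n) F) where
  carrier := {g | g.val.BlockTriangular id}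
  one_mem' := Matrix.blockTriangular_one
  mul_mem' ha hb := Matrix.BlockTriangular.mul ha hb
  inv_mem' := by
    intro a ha
    change (a⁻¹).val.BlockTriangular id
    rw [Matrix.coe_units_inv]
    have := a.invertible
    exact Matrix.blockTriangular_inv_of_blockTriangular ha

theorem upGL_mem (t : Fin n → Fˣ) (y : StrictPair n → F) : upGL t y ∈ upperGL F n :=
  upMat_blockTriangular t y

theorem mul_apply_diag {A B : Matrix (Fin n) (Fin n) F} (hA : A.BlockTriangular id)
    (hB : B.BlockTriangular id) (i : Fin n) : (A * B) i i = A i i * B i i := by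
  rw [Matrix.mul_apply, Finset.sum_eq_single i]
  · intro k _ hk
    rcases hk.lt_or_gt with h | h
    · rw [hA h, zero_mul]
    · rw [hB h, mul_zero]
  · simp

theorem inv_apply_diag {b : GL (Fin n) F} (hb : b ∈ upperGL F n) (i : Fin n) :
    (b⁻¹).val i i = (b.val i i)⁻¹ := by
  have h := mul_apply_diag hb ((upperGL F n).inv_mem hb) i
  rw [b.mul_inv, Matrix.one_apply_eq] at h
  exact eq_inv_of_mul_eq_one_right h.symm

theorem diag_ne_zero {b : GL (Fin n) F} (hb : b ∈ upperGL F n) (i : Fin n) : b.val i i ≠ 0 := by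
  have h := mul_apply_diag hb ((upperGL F n).inv_mem hb) i
  rw [b.mul_inv, Matrix.one_apply_eq] at h
  exact left_ne_zero_of_mul_eq_one h.symm

theorem diag_norm_of_mem_intGL {b : GL (Fin n) F} (hb : b ∈ upperGL F n)
    (hk : b ∈ intGL F (Fin n)) (i : Fin n) : ‖b.val i i‖ = 1 := by
  refine le_antisymm ((mem_intGL_iff.1 hk).1 i i) ?_
  have := (mem_intGL_iff.1 hk).2 i i
  rw [inv_apply_diag hb, norm_inv] at this
  exact (inv_le_one₀ (norm_pos_iff.2 (diag_ne_zero hb i))).1 this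

/-- The Iwasawa decomposition. -/
theorem exists_eq_upGL_mul [ProperSpace F] (h : GL (Fin n) F) :
    ∃ (t : Fin n → Fˣ) (y : StrictPair n → F), ∃ k ∈ intGL F (Fin n), h = upGL t y * k := by
  -- `D j` consists of the integral vectors that `h` sends to vectors vanishing below row `j`. In
  -- each `D j` compactness provides a vector `c j` for which coordinate `j` of the image is of
  -- maximal norm. The matrix `m` with columns `c j` is integral and `h m` is upper triangular.
  -- Maximality will give that `m⁻¹` is integral too.
  let D : Fin n → Set (Fin n → F) := fun j =>
    {c | (∀ i, ‖c i‖ ≤ 1) ∧ ∀ i, j < i → (h.val.mulVec c) i = 0}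
  have hcont : Continuous fun c : Fin n → F => h.val.mulVec c :=
    continuous_const.matrix_mulVec continuous_id
  have hD : ∀ j, IsCompact (D j) := fun j => by
    have h1 : IsCompact (Set.pi Set.univ fun _ : Fin n => {x : F | ‖x‖ ≤ 1}) :=
      isCompact_univ_pi fun _ => isCompact_norm_le 1
    have h2 : IsClosed {c : Fin n → F | ∀ i, j < i → (h.val.mulVec c) i = 0} := by
      have : {c : Fin n → F | ∀ i, j < i → (h.val.mulVec c) i = 0} =
          ⋂ i, ⋂ (_ : j < i), {c | (h.val.mulVec c) i = 0} := by ext; simp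
      rw [this]
      exact isClosed_iInter fun i => isClosed_iInter fun _ =>
        isClosed_eq ((continuous_apply i).comp hcont) continuous_const
    convert h1.inter_right h2 using 1
    ext c
    simp [D]
  have hmax : ∀ j, ∃ c ∈ D j, ∀ c' ∈ D j, ‖(h.val.mulVec c') j‖ ≤ ‖(h.val.mulVec c) j‖ := by
    intro j
    obtain ⟨c, hc, hm⟩ := (hD j).exists_isMaxOn ⟨0, by simp [D]⟩
      ((continuous_norm.comp ((continuous_apply j).comp hcont)).continuousOn)
    exact ⟨c, hc, fun c' hc' => hm hc'⟩
  choose c hc hcm using hmax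
  let m : Matrix (Fin n) (Fin n) F := Matrix.of fun i j => c j i
  have hb : ∀ i j, (h.val * m) i j = (h.val.mulVec (c j)) i := fun i j => rfl
  have hb0 : ∀ i j, j < i → (h.val * m) i j = 0 := fun i j hij => (hc j).2 i hij
  -- A small multiple of `h⁻¹ e_j` lies in `D j` and its image has nonzero coordinate `j`, so the
  -- maximum is not zero.
  have hbd : ∀ j, (h.val * m) j j ≠ 0 := by
    intro j hj
    let v : Fin n → F := (h⁻¹).val.mulVec (Pi.single j 1)
    obtain ⟨a, ha0, ha⟩ := NormedField.exists_norm_lt F (r := (1 + ‖v‖)⁻¹) (by positivity)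
    have ha' : a ≠ 0 := norm_pos_iff.1 ha0
    have hv : h.val.mulVec (a • v) = a • Pi.single j 1 := by
      rw [Matrix.mulVec_smul, Matrix.mulVec_mulVec, h.mul_inv, Matrix.one_mulVec]
    have hmem : a • v ∈ D j := by
      refine ⟨fun i => ?_, fun i hi => ?_⟩
      · rw [Pi.smul_apply, smul_eq_mul, norm_mul]
        have h1 : ‖v i‖ ≤ 1 + ‖v‖ := (norm_le_pi_norm v i).trans (by linarith)
        calc ‖a‖ * ‖v i‖ ≤ (1 + ‖v‖)⁻¹ * (1 + ‖v‖) := by gcongr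
          _ = 1 := inv_mul_cancel₀ (by positivity)
      · rw [hv]; simp [hi.ne']
    have := hcm j _ hmem
    rw [hv, ← hb, hj, norm_zero] at this
    simp [ha'] at this
  -- Elimination from the bottom row up: the multiple `a` of `c i₀` that clears row `k` has `‖a‖ ≤
  -- 1` because `c i₀` attains the maximum. Hence `m⁻¹ x` is integral for every integral `x`; basis
  -- vectors then give `m⁻¹` itself.
  have key : ∀ k ≤ n, ∀ x : Fin n → F, (∀ i, ‖x i‖ ≤ 1) →
      (∀ i : Fin n, k ≤ i → (h.val.mulVec x) i = 0) →
      ∃ d : Fin n → F, (∀ i, ‖d i‖ ≤ 1) ∧ h.val.mulVec x = (h.val * m).mulVec d := by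
    intro k
    induction k with
    | zero =>
      intro _ x _ hx
      exact ⟨0, by simp, by rw [Matrix.mulVec_zero]; exact funext fun i => hx i (Nat.zero_le _)⟩
    | succ k ih =>
      intro hk x hx hx0
      let i₀ : Fin n := ⟨k, hk⟩
      have hxD : x ∈ D i₀ := ⟨hx, fun i hi => hx0 i hi⟩
      let a : F := (h.val.mulVec x) i₀ / (h.val * m) i₀ i₀
      have ha : ‖a‖ ≤ 1 := by
        rw [norm_div]
        exact div_le_one_of_le₀ (hcm i₀ x hxD) (norm_nonneg _)
      have hmul : h.val.mulVec (x - a • c i₀) = h.val.mulVec x - a • h.val.mulVec (c i₀) := by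
        rw [Matrix.mulVec_sub, Matrix.mulVec_smul]
      obtain ⟨d, hd, hd'⟩ := ih (Nat.le_of_succ_le hk) (x - a • c i₀) (fun i => by
          rw [Pi.sub_apply, sub_eq_add_neg]
          refine (IsUltrametricDist.norm_add_le_max _ _).trans (max_le (hx i) ?_)
          rw [norm_neg, Pi.smul_apply, smul_eq_mul, norm_mul]
          exact mul_le_one₀ ha (norm_nonneg _) ((hc i₀).1 i)) (fun i hi => by
          rw [hmul, Pi.sub_apply, Pi.smul_apply, smul_eq_mul, ← hb]
          rcases hi.lt_or_eq with h1 | h1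
          · rw [hx0 i h1, hb0 i i₀ h1, mul_zero, sub_zero]
          · have : i = i₀ := Fin.ext h1.symm
            rw [this, div_mul_cancel₀ _ (hbd i₀), sub_self])
      refine ⟨d + a • Pi.single i₀ 1, fun i => ?_, ?_⟩
      · refine (IsUltrametricDist.norm_add_le_max _ _).trans (max_le (hd i) ?_)
        rw [Pi.smul_apply, smul_eq_mul, norm_mul]
        refine mul_le_one₀ ha (norm_nonneg _) ?_
        rw [Pi.single_apply]; split_ifs <;> simp
      · rw [Matrix.mulVec_add, ← hd', hmul, Matrix.mulVec_smul, Matrix.mulVec_single_one]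
        have : (h.val * m).col i₀ = h.val.mulVec (c i₀) := rfl
        rw [this, sub_add_cancel]
  have hcol : ∀ j, ∃ d : Fin n → F, (∀ i, ‖d i‖ ≤ 1) ∧
      h.val.mulVec (Pi.single j 1) = (h.val * m).mulVec d := fun j =>
    key n le_rfl _ (fun i => by rw [Pi.single_apply]; split_ifs <;> simp)
      fun i hi => absurd i.2 (not_lt.2 hi)
  choose d hd hd' using hcol
  let t : Fin n → Fˣ := fun i => Units.mk0 _ (hbd i)
  let y : StrictPair n → F := fun p => (h.val * m) p.1.1 p.1.2
  let b : GL (Fin n) F := upGL t y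
  have hbv : b.val = h.val * m := by
    ext i j
    rcases lt_trichotomy i j with hij | rfl | hij
    · exact upMat_of_lt t y hij
    · exact upMat_diag t y i
    · rw [hb0 i j hij]; exact upMat_blockTriangular t y hij
  have hk1 : (b⁻¹ * h).val = Matrix.of fun i j => d j i := by
    have h1 : h.val = b.val * Matrix.of fun i j => d j i := by
      ext i j
      have := congrFun (hd' j) i
      rw [Matrix.mulVec_single_one] at this
      rw [hbv]
      exact this
    rw [Units.val_mul, h1, ← mul_assoc, b.inv_mul, one_mul]
  have hk2 : ((b⁻¹ * h)⁻¹).val = m := by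
    rw [mul_inv_rev, inv_inv, Units.val_mul, hbv, ← mul_assoc, h.inv_mul, one_mul]
  refine ⟨_, _, b⁻¹ * h, mem_intGL_iff.2 ⟨fun i j => ?_, fun i j => ?_⟩, (mul_inv_cancel_left b h).symm⟩
  · rw [hk1]; exact hd j i
  · rw [hk2]; exact (hc j).1 i

end UpperTriangular

end ParahoricZeta

namespace ParahoricZeta

/-! ### Volumes of lattices under upper triangular matrices -/

section Action

variable {F : Type*} [NontriviallyNormedField F] [IsUltrametricDist F] {n : ℕ}
  {P : Fin n × Fin n → Prop} [DecidablePred P]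

/-- Extension by zero of a function on a set of positions to a matrix. -/
def extMat (y : {p // P p} → F) : Matrix (Fin n) (Fin n) F :=
  Matrix.of fun i j => if h : P (i, j) then y ⟨(i, j), h⟩ else 0

theorem extMat_apply (y : {p // P p} → F) (p : {p // P p}) : extMat y p.1.1 p.1.2 = y p := by
  simp [extMat, p.2]

theorem extMat_of_not (y : {p // P p} → F) {i j : Fin n} (h : ¬ P (i, j)) : extMat y i j = 0 := by
  simp [extMat, h]

theorem extMat_add (y z : {p // P p} → F) : extMat (y + z) = extMat y + extMat z := by
  ext i j
  by_cases h : P (i, j) <;> simp [extMat, h]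

/-- Left multiplication by a matrix, on the entries at a set of positions. -/
def matAct (c : Matrix (Fin n) (Fin n) F) (y : {p // P p} → F) : {p // P p} → F :=
  fun p => (c * extMat y) p.1.1 p.1.2

theorem matAct_add (c : Matrix (Fin n) (Fin n) F) (y z : {p // P p} → F) :
    matAct c (y + z) = matAct c y + matAct c z := by
  ext p
  simp [matAct, extMat_add, mul_add]

theorem matAct_one (y : {p // P p} → F) : matAct 1 y = y := by
  ext p
  simp [matAct, extMat_apply]

theorem continuous_matAct (c : Matrix (Fin n) (Fin n) F) :
    Continuous (matAct c : ({p // P p} → F) → {p // P p} → F) := by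
  refine continuous_pi fun p => ?_
  have : ∀ i j, Continuous fun y : {p // P p} → F => extMat y i j := fun i j => by
    by_cases h : P (i, j)
    · simp only [extMat, Matrix.of_apply, dif_pos h]; exact continuous_apply _
    · simp only [extMat, Matrix.of_apply, dif_neg h]; exact continuous_const
  simp only [matAct, Matrix.mul_apply]
  exact continuous_finsetSum _ fun k _ => continuous_const.mul (this _ _)

/-- By `hP` the set of positions contains, with each position, all those above it in its column.
Left multiplication by an upper triangular matrix only moves entries upwards, so nothing leaves the
set. The cases needed are the positions strictly above the diagonal and all positions. -/
theorem extMat_matAct (hP : ∀ i l j, P (l, j) → i ≤ l → P (i, j)) {c : Matrix (Fin n) (Fin n) F}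
    (hc : c.BlockTriangular id) (y : {p // P p} → F) : extMat (matAct c y) = c * extMat y := by
  ext i j
  by_cases h : P (i, j)
  · simp only [extMat, Matrix.of_apply, dif_pos h]; rfl
  · rw [extMat_of_not _ h, Matrix.mul_apply]
    refine (Finset.sum_eq_zero fun l _ => ?_).symm
    by_cases hl : P (l, j)
    · rw [hc (i := i) (j := l), zero_mul]
      exact not_le.1 fun hil => h (hP i l j hl hil)
    · rw [extMat_of_not _ hl, mul_zero]

theorem matAct_mul (hP : ∀ i l j, P (l, j) → i ≤ l → P (i, j)) (c : Matrix (Fin n) (Fin n) F)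
    {c' : Matrix (Fin n) (Fin n) F} (hc : c'.BlockTriangular id) (y : {p // P p} → F) :
    matAct (c * c') y = matAct c (matAct c' y) := by
  ext p
  rw [matAct, matAct, extMat_matAct hP hc, mul_assoc]

/-- The action of an invertible upper triangular matrix, as an automorphism. -/
def matActEquiv (hP : ∀ i l j, P (l, j) → i ≤ l → P (i, j)) {b : GL (Fin n) F}
    (hb : b ∈ upperGL F n) : ({p // P p} → F) ≃ₜ+ ({p // P p} → F) where
  toFun := matAct b.val
  invFun := matAct (b⁻¹).val
  left_inv y := by rw [← matAct_mul hP _ hb, b.inv_mul, matAct_one]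
  right_inv y := by rw [← matAct_mul hP _ ((upperGL F n).inv_mem hb), b.mul_inv, matAct_one]
  map_add' := matAct_add _
  continuous_toFun := continuous_matAct _
  continuous_invFun := continuous_matAct _

theorem matAct_norm_le {c : Matrix (Fin n) (Fin n) F} (hc : ∀ i j, ‖c i j‖ ≤ 1) {y : {p // P p} → F}
    (hy : ∀ p, ‖y p‖ ≤ 1) (p : {p // P p}) : ‖matAct c y p‖ ≤ 1 := by
  have := norm_mul_apply_le (B := extMat y) zero_le_one zero_le_one hc (fun i j => by
    by_cases h : P (i, j)
    · simpa [extMat, h] using hy _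
    · simp [extMat, h]) p.1.1 p.1.2
  rwa [one_mul] at this

variable [ProperSpace F] [MeasurableSpace F] [BorelSpace F] (μ : Measure F) [μ.IsAddHaarMeasure]

theorem pi_norm_le_eq (r : {p // P p} → ℝ) :
    (Measure.pi fun _ : {p // P p} => μ) {y | ∀ p, ‖y p‖ ≤ r p} = ∏ p, μ {x | ‖x‖ ≤ r p} := by
  rw [← Measure.pi_pi]
  congr 1
  ext y
  simp

/-- Both the matrix and its inverse map the unit box, of volume `1`, into itself. -/
theorem measurePreserving_matAct_of_mem_intGL (hP : ∀ i l j, P (l, j) → i ≤ l → P (i, j))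
    (hμ : μ {x | ‖x‖ ≤ 1} = 1) {b : GL (Fin n) F} (hb : b ∈ upperGL F n)
    (hk : b ∈ intGL F (Fin n)) :
    MeasurePreserving (matActEquiv hP hb) (Measure.pi fun _ => μ) (Measure.pi fun _ => μ) := by
  have h1 : (Measure.pi fun _ : {p // P p} => μ) {y | ∀ p, ‖y p‖ ≤ 1} = 1 := by
    rw [pi_norm_le_eq]; simp [hμ]
  refine measurePreserving_of_preimage_eq _ _ (A := {y | ∀ p, ‖y p‖ ≤ 1}) ?_
    (h1 ▸ one_ne_zero) (h1 ▸ ENNReal.one_ne_top) ?_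
  · have : {y : {p // P p} → F | ∀ p, ‖y p‖ ≤ 1} = ⋂ p, {y | ‖y p‖ ≤ 1} := by ext; simp
    rw [this]
    exact MeasurableSet.iInter fun p =>
      (isClosed_le (continuous_norm.comp (continuous_apply p)) continuous_const).measurableSet
  · ext y
    refine ⟨fun h => ?_, fun h => matAct_norm_le (mem_intGL_iff.1 hk).1 h⟩
    have := matAct_norm_le (mem_intGL_iff.1 hk).2 (y := matAct b.val y) h
    rwa [← matAct_mul hP _ hb, b.inv_mul, matAct_one] at this

/-- Conjugation by `diag(a^(-i))` multiplies the entry at `(i, j)` by `a^(j - i)`. For small `a`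
this makes a unipotent upper triangular matrix integral, and conjugation does not change the factor
by which Haar measure is scaled. -/
theorem measurePreserving_matAct_unipotent (hP : ∀ i l j, P (l, j) → i ≤ l → P (i, j))
    (hμ : μ {x | ‖x‖ ≤ 1} = 1) {b : GL (Fin n) F} (hb : b ∈ upperGL F n)
    (h1 : ∀ i, b.val i i = 1) :
    MeasurePreserving (matActEquiv hP hb) (Measure.pi fun _ => μ) (Measure.pi fun _ => μ) := by
  obtain ⟨C, hC0, hC⟩ : ∃ C : ℝ, 0 < C ∧ ∀ i j, ‖b.val i j‖ ≤ C := by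
    refine ⟨1 + ∑ i, ∑ j, ‖b.val i j‖, by positivity, fun i j => ?_⟩
    have e1 : ‖b.val i j‖ ≤ ∑ j, ‖b.val i j‖ :=
      Finset.single_le_sum (f := fun j => ‖b.val i j‖) (fun _ _ => norm_nonneg _) (Finset.mem_univ j)
    have e2 : ∑ j, ‖b.val i j‖ ≤ ∑ i, ∑ j, ‖b.val i j‖ :=
      Finset.single_le_sum (f := fun i => ∑ j, ‖b.val i j‖)
        (fun _ _ => Finset.sum_nonneg fun _ _ => norm_nonneg _) (Finset.mem_univ i)
    linarith
  obtain ⟨a, ha0, ha⟩ := NormedField.exists_norm_lt F (r := min 1 C⁻¹) (by positivity)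
  let a' : Fˣ := Units.mk0 a (norm_pos_iff.1 ha0)
  have ha1 : ‖a‖ ≤ 1 := ha.le.trans (min_le_left _ _)
  have haC : ‖a‖ ≤ C⁻¹ := ha.le.trans (min_le_right _ _)
  let t : Fin n → Fˣ := fun i => a' ^ (-(i : ℤ))
  let d : GL (Fin n) F := upGL t 0
  have hd : d ∈ upperGL F n := upGL_mem _ _
  have hdv : d.val = Matrix.diagonal fun i => (t i : F) := by
    ext i j
    rw [upGL_val]
    simp only [upMat, Matrix.of_apply, Matrix.diagonal_apply]
    split_ifs with h h' <;> first | rfl | skip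
    exact absurd h' h.ne
  have hdi : (d⁻¹).val = Matrix.diagonal fun i => ((t i)⁻¹ : F) := by
    have : d.val * Matrix.diagonal (fun i => ((t i)⁻¹ : F)) = 1 := by
      rw [hdv, Matrix.diagonal_mul_diagonal]; simp
    calc (d⁻¹).val = (d⁻¹).val * (d.val * Matrix.diagonal fun i => ((t i)⁻¹ : F)) := by
          rw [this, mul_one]
      _ = _ := by rw [← mul_assoc, d.inv_mul, one_mul]
  have hconj : d * b * d⁻¹ ∈ upperGL F n :=
    mul_mem (mul_mem hd hb) ((upperGL F n).inv_mem hd)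
  have hent : ∀ i j, (d * b * d⁻¹).val i j = t i * b.val i j * (t j : F)⁻¹ := fun i j => by
    rw [Units.val_mul, Units.val_mul, hdv, hdi, Matrix.mul_diagonal, Matrix.diagonal_mul]
  have hconjK : d * b * d⁻¹ ∈ intGL F (Fin n) := by
    refine mem_intGL_of_det (fun i j => ?_) ?_
    · rcases lt_trichotomy i j with h | rfl | h
      · rw [hent]
        have e : (t i : F) * b.val i j * (t j : F)⁻¹ = a ^ ((j : ℤ) - i) * b.val i j := by
          have ha' : a ≠ 0 := norm_pos_iff.1 ha0
          simp only [t, Units.val_zpow_eq_zpow_val]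
          change a ^ (-(i : ℤ)) * b.val i j * (a ^ (-(j : ℤ)))⁻¹ = _
          rw [← zpow_neg, neg_neg, mul_right_comm, ← zpow_add₀ ha', neg_add_eq_sub]
        rw [e, norm_mul, norm_zpow]
        have e1 : ‖a‖ ^ ((j : ℤ) - i) ≤ ‖a‖ := by
          have h2 : (1 : ℤ) ≤ (j : ℤ) - i := by have : (i : ℕ) < j := h; omega
          simpa using zpow_le_zpow_right_of_le_one₀ ha0 ha1 h2
        calc ‖a‖ ^ ((j : ℤ) - i) * ‖b.val i j‖ ≤ C⁻¹ * C := by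
              gcongr
              · exact e1.trans haC
              · exact hC i j
          _ = 1 := inv_mul_cancel₀ hC0.ne'
      · rw [hent, h1, mul_one, mul_inv_cancel₀ (t i).ne_zero, norm_one]
      · rw [hconj h, norm_zero]; exact zero_le_one
    · rw [Matrix.det_of_isUpperTriangular hconj, norm_prod]
      refine Finset.prod_eq_one fun i _ => ?_
      rw [hent, h1, mul_one, mul_inv_cancel₀ (t i).ne_zero, norm_one]
  refine measurePreserving_of_conj _ (d := matActEquiv hP hd) ?_
  convert (measurePreserving_matAct_of_mem_intGL μ hP hμ hconj hconjK) using 1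
  ext1 y
  change matAct d.val (matAct b.val (matAct (d⁻¹).val y)) = matAct (d * b * d⁻¹).val y
  rw [Units.val_mul, Units.val_mul, matAct_mul hP _ ((upperGL F n).inv_mem hd), matAct_mul hP _ hb]

/-- The volume of a lattice spanned by an invertible upper triangular matrix. -/
theorem measure_matAct_inv_norm_le {ϖ : Fˣ} (hϖ : IsUniformizer ϖ)
    (hP : ∀ i l j, P (l, j) → i ≤ l → P (i, j)) (hμ : μ {x | ‖x‖ ≤ 1} = 1) {b : GL (Fin n) F}
    (hb : b ∈ upperGL F n) :
    (Measure.pi fun _ : {p // P p} => μ) {y | ∀ p, ‖matAct (b⁻¹).val y p‖ ≤ 1} =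
      ∏ p : {p // P p}, ENNReal.ofReal (normAbs ϖ (b.val p.1.1 p.1.1)) := by
  -- With `d` the diagonal part of `b`, the unipotent factor `b d⁻¹` preserves the measure. The
  -- lattice may thus be replaced by a box with sides the `‖b i i‖`.
  let t : Fin n → Fˣ := fun i => Units.mk0 _ (diag_ne_zero hb i)
  let d : GL (Fin n) F := upGL t 0
  have hd : d ∈ upperGL F n := upGL_mem _ _
  have hu : d * b⁻¹ ∈ upperGL F n := mul_mem hd ((upperGL F n).inv_mem hb)
  have hu' : b * d⁻¹ ∈ upperGL F n := mul_mem hb ((upperGL F n).inv_mem hd)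
  have hdd : ∀ i, d.val i i = b.val i i := fun i => upMat_diag t 0 i
  have hu1 : ∀ i, (b * d⁻¹).val i i = 1 := fun i => by
    rw [Units.val_mul, mul_apply_diag hb ((upperGL F n).inv_mem hd), inv_apply_diag hd, hdd]
    exact mul_inv_cancel₀ (diag_ne_zero hb i)
  have hmp := measurePreserving_matAct_unipotent μ hP hμ hu' hu1
  have hS : MeasurableSet {y : {p // P p} → F | ∀ p, ‖matAct (b⁻¹).val y p‖ ≤ 1} := by
    have : {y : {p // P p} → F | ∀ p, ‖matAct (b⁻¹).val y p‖ ≤ 1} =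
        ⋂ p, {y | ‖matAct (b⁻¹).val y p‖ ≤ 1} := by ext; simp
    rw [this]
    exact MeasurableSet.iInter fun p => (isClosed_le (continuous_norm.comp
      ((continuous_apply p).comp (continuous_matAct _))) continuous_const).measurableSet
  rw [← hmp.measure_preimage hS.nullMeasurableSet]
  have : matActEquiv hP hu' ⁻¹' {y | ∀ p, ‖matAct (b⁻¹).val y p‖ ≤ 1} =
      {y | ∀ p, ‖y p‖ ≤ ‖b.val p.1.1 p.1.1‖} := by
    ext y
    simp only [Set.mem_preimage, Set.mem_ofPred_eq]
    change (∀ p, ‖matAct (b⁻¹).val (matAct (b * d⁻¹).val y) p‖ ≤ 1) ↔ _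
    rw [← matAct_mul hP _ hu', ← Units.val_mul, inv_mul_cancel_left]
    refine forall_congr' fun p => ?_
    have hoff : ∀ k, k ≠ p.1.1 → (d⁻¹).val p.1.1 k = 0 := fun k hk => by
      rcases hk.lt_or_gt with h | h
      · exact ((upperGL F n).inv_mem hd) h
      · have hdiag : d.val = Matrix.diagonal fun i => (t i : F) := by
          ext i j
          rw [upGL_val]
          simp only [upMat, Matrix.of_apply, Matrix.diagonal_apply]
          split_ifs with h h' <;> first | rfl | skip
          exact absurd h' h.ne
        have e := congrFun (congrFun d.mul_inv p.1.1) k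
        rw [hdiag, Matrix.diagonal_mul, Matrix.one_apply_ne h.ne] at e
        exact (mul_eq_zero.1 e).resolve_left (t p.1.1).ne_zero
    have e : matAct (d⁻¹).val y p = (b.val p.1.1 p.1.1)⁻¹ * y p := by
      rw [matAct, Matrix.mul_apply, Finset.sum_eq_single p.1.1, inv_apply_diag hd, hdd, extMat_apply]
      · intro k _ hk
        rw [hoff k hk, zero_mul]
      · simp
    rw [e, norm_mul, norm_inv, inv_mul_le_iff₀ (norm_pos_iff.2 (diag_ne_zero hb _)), mul_one]
  rw [this, pi_norm_le_eq]
  exact Finset.prod_congr rfl fun p _ => measure_norm_le_units hϖ μ hμ (t p.1.1)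

end Action

end ParahoricZeta

namespace ParahoricZeta

/-! ### The multiplicative group: topology and volumes of shells -/

section UnitsMeasurable

variable {F : Type*} [NontriviallyNormedField F] [IsUltrametricDist F]

instance units_borelSpace [MeasurableSpace F] [BorelSpace F] : BorelSpace Fˣ := by
  refine ⟨?_⟩
  have h1 := (Units.isEmbedding_val₀ (G₀ := F)).eq_induced
  rw [h1, borel_comap, ← BorelSpace.measurable_eq (α := F)]
  rfl

instance units_secondCountable [ProperSpace F] : SecondCountableTopology Fˣ :=
  Units.isEmbedding_val₀.secondCountableTopology

theorem isOpen_norm_eq (a : Fˣ) : IsOpen {c : Fˣ | ‖(c : F)‖ = ‖(a : F)‖} := by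
  have h1 : IsOpen {x : F | ‖x‖ = ‖(a : F)‖} := by
    have := IsUltrametricDist.isOpen_sphere (0 : F) (r := ‖(a : F)‖) (norm_units_pos a).ne'
    simpa [Metric.sphere, dist_zero_right] using this
  exact h1.preimage Units.continuous_val

theorem isOpen_unitSet : IsOpen (unitSet F) := by
  have := isOpen_norm_eq (1 : Fˣ)
  simpa [unitSet] using this

theorem measure_norm_eq [MeasurableSpace F] [BorelSpace F] (dc : Measure Fˣ)
    [dc.IsMulLeftInvariant] (hdc : dc (unitSet F) = 1) (a : Fˣ) :
    dc {c | ‖(c : F)‖ = ‖(a : F)‖} = 1 := by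
  rw [← hdc, ← measure_preimage_mul dc a⁻¹ (unitSet F)]
  congr 1
  ext c
  simp only [Set.mem_ofPred_eq, Set.mem_preimage, unitSet, Units.val_mul, norm_mul,
    Units.val_inv_eq_inv_val, norm_inv]
  rw [inv_mul_eq_one₀ (norm_units_pos a).ne', eq_comm]

end UnitsMeasurable

/-! ### Haar measure in Iwasawa coordinates -/

section IwasawaMeasure

variable {F : Type*} [NontriviallyNormedField F] [IsUltrametricDist F] {n : ℕ} [ProperSpace F]
  [MeasurableSpace F] [BorelSpace F]

/-- The density of left Haar measure on upper triangular matrices. -/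
noncomputable def upperDensity (ϖ : Fˣ) (x : (Fin n → Fˣ) × (StrictPair n → F)) : ENNReal :=
  (∏ p : StrictPair n, ENNReal.ofReal (normAbs ϖ (x.1 p.1.1 : F)))⁻¹

/-- Left Haar measure on upper triangular matrices, in the coordinates `upGL`. -/
noncomputable def upperMeasure (n : ℕ) (ϖ : Fˣ) (dc : Measure Fˣ) (μ : Measure F) :
    Measure ((Fin n → Fˣ) × (StrictPair n → F)) :=
  ((Measure.pi fun _ => dc).prod (Measure.pi fun _ => μ)).withDensity (upperDensity ϖ)

theorem continuous_upMat : Continuous fun x : (Fin n → Fˣ) × (StrictPair n → F) =>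
    upMat x.1 x.2 := by
  refine continuous_matrix fun i j => ?_
  simp only [upMat, Matrix.of_apply]
  split_ifs with h h'
  · exact (continuous_apply _).comp continuous_snd
  · exact Units.continuous_val.comp ((continuous_apply i).comp continuous_fst)
  · exact continuous_const

theorem continuous_upGL : Continuous fun x : (Fin n → Fˣ) × (StrictPair n → F) =>
    upGL x.1 x.2 :=
  continuous_GL_of_val continuous_upMat

theorem measurable_upperDensity (ϖ : Fˣ) :
    Measurable (upperDensity ϖ : (Fin n → Fˣ) × (StrictPair n → F) → ENNReal) := by
  refine Measurable.inv (Finset.measurable_prod _ fun p _ => ?_)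
  exact ENNReal.measurable_ofReal.comp (continuous_normAbs_units.measurable.comp
    ((measurable_pi_apply _).comp measurable_fst))

theorem strictPair_stable : ∀ i l j : Fin n, l < j → i ≤ l → i < j :=
  fun _ _ _ h h' => h'.trans_lt h

theorem upMat_eq_add (t : Fin n → Fˣ) (y : StrictPair n → F) :
    upMat t y = Matrix.diagonal (fun i => (t i : F)) + extMat (P := fun p => p.1 < p.2) y := by
  ext i j
  simp only [upMat, Matrix.of_apply, Matrix.add_apply, Matrix.diagonal_apply, extMat]
  by_cases h : i < j
  · simp [h, h.ne]
  · simp [h]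

/-- An upper triangular matrix belongs to `GL_n(𝒪)` exactly when its diagonal entries are units and
the entries above are integral. In these coordinates the first condition involves only `t`, and the
second is affine in `y` for fixed `t`. -/
theorem mul_upGL_mem_intGL_iff {c : GL (Fin n) F} (hc : c ∈ upperGL F n) (t : Fin n → Fˣ)
    (y : StrictPair n → F) : c * upGL t y ∈ intGL F (Fin n) ↔
      (∀ i, ‖(t i : F)‖ = ‖(c⁻¹).val i i‖) ∧ ∀ p : StrictPair n, ‖matAct c.val y p +
        (c.val * Matrix.diagonal fun i => (t i : F)) p.1.1 p.1.2‖ ≤ 1 := by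
  have hm : c * upGL t y ∈ upperGL F n := mul_mem hc (upGL_mem t y)
  have hd : ∀ i, (c * upGL t y).val i i = c.val i i * t i := fun i => by
    rw [Units.val_mul, mul_apply_diag hc (upGL_mem t y), upGL_val, upMat_diag]
  have h1 : ∀ i, ‖(c * upGL t y).val i i‖ = 1 ↔ ‖(t i : F)‖ = ‖(c⁻¹).val i i‖ := fun i => by
    rw [hd, inv_apply_diag hc, norm_inv, norm_mul,
      mul_comm, mul_eq_one_iff_eq_inv₀ (norm_ne_zero_iff.2 (diag_ne_zero hc i))]
  have h2 : ∀ p : StrictPair n, (c * upGL t y).val p.1.1 p.1.2 = matAct c.val y p +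
      (c.val * Matrix.diagonal fun i => (t i : F)) p.1.1 p.1.2 := fun p => by
    rw [Units.val_mul, upGL_val, upMat_eq_add, mul_add, Matrix.add_apply, add_comm]; rfl
  constructor
  · intro h
    exact ⟨fun i => (h1 i).1 (diag_norm_of_mem_intGL hm h i),
      fun p => h2 p ▸ (mem_intGL_iff.1 h).1 _ _⟩
  · rintro ⟨h3, h4⟩
    refine mem_intGL_of_det (fun i j => ?_) ?_
    · rcases lt_trichotomy i j with h | rfl | h
      · exact (h2 ⟨(i, j), h⟩).symm ▸ h4 ⟨(i, j), h⟩
      · exact ((h1 i).2 (h3 i)).le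
      · rw [hm h, norm_zero]; exact zero_le_one
    · rw [Matrix.det_of_isUpperTriangular hm, norm_prod]
      exact Finset.prod_eq_one fun i _ => (h1 i).2 (h3 i)

variable [MeasurableSpace (Matrix (Fin n) (Fin n) F)] [BorelSpace (Matrix (Fin n) (Fin n) F)]

/-- By the Iwasawa decomposition every coset of `GL_n(𝒪)` is represented by an upper triangular `b`.
In coordinates the coset fixes each `‖t i‖`, a set of volume `1`, and confines `y` to a translate of
the lattice spanned by `b`. The volume of that lattice is cancelled by the density. -/
theorem upperMeasure_coset {ϖ : Fˣ} (hϖ : IsUniformizer ϖ) (dc : Measure Fˣ) [dc.IsHaarMeasure]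
    (hdc : dc (unitSet F) = 1) (μ : Measure F) [μ.IsAddHaarMeasure] (hμ : μ {x | ‖x‖ ≤ 1} = 1)
    (g : GL (Fin n) F) :
    ((upperMeasure n ϖ dc μ).map fun x => upGL x.1 x.2) {x | g⁻¹ * x ∈ intGL F (Fin n)} = 1 := by
  obtain ⟨t₀, y₀, k, hk, rfl⟩ := exists_eq_upGL_mul g
  have hopen : IsOpen {x : GL (Fin n) F | (upGL t₀ y₀ * k)⁻¹ * x ∈ intGL F (Fin n)} :=
    isOpen_intGL.preimage (continuous_const_mul _)
  rw [Measure.map_apply continuous_upGL.measurable hopen.measurableSet]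
  set b := upGL t₀ y₀ with hbdef
  have hb : b ∈ upperGL F n := upGL_mem _ _
  have hbi : b⁻¹ ∈ upperGL F n := (upperGL F n).inv_mem hb
  let T : Set (Fin n → Fˣ) := Set.pi Set.univ fun i => {c | ‖(c : F)‖ = ‖(t₀ i : F)‖}
  have hT : MeasurableSet T := MeasurableSet.univ_pi fun i => (isOpen_norm_eq (t₀ i)).measurableSet
  let z : (Fin n → Fˣ) → StrictPair n → F := fun t p =>
    ((b⁻¹).val * Matrix.diagonal fun i => (t i : F)) p.1.1 p.1.2
  have hpre : (fun x : (Fin n → Fˣ) × (StrictPair n → F) => upGL x.1 x.2) ⁻¹'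
      {x | (b * k)⁻¹ * x ∈ intGL F (Fin n)} =
      {x | x.1 ∈ T ∧ ∀ p, ‖matAct (b⁻¹).val x.2 p + z x.1 p‖ ≤ 1} := by
    ext x
    simp only [Set.mem_preimage, Set.mem_ofPred_eq]
    rw [mul_inv_rev, mul_assoc, Subgroup.mul_mem_cancel_left _ (inv_mem hk),
      mul_upGL_mem_intGL_iff hbi, inv_inv]
    refine and_congr ?_ Iff.rfl
    simp [T, hbdef, upGL_val, upMat_diag]
  have hS : MeasurableSet {x : (Fin n → Fˣ) × (StrictPair n → F) |
      x.1 ∈ T ∧ ∀ p, ‖matAct (b⁻¹).val x.2 p + z x.1 p‖ ≤ 1} := by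
    rw [← hpre]
    exact (hopen.preimage continuous_upGL).measurableSet
  have hsec : ∀ w : StrictPair n → F, (Measure.pi fun _ : StrictPair n => μ)
      {y | ∀ p, ‖matAct (b⁻¹).val y p + w p‖ ≤ 1} =
      ∏ p : StrictPair n, ENNReal.ofReal (normAbs ϖ (t₀ p.1.1 : F)) := by
    intro w
    have h1 := measure_matAct_inv_norm_le μ hϖ (P := fun p : Fin n × Fin n => p.1 < p.2)
      strictPair_stable hμ hb
    simp only [hbdef, upGL_val, upMat_diag] at h1
    rw [← h1, ← measure_preimage_add_right _ (matAct b.val (-w))]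
    congr 1
    ext y
    simp only [Set.mem_preimage, Set.mem_ofPred_eq]
    refine forall_congr' fun p => ?_
    rw [← hbdef, matAct_add, ← matAct_mul strictPair_stable _ hb, b.inv_mul, matAct_one,
      Pi.add_apply, Pi.neg_apply, neg_add_cancel_right]
  rw [hpre, upperMeasure, withDensity_apply _ hS, ← lintegral_indicator hS,
    lintegral_prod _ ((measurable_upperDensity ϖ).indicator hS).aemeasurable]
  have hin : ∀ t : Fin n → Fˣ, ∫⁻ y, ({x : (Fin n → Fˣ) × (StrictPair n → F) |
      x.1 ∈ T ∧ ∀ p, ‖matAct (b⁻¹).val x.2 p + z x.1 p‖ ≤ 1}.indicator (upperDensity ϖ) (t, y))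
        ∂(Measure.pi fun _ : StrictPair n => μ) = T.indicator (fun _ => 1) t := by
    intro t
    by_cases ht : t ∈ T
    · rw [Set.indicator_of_mem ht]
      have hms : MeasurableSet {y | ∀ p, ‖matAct (b⁻¹).val y p + z t p‖ ≤ 1} := by
        have h2 := measurable_prodMk_left (x := t) hS
        have h3 : Prod.mk t ⁻¹' {x : (Fin n → Fˣ) × (StrictPair n → F) |
            x.1 ∈ T ∧ ∀ p, ‖matAct (b⁻¹).val x.2 p + z x.1 p‖ ≤ 1} =
            {y | ∀ p, ‖matAct (b⁻¹).val y p + z t p‖ ≤ 1} := by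
          ext y; simp [ht]
        rwa [h3] at h2
      have e : ∀ y, ({x : (Fin n → Fˣ) × (StrictPair n → F) |
          x.1 ∈ T ∧ ∀ p, ‖matAct (b⁻¹).val x.2 p + z x.1 p‖ ≤ 1}.indicator (upperDensity ϖ) (t, y))
          = {y | ∀ p, ‖matAct (b⁻¹).val y p + z t p‖ ≤ 1}.indicator
            (fun _ => (∏ p : StrictPair n, ENNReal.ofReal (normAbs ϖ (t p.1.1 : F)))⁻¹) y := by
        intro y
        simp only [Set.indicator, Set.mem_ofPred_eq, ht, true_and]
        rfl
      simp_rw [e]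
      rw [lintegral_indicator_const hms, hsec]
      have e2 : ∀ i, normAbs ϖ (t i : F) = normAbs ϖ (t₀ i : F) := fun i =>
        normAbs_eq_of_norm (ht i trivial)
      simp_rw [e2]
      refine ENNReal.inv_mul_cancel ?_ ?_
      · exact Finset.prod_ne_zero_iff.2 fun p _ => by simpa using normAbs_pos _
      · exact ENNReal.prod_ne_top fun p _ => ENNReal.ofReal_ne_top
    · rw [Set.indicator_of_notMem ht]
      simp [Set.indicator, ht]
  simp_rw [hin]
  rw [lintegral_indicator_const hT, one_mul, Measure.pi_pi]
  exact Finset.prod_eq_one fun i _ => measure_norm_eq dc hdc (t₀ i)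

theorem haar_coset (m : Measure (GL (Fin n) F)) [m.IsMulLeftInvariant] (H : Subgroup (GL (Fin n) F))
    (g : GL (Fin n) F) : m {x | g⁻¹ * x ∈ H} = m H :=
  measure_preimage_mul m g⁻¹ (H : Set (GL (Fin n) F))

/-- Integration in Iwasawa coordinates. -/
theorem integral_iwasawa {ϖ : Fˣ} (hϖ : IsUniformizer ϖ) (dc : Measure Fˣ) [dc.IsHaarMeasure]
    (hdc : dc (unitSet F) = 1) (μ : Measure F) [μ.IsAddHaarMeasure] (hμ : μ {x | ‖x‖ ≤ 1} = 1)
    (m : Measure (GL (Fin n) F)) [m.IsHaarMeasure] {f : GL (Fin n) F → ℂ}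
    (hf : ∀ g, ∀ k ∈ intGL F (Fin n), f (g * k) = f g) :
    ∫ g, f g ∂m = m.real (intGL F (Fin n)) *
      ∫ x, f (upGL x.1 x.2) ∂(upperMeasure n ϖ dc μ) := by
  rw [integral_eq_of_cosets isOpen_intGL (m₂ := (upperMeasure n ϖ dc μ).map fun x => upGL x.1 x.2)
    (c := m (intGL F (Fin n))) (fun g => by
      rw [haar_coset, upperMeasure_coset hϖ dc hdc μ hμ, mul_one]) hf,
    integral_map continuous_upGL.aemeasurable
      (continuous_of_mul_eq isOpen_intGL hf).aestronglyMeasurable]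
  rfl

theorem integrable_iwasawa {ϖ : Fˣ} (hϖ : IsUniformizer ϖ) (dc : Measure Fˣ) [dc.IsHaarMeasure]
    (hdc : dc (unitSet F) = 1) (μ : Measure F) [μ.IsAddHaarMeasure] (hμ : μ {x | ‖x‖ ≤ 1} = 1)
    (m : Measure (GL (Fin n) F)) [m.IsHaarMeasure] {f : GL (Fin n) F → ℂ}
    (hf : ∀ g, ∀ k ∈ intGL F (Fin n), f (g * k) = f g)
    (hi : Integrable (fun x => f (upGL x.1 x.2)) (upperMeasure n ϖ dc μ)) : Integrable f m := by
  refine integrable_of_cosets isOpen_intGL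
    (m₂ := (upperMeasure n ϖ dc μ).map fun x => upGL x.1 x.2)
    (c := m (intGL F (Fin n))) isCompact_intGL.measure_ne_top (fun g => by
      rw [haar_coset, upperMeasure_coset hϖ dc hdc μ hμ, mul_one]) hf ?_
  rwa [integrable_map_measure (continuous_of_mul_eq isOpen_intGL hf).aestronglyMeasurable
    continuous_upGL.aemeasurable]

end IwasawaMeasure

end ParahoricZeta

namespace ParahoricZeta

/-! ### Integral matrices that are upper triangular up to a small error -/

section LowerBound

variable {F : Type*} [NontriviallyNormedField F] [IsUltrametricDist F] {n : ℕ}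

/-- The determinant of an integral matrix which is upper triangular up to `r`. -/
theorem norm_det_sub_prod_diag_le {A : Matrix (Fin n) (Fin n) F} {r : ℝ} (hr : 0 ≤ r)
    (hA : ∀ i j, ‖A i j‖ ≤ 1) (hl : ∀ i j, j < i → ‖A i j‖ ≤ r) :
    ‖A.det - ∏ i, A i i‖ ≤ r := by
  rw [Matrix.det_apply', ← Finset.add_sum_erase _ _ (Finset.mem_univ (1 : Equiv.Perm (Fin n)))]
  simp only [Equiv.Perm.sign_one, Units.val_one, Int.cast_one, one_mul, Equiv.Perm.one_apply,
    add_sub_cancel_left]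
  refine IsUltrametricDist.norm_sum_le_of_forall_le_of_nonneg hr fun σ hσ => ?_
  have hσ1 : σ ≠ 1 := Finset.ne_of_mem_erase hσ
  -- A permutation that raises no index is the identity. Every other term of the determinant thus
  -- contains an entry `A (σ i) i` below the diagonal.
  have hex : ∃ i, i < σ i := by
    by_contra! h
    refine hσ1 (Equiv.ext fun i => ?_)
    induction i using WellFoundedLT.induction with
    | ind i ih =>
      rcases (h i).lt_or_eq with h1 | h1
      · exact absurd (σ.injective (ih _ h1)) h1.ne
      · exact h1
  obtain ⟨i, hi⟩ := hex
  rw [norm_mul, norm_prod]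
  have h1 : ‖((Equiv.Perm.sign σ : ℤ) : F)‖ ≤ 1 := by
    rcases Int.units_eq_one_or (Equiv.Perm.sign σ) with h | h <;> simp [h]
  have h2 : ∏ i, ‖A (σ i) i‖ ≤ r := by
    rw [← Finset.mul_prod_erase _ _ (Finset.mem_univ i)]
    calc ‖A (σ i) i‖ * ∏ x ∈ Finset.univ.erase i, ‖A (σ x) x‖ ≤ r * 1 := by
          gcongr
          · exact hl _ _ hi
          · exact Finset.prod_le_one (fun _ _ => norm_nonneg _) fun _ _ => hA _ _
      _ = r := mul_one r
  calc _ ≤ 1 * r := by gcongr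
    _ = r := one_mul r

/-- The elements of `GL_n(𝒪)` that are upper triangular up to `r`. -/
def iwahoriLevel (F : Type*) [NontriviallyNormedField F] [IsUltrametricDist F] (n : ℕ) (r : ℝ) :
    Set (GL (Fin n) F) :=
  {g | g ∈ intGL F (Fin n) ∧ ∀ i j, j < i → ‖g.val i j‖ ≤ r}

/-- The product of the diagonal entries differs from a determinant of norm `1` by less than `1`, so
it has norm `1`. Its factors have norm at most `1`, so none can be smaller. -/
theorem norm_diag_of_mem_iwahoriLevel {r : ℝ} (hr : 0 ≤ r) (hr1 : r < 1) {g : GL (Fin n) F}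
    (hg : g ∈ iwahoriLevel F n r) (i : Fin n) : ‖g.val i i‖ = 1 := by
  have h1 := (mem_intGL_iff.1 hg.1).1
  have h2 := norm_det_sub_prod_diag_le hr h1 hg.2
  have h3 : ‖∏ i, g.val i i‖ = 1 := by
    have h4 : ‖∏ i, g.val i i - g.val.det‖ < ‖g.val.det‖ := by
      rw [norm_sub_rev, norm_det_of_mem_intGL hg.1]; exact h2.trans_lt hr1
    have := IsUltrametricDist.norm_add_eq_max_of_norm_ne_norm h4.ne
    rw [sub_add_cancel, max_eq_right h4.le, norm_det_of_mem_intGL hg.1] at this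
    exact this
  rw [norm_prod, ← Finset.mul_prod_erase _ _ (Finset.mem_univ i)] at h3
  have h5 : ∏ x ∈ Finset.univ.erase i, ‖g.val x x‖ ≤ 1 :=
    Finset.prod_le_one (fun _ _ => norm_nonneg _) fun _ _ => h1 _ _
  have h6 : 0 ≤ ∏ x ∈ Finset.univ.erase i, ‖g.val x x‖ :=
    Finset.prod_nonneg fun _ _ => norm_nonneg _
  nlinarith [h1 i i, norm_nonneg (g.val i i)]

theorem norm_det_of_upper_mod {A : Matrix (Fin n) (Fin n) F} {r : ℝ} (hr : 0 ≤ r) (hr1 : r < 1)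
    (hA : ∀ i j, ‖A i j‖ ≤ 1) (hl : ∀ i j, j < i → ‖A i j‖ ≤ r) (hd : ∀ i, ‖A i i‖ = 1) :
    ‖A.det‖ = 1 := by
  have h2 := norm_det_sub_prod_diag_le hr hA hl
  have h3 : ‖∏ i, A i i‖ = 1 := by
    rw [norm_prod]; exact Finset.prod_eq_one fun i _ => hd i
  have h4 : ‖A.det - ∏ i, A i i‖ < ‖∏ i, A i i‖ := h3 ▸ h2.trans_lt hr1
  have := IsUltrametricDist.norm_add_eq_max_of_norm_ne_norm h4.ne
  rwa [sub_add_cancel, max_eq_right h4.le, h3] at this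

end LowerBound

/-! ### Additive Haar measure on matrices and the volume of Iwahori levels -/

section MatrixMeasure

variable {F : Type*} [NontriviallyNormedField F] [IsUltrametricDist F] {n : ℕ} [ProperSpace F]
  [MeasurableSpace F] [BorelSpace F]
  [MeasurableSpace (Matrix (Fin n) (Fin n) F)] [BorelSpace (Matrix (Fin n) (Fin n) F)]
  (dX : Measure (Matrix (Fin n) (Fin n) F)) [dX.IsAddHaarMeasure]
  (μ : Measure F) [μ.IsAddHaarMeasure]

variable (F n) in
/-- A matrix as the family of its entries. -/
def entriesEquiv : Matrix (Fin n) (Fin n) F ≃ₜ+ ({_p : Fin n × Fin n // True} → F) where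
  toFun X p := X p.1.1 p.1.2
  invFun := extMat (P := fun _ => True)
  left_inv X := by ext i j; simp [extMat]
  right_inv y := by ext p; simp [extMat]
  map_add' X Y := rfl
  continuous_toFun := continuous_pi fun p => continuous_id.matrix_elem _ _
  continuous_invFun := continuous_matrix fun i j => by
    simp only [extMat, Matrix.of_apply, dif_pos trivial]; exact continuous_apply _

theorem isClosed_matrix_norm_le (r : ℝ) :
    IsClosed {X : Matrix (Fin n) (Fin n) F | ∀ i j, ‖X i j‖ ≤ r} :=
  (isCompact_integral_matrices (Fin n) r).isClosed

theorem measure_entries_preimage (hdX : dX {X | ∀ i j, ‖X i j‖ ≤ 1} = 1)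
    (hμ : μ {x | ‖x‖ ≤ 1} = 1) {A : Set ({_p : Fin n × Fin n // True} → F)} (hA : MeasurableSet A) :
    dX (entriesEquiv F n ⁻¹' A) = (Measure.pi fun _ => μ) A := by
  have hm : Measurable (entriesEquiv F n) := (entriesEquiv F n).continuous.measurable
  have hh : (dX.map (entriesEquiv F n)).IsAddHaarMeasure :=
    (entriesEquiv F n).isAddHaarMeasure_map dX
  have hs := Measure.isAddLeftInvariant_eq_smul (dX.map (entriesEquiv F n))
    (Measure.pi fun _ : {_p : Fin n × Fin n // True} => μ)
  have hbox : MeasurableSet {y : {_p : Fin n × Fin n // True} → F | ∀ p, ‖y p‖ ≤ 1} := by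
    have : {y : {_p : Fin n × Fin n // True} → F | ∀ p, ‖y p‖ ≤ 1} = ⋂ p, {y | ‖y p‖ ≤ 1} := by
      ext; simp
    rw [this]
    exact MeasurableSet.iInter fun p =>
      (isClosed_le (continuous_norm.comp (continuous_apply p)) continuous_const).measurableSet
  have h1 : (dX.map (entriesEquiv F n)) {y | ∀ p, ‖y p‖ ≤ 1} = 1 := by
    rw [Measure.map_apply hm hbox, ← hdX]
    congr 1
    ext X
    exact ⟨fun h i j => h ⟨(i, j), trivial⟩, fun h p => h _ _⟩
  have h2 : (Measure.pi fun _ : {_p : Fin n × Fin n // True} => μ) {y | ∀ p, ‖y p‖ ≤ 1} = 1 := by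
    rw [pi_norm_le_eq]; simp [hμ]
  rw [← Measure.map_apply hm hA, hs, Measure.smul_apply]
  rw [hs, Measure.smul_apply, h2, ENNReal.smul_def, smul_eq_mul, mul_one] at h1
  rw [ENNReal.smul_def, h1, one_smul]

/-- The volume of the lattice `g M_n(𝒪)`. -/
theorem measure_lattice {ϖ : Fˣ} (hϖ : IsUniformizer ϖ) (hdX : dX {X | ∀ i j, ‖X i j‖ ≤ 1} = 1)
    (hμ : μ {x | ‖x‖ ≤ 1} = 1) (g : GL (Fin n) F) :
    dX {X | ∀ i j, ‖((g⁻¹).val * X) i j‖ ≤ 1} =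
      ENNReal.ofReal (normAbs ϖ (Matrix.GeneralLinearGroup.det g : F) ^ n) := by
  obtain ⟨t, y, k, hk, rfl⟩ := exists_eq_upGL_mul g
  have hb := upGL_mem t y
  have hP : ∀ i l j : Fin n, True → i ≤ l → True := fun _ _ _ _ _ => trivial
  have h1 := measure_matAct_inv_norm_le μ hϖ (P := fun _ : Fin n × Fin n => True) hP hμ hb
  have hS : MeasurableSet {z : {_p : Fin n × Fin n // True} → F |
      ∀ p, ‖matAct ((upGL t y)⁻¹).val z p‖ ≤ 1} := by
    have : {z : {_p : Fin n × Fin n // True} → F | ∀ p, ‖matAct ((upGL t y)⁻¹).val z p‖ ≤ 1} =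
        ⋂ p, {z | ‖matAct ((upGL t y)⁻¹).val z p‖ ≤ 1} := by ext; simp
    rw [this]
    exact MeasurableSet.iInter fun p => (isClosed_le (continuous_norm.comp
      ((continuous_apply p).comp (continuous_matAct _))) continuous_const).measurableSet
  have hset : {X : Matrix (Fin n) (Fin n) F | ∀ i j, ‖((upGL t y * k)⁻¹.val * X) i j‖ ≤ 1} =
      entriesEquiv F n ⁻¹' {z | ∀ p, ‖matAct ((upGL t y)⁻¹).val z p‖ ≤ 1} := by
    ext X
    have e : ∀ p : {_p : Fin n × Fin n // True},
        matAct ((upGL t y)⁻¹).val (entriesEquiv F n X) p = (((upGL t y)⁻¹).val * X) p.1.1 p.1.2 := by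
      intro p
      have : extMat (entriesEquiv F n X) = X := (entriesEquiv F n).left_inv X
      rw [matAct, this]
    simp only [Set.mem_preimage, Set.mem_ofPred_eq, e]
    -- The factor `k` preserves integral matrices, so only the triangular factor of `g` affects the
    -- lattice. Each `|t i|` then occurs once for every column, which produces the exponent `n`.
    have e2 : ((upGL t y * k)⁻¹).val * X = (k⁻¹).val * (((upGL t y)⁻¹).val * X) := by
      rw [mul_inv_rev, Units.val_mul, mul_assoc]
    have e3 : ((upGL t y)⁻¹).val * X = k.val * (((upGL t y * k)⁻¹).val * X) := by
      rw [e2, ← mul_assoc, k.mul_inv, one_mul]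
    constructor
    · intro h p
      rw [e3]
      simpa using norm_mul_apply_le zero_le_one zero_le_one (mem_intGL_iff.1 hk).1 h p.1.1 p.1.2
    · intro h i j
      rw [e2]
      simpa using norm_mul_apply_le zero_le_one zero_le_one (mem_intGL_iff.1 hk).2
        (fun i j => h ⟨(i, j), trivial⟩) i j
  rw [hset, measure_entries_preimage dX μ hdX hμ hS, h1]
  have hdet : normAbs ϖ ((Matrix.GeneralLinearGroup.det (upGL t y * k) : Fˣ) : F) =
      ∏ i, normAbs ϖ (t i : F) := by
    have : ((Matrix.GeneralLinearGroup.det (upGL t y * k) : Fˣ) : F) =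
        (∏ i, (t i : F)) * k.val.det := by
      change ((upGL t y * k).val).det = _
      rw [Units.val_mul, Matrix.det_mul, upGL_val, det_upMat]
    rw [this, normAbs_mul, normAbs_of_norm_one (norm_det_of_mem_intGL hk), mul_one, normAbs_prod]
  rw [hdet, ← Finset.prod_pow, ENNReal.ofReal_prod_of_nonneg
    (fun i _ => pow_nonneg (normAbs_pos _).le _)]
  simp only [upGL_val, upMat_diag]
  have hsub : ∏ p : {_p : Fin n × Fin n // True}, ENNReal.ofReal (normAbs ϖ (t p.1.1 : F)) =
      ∏ p : Fin n × Fin n, ENNReal.ofReal (normAbs ϖ (t p.1 : F)) :=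
    Fintype.prod_equiv (Equiv.subtypeUnivEquiv fun _ => trivial) _ _ fun _ => rfl
  rw [hsub, Fintype.prod_prod_type]
  refine Finset.prod_congr rfl fun i _ => ?_
  rw [ENNReal.ofReal_pow (normAbs_pos _).le]
  simp

theorem measure_add_const_norm_le (A : Matrix (Fin n) (Fin n) F) (r : ℝ) :
    dX {X | ∀ i j, ‖(X - A) i j‖ ≤ r} = dX {X | ∀ i j, ‖X i j‖ ≤ r} := by
  rw [← measure_preimage_add_right dX A {X | ∀ i j, ‖(X - A) i j‖ ≤ r}]
  congr 1
  ext X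
  simp

/-- Every `X` in the ball around `g` is `g (1 + E)` with `E = g⁻¹ (X - g)` bounded by `r`, and `1 +
E` is invertible over the integers because `r < 1`. Multiplicative cosets thus become additive
balls. -/
theorem image_coset_congruenceGL {r : ℝ} (hr : 0 ≤ r) (hr1 : r < 1) {g : GL (Fin n) F}
    (hg : g ∈ intGL F (Fin n)) :
    Units.val '' {x : GL (Fin n) F | g⁻¹ * x ∈ congruenceGL F (Fin n) hr} =
      {X | ∀ i j, ‖(X - g.val) i j‖ ≤ r} := by
  ext X
  constructor
  · rintro ⟨x, hx, rfl⟩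
    have e : x.val - g.val = g.val * ((g⁻¹ * x).val - 1) := by
      rw [mul_sub, ← Units.val_mul, mul_inv_cancel_left, mul_one]
    intro i j
    rw [e]
    simpa using norm_mul_apply_le zero_le_one hr (mem_intGL_iff.1 hg).1 hx.2 i j
  · intro hX
    let E : Matrix (Fin n) (Fin n) F := (g⁻¹).val * (X - g.val)
    have hE : ∀ i j, ‖E i j‖ ≤ r := fun i j => by
      simpa only [one_mul] using norm_mul_apply_le zero_le_one hr (mem_intGL_iff.1 hg).2 hX i j
    have h1 : ∀ i j, ‖(1 + E) i j‖ ≤ 1 := fun i j => by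
      refine (IsUltrametricDist.norm_add_le_max _ _).trans (max_le ?_ ((hE i j).trans hr1.le))
      rw [Matrix.one_apply]; split_ifs <;> simp
    have hd : ‖(1 + E).det‖ = 1 := by
      refine norm_det_of_upper_mod hr hr1 h1 (fun i j h => ?_) fun i => ?_
      · rw [Matrix.add_apply, Matrix.one_apply_ne h.ne', zero_add]; exact hE i j
      · rw [Matrix.add_apply, Matrix.one_apply_eq]
        have h2 : ‖E i i‖ < ‖(1 : F)‖ := by rw [norm_one]; exact (hE i i).trans_lt hr1
        rw [IsUltrametricDist.norm_add_eq_max_of_norm_ne_norm h2.ne', max_eq_left h2.le, norm_one]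
    have hd0 : (1 + E).det ≠ 0 := fun h => by simp [h] at hd
    let u : GL (Fin n) F := Matrix.GeneralLinearGroup.mkOfDetNeZero (1 + E) hd0
    have hu : u.val = 1 + E := rfl
    refine ⟨g * u, ⟨?_, ?_⟩, ?_⟩
    · rw [inv_mul_cancel_left]; exact mem_intGL_of_det h1 hd
    · intro i j
      rw [inv_mul_cancel_left, hu, add_sub_cancel_left]; exact hE i j
    · rw [Units.val_mul, hu, mul_add, mul_one]
      simp only [E]
      rw [← mul_assoc, g.mul_inv, one_mul, add_sub_cancel]

/-- Left Haar measure and additive Haar measure are proportional on unions of cosets of a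
congruence subgroup in `GL_n(𝒪)`. -/
theorem exists_measure_eq_comap {r : ℝ} (hr : 0 < r) (hr1 : r < 1) (m : Measure (GL (Fin n) F))
    [m.IsHaarMeasure] : ∃ c : ENNReal, ∀ S : Set (GL (Fin n) F), S ⊆ intGL F (Fin n) →
      (∀ g ∈ S, ∀ k ∈ congruenceGL F (Fin n) hr.le, g * k ∈ S) →
      m S = c * dX (Units.val '' S) := by
  have hemb : MeasurableEmbedding (Units.val : GL (Fin n) F → Matrix (Fin n) (Fin n) F) :=
    GL_isOpenEmbedding_val.measurableEmbedding
  -- The constant is the volume of the congruence subgroup divided by that of the additive ball of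
  -- radius `r`; it is the same for every coset by translation invariance.
  refine ⟨m (congruenceGL F (Fin n) hr.le) / dX {X | ∀ i j, ‖X i j‖ ≤ r}, fun S hSK hS => ?_⟩
  rw [← hemb.comap_apply]
  refine measure_eq_of_cosets (isOpen_congruenceGL hr) hS fun g hg => ?_
  rw [haar_coset, hemb.comap_apply, image_coset_congruenceGL hr.le hr1 (hSK hg),
    measure_add_const_norm_le, ENNReal.div_mul_cancel]
  · have ho : IsOpen {X : Matrix (Fin n) (Fin n) F | ∀ i j, ‖X i j‖ ≤ r} := by
      have : {X : Matrix (Fin n) (Fin n) F | ∀ i j, ‖X i j‖ ≤ r} =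
          ⋂ i, ⋂ j, {X | ‖X i j‖ ≤ r} := by ext; simp
      rw [this]
      exact isOpen_iInter_of_finite fun i => isOpen_iInter_of_finite fun j =>
        (isOpen_norm_le hr).preimage (continuous_id.matrix_elem i j)
    exact (ho.measure_pos dX ⟨0, by simp [hr.le]⟩).ne'
  · exact (isCompact_integral_matrices (Fin n) r).measure_ne_top

/-- The description is entry by entry, so additive volumes become products of one-dimensional
volumes. -/
theorem image_iwahoriLevel {r : ℝ} (hr : 0 ≤ r) (hr1 : r < 1) :
    Units.val '' iwahoriLevel F n r = entriesEquiv F n ⁻¹' (Set.pi Set.univ fun p =>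
      if p.1.1 < p.1.2 then {x | ‖x‖ ≤ 1} else if p.1.1 = p.1.2 then {x | ‖x‖ = 1} else
        {x | ‖x‖ ≤ r}) := by
  ext X
  simp only [Set.mem_preimage, Set.mem_pi, Set.mem_univ, true_imp_iff]
  constructor
  · rintro ⟨g, hg, rfl⟩ ⟨⟨i, j⟩, -⟩
    change g.val i j ∈ _
    dsimp only
    split_ifs with h h'
    · exact (mem_intGL_iff.1 hg.1).1 i j
    · subst h'
      exact norm_diag_of_mem_iwahoriLevel hr hr1 hg i
    · exact hg.2 i j (lt_of_le_of_ne (not_lt.1 h) (Ne.symm h'))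
  · intro h
    have hX : ∀ i j, X i j ∈ (if i < j then {x : F | ‖x‖ ≤ 1} else if i = j then {x | ‖x‖ = 1} else
        {x | ‖x‖ ≤ r}) := fun i j => h ⟨(i, j), trivial⟩
    have hd : ∀ i, ‖X i i‖ = 1 := fun i => by simpa using hX i i
    have hl : ∀ i j, j < i → ‖X i j‖ ≤ r := fun i j hij => by
      simpa [hij.not_gt, hij.ne'] using hX i j
    have h1 : ∀ i j, ‖X i j‖ ≤ 1 := fun i j => by
      rcases lt_trichotomy i j with hij | rfl | hij
      · simpa [hij] using hX i j
      · exact (hd i).le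
      · exact (hl i j hij).trans hr1.le
    have hdet := norm_det_of_upper_mod hr hr1 h1 hl hd
    have hd0 : X.det ≠ 0 := fun h => by simp [h] at hdet
    exact ⟨Matrix.GeneralLinearGroup.mkOfDetNeZero X hd0, ⟨mem_intGL_of_det h1 hdet, hl⟩, rfl⟩

theorem iwahoriLevel_mul_mem {r r' : ℝ} (hr : 0 ≤ r) (h : r ≤ r') {g k : GL (Fin n) F}
    (hg : g ∈ iwahoriLevel F n r') (hk : k ∈ congruenceGL F (Fin n) hr) :
    g * k ∈ iwahoriLevel F n r' := by
  refine ⟨mul_mem hg.1 hk.1, fun i j hij => ?_⟩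
  have e : (g * k).val = g.val + g.val * (k.val - 1) := by
    rw [mul_sub, mul_one, Units.val_mul]; abel
  rw [e, Matrix.add_apply]
  refine (IsUltrametricDist.norm_add_le_max _ _).trans (max_le (hg.2 i j hij) ?_)
  refine le_trans ?_ h
  simpa using norm_mul_apply_le zero_le_one hr (mem_intGL_iff.1 hg.1).1 hk.2 i j

theorem iwahori_eq_level {ϖ : Fˣ} (hϖ : IsUniformizer ϖ) :
    iwahori F n = iwahoriLevel F n (‖(ϖ : F)‖ ^ 1) := by
  ext g
  rw [mem_iwahori_iff, pow_one]
  exact and_congr_right fun _ => forall_congr' fun i => forall_congr' fun j => imp_congr_right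
    fun _ => ⟨hϖ.norm_le_of_lt_one, fun h => h.trans_lt hϖ.norm_lt_one⟩

/-- Passing from level `1` to level `b` changes only the entries below the diagonal, each of which
loses a factor `q^(b - 1)` of volume. Multiplicative and additive volumes may be exchanged by
`exists_measure_eq_comap`. -/
theorem measure_iwahori {ϖ : Fˣ} (hϖ : IsUniformizer ϖ) (hdX : dX {X | ∀ i j, ‖X i j‖ ≤ 1} = 1)
    (hμ : μ {x | ‖x‖ ≤ 1} = 1) (m : Measure (GL (Fin n) F)) [m.IsHaarMeasure] {b : ℕ} (hb : 1 ≤ b) :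
    m (iwahori F n) = (resCard F : ENNReal) ^ ((b - 1) * Fintype.card (StrictPair n)) *
      m (iwahoriLevel F n (‖(ϖ : F)‖ ^ b)) := by
  have h0 := norm_units_pos ϖ
  have hlt : ∀ {c : ℕ}, 1 ≤ c → ‖(ϖ : F)‖ ^ c < 1 := fun hc =>
    pow_lt_one₀ h0.le hϖ.norm_lt_one (by omega)
  have hle : ‖(ϖ : F)‖ ^ b ≤ ‖(ϖ : F)‖ ^ 1 := pow_le_pow_of_le_one h0.le hϖ.norm_lt_one.le hb
  obtain ⟨c, hc⟩ := exists_measure_eq_comap dX (pow_pos h0 b) (hlt hb) m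
  rw [iwahori_eq_level hϖ, hc _ (fun g hg => hg.1) fun g hg k hk => iwahoriLevel_mul_mem _ hle hg hk,
    hc _ (fun g hg => hg.1) fun g hg k hk => iwahoriLevel_mul_mem _ le_rfl hg hk, mul_left_comm]
  congr 1
  have hms : ∀ (r : ℝ) (p : {_p : Fin n × Fin n // True}), MeasurableSet
      (if p.1.1 < p.1.2 then {x : F | ‖x‖ ≤ 1} else if p.1.1 = p.1.2 then {x | ‖x‖ = 1} else
        {x | ‖x‖ ≤ r}) := fun r p => by
    split_ifs
    · exact (isClosed_le continuous_norm continuous_const).measurableSet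
    · exact (isClosed_eq continuous_norm continuous_const).measurableSet
    · exact (isClosed_le continuous_norm continuous_const).measurableSet
  rw [image_iwahoriLevel (pow_pos h0 1).le (hlt le_rfl), image_iwahoriLevel (pow_pos h0 b).le (hlt hb),
    measure_entries_preimage dX μ hdX hμ (MeasurableSet.univ_pi (hms _)),
    measure_entries_preimage dX μ hdX hμ (MeasurableSet.univ_pi (hms _)), Measure.pi_pi, Measure.pi_pi]
  have hq0 : (resCard F : ENNReal) ≠ 0 := by
    have := two_le_resCard F
    simp; omega
  have hqt : (resCard F : ENNReal) ≠ ⊤ := ENNReal.natCast_ne_top _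
  have hcard : (resCard F : ENNReal) ^ ((b - 1) * Fintype.card (StrictPair n)) =
      ∏ p : {_p : Fin n × Fin n // True},
        if p.1.2 < p.1.1 then (resCard F : ENNReal) ^ (b - 1) else 1 := by
    rw [Finset.prod_ite, Finset.prod_const, Finset.prod_const_one, mul_one, ← pow_mul]
    congr 2
    rw [← Fintype.card_subtype]
    refine Fintype.card_congr ⟨fun p => ⟨⟨(p.1.2, p.1.1), trivial⟩, p.2⟩,
      fun p => ⟨(p.1.1.2, p.1.1.1), p.2⟩, fun p => rfl, fun p => rfl⟩
  rw [hcard, ← Finset.prod_mul_distrib]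
  refine Finset.prod_congr rfl fun p _ => ?_
  have hz : ∀ c : ℕ, μ {x | ‖x‖ ≤ ‖(ϖ : F)‖ ^ c} = (resCard F : ENNReal) ^ (-(c : ℤ)) := fun c => by
    have := measure_norm_le_zpow hϖ μ hμ c
    simpa using this
  rcases lt_trichotomy p.1.1 p.1.2 with h | h | h
  · simp [h, h.not_gt]
  · simp [h]
  · simp only [h.not_gt, h.ne', h, if_true, if_false, hz]
    rw [← zpow_natCast, ← ENNReal.zpow_add hq0 hqt]
    congr 1
    omega

end MatrixMeasure

end ParahoricZeta

namespace ParahoricZeta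

/-! ### The inducing character and the Borel and parahoric subgroups -/

section InducingCharacter

variable {F : Type*} [NontriviallyNormedField F] [IsUltrametricDist F] {n : ℕ} {ϖ : Fˣ}
  {θ : Fin n ⊕ Fin n → Fˣ →* ℂˣ}

theorem inducingChar_mul (t t' : Fin n ⊕ Fin n → Fˣ) :
    inducingChar ϖ θ (t * t') = inducingChar ϖ θ t * inducingChar ϖ θ t' := by
  rw [inducingChar, inducingChar, inducingChar, ← Finset.prod_mul_distrib]
  refine Finset.prod_congr rfl fun i _ => ?_
  rw [Pi.mul_apply, Units.val_mul, normAbs_mul,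
    Real.mul_rpow (normAbs_pos _).le (normAbs_pos _).le, map_mul, Units.val_mul, Complex.ofReal_mul]
  ring

theorem inducingChar_congr (hθ : ∀ i, IsUnramified (θ i)) {t t' : Fin n ⊕ Fin n → Fˣ}
    (h : ∀ i, ‖(t i : F)‖ = ‖(t' i : F)‖) : inducingChar ϖ θ t = inducingChar ϖ θ t' := by
  refine Finset.prod_congr rfl fun i _ => ?_
  rw [normAbs_eq_of_norm (h i), (hθ i).map_eq (h i)]

end InducingCharacter

section Borel

variable {F : Type*} [NontriviallyNormedField F] [IsUltrametricDist F] {n : ℕ}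

variable (F n) in
/-- The upper triangular Borel subgroup of `GL_{2n}`. -/
noncomputable def borelGL : Subgroup (GL (Fin n ⊕ Fin n) F) where
  carrier := {g | g.val.BlockTriangular toLex}
  one_mem' := Matrix.blockTriangular_one
  mul_mem' ha hb := Matrix.BlockTriangular.mul ha hb
  inv_mem' := by
    intro a ha
    change (a⁻¹).val.BlockTriangular toLex
    rw [Matrix.coe_units_inv]
    have := a.invertible
    exact Matrix.blockTriangular_inv_of_blockTriangular ha

theorem mul_apply_diag_lex {A B : Matrix (Fin n ⊕ Fin n) (Fin n ⊕ Fin n) F}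
    (hA : A.BlockTriangular toLex) (hB : B.BlockTriangular toLex) (i : Fin n ⊕ Fin n) :
    (A * B) i i = A i i * B i i := by
  rw [Matrix.mul_apply, Finset.sum_eq_single i]
  · intro k _ hk
    have hk' : toLex k ≠ toLex i := fun h => hk (toLex.injective h)
    rcases hk'.lt_or_gt with h | h
    · rw [hA h, zero_mul]
    · rw [hB h, mul_zero]
  · simp

theorem borel_diag_ne_zero {b : GL (Fin n ⊕ Fin n) F} (hb : b ∈ borelGL F n) (i : Fin n ⊕ Fin n) :
    b.val i i ≠ 0 := by
  have h := mul_apply_diag_lex hb ((borelGL F n).inv_mem hb) i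
  rw [b.mul_inv, Matrix.one_apply_eq] at h
  exact left_ne_zero_of_mul_eq_one h.symm

/-- The diagonal of an element of the Borel subgroup. -/
noncomputable def borelDiag (b : borelGL F n) (i : Fin n ⊕ Fin n) : Fˣ :=
  Units.mk0 _ (borel_diag_ne_zero b.2 i)

theorem borelDiag_mul (b b' : borelGL F n) : borelDiag (b * b') = borelDiag b * borelDiag b' := by
  ext i
  exact mul_apply_diag_lex b.2 b'.2 i

theorem torus_mul_mem_borel {t : Fin n ⊕ Fin n → Fˣ} {v : GL (Fin n ⊕ Fin n) F}
    (hv : v ∈ upperUnip F n) : torus t * v ∈ borelGL F n :=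
  Matrix.BlockTriangular.mul (Matrix.blockTriangular_diagonal _) hv.1

theorem borelDiag_torus_mul {t : Fin n ⊕ Fin n → Fˣ} {v : GL (Fin n ⊕ Fin n) F}
    (hv : v ∈ upperUnip F n) : borelDiag ⟨torus t * v, torus_mul_mem_borel hv⟩ = t := by
  ext i
  change (torus t * v).val i i = t i
  have : (torus t * v).val = Matrix.diagonal (fun i => (t i : F)) * v.val := rfl
  rw [this, Matrix.diagonal_mul, hv.2 i, mul_one]

theorem exists_eq_torus_mul (b : borelGL F n) :
    ∃ v ∈ upperUnip F n, (b : GL (Fin n ⊕ Fin n) F) = torus (borelDiag b) * v := by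
  have hT : ((torus (borelDiag b))⁻¹ : GL (Fin n ⊕ Fin n) F).val =
      Matrix.diagonal fun i => (((borelDiag b i)⁻¹ : Fˣ) : F) := rfl
  refine ⟨(torus (borelDiag b))⁻¹ * b, ⟨?_, fun i => ?_⟩, (mul_inv_cancel_left _ _).symm⟩
  · rw [Units.val_mul, hT]
    exact Matrix.BlockTriangular.mul (Matrix.blockTriangular_diagonal _) b.2
  · rw [Units.val_mul, hT, Matrix.diagonal_mul]
    exact Units.inv_mul (borelDiag b i)

variable (F n) in
/-- The parahoric subgroup as a subgroup. -/
noncomputable def parahoricGL (ϖ : Fˣ) : Subgroup (GL (Fin n ⊕ Fin n) F) :=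
  intGL F _ ⊓ (intGL F _).comap (MulAut.conj (tMat n ϖ)).toMonoidHom

/-- Conjugation by `diag(ϖ, 1)` multiplies the upper right block by `ϖ` and the lower left block by
`ϖ⁻¹`. The conjugate is thus integral exactly when the lower left block is divisible by `ϖ`. With
`J` in this form, closure under products and openness come for free. -/
theorem mem_parahoricGL_iff {ϖ : Fˣ} (hϖ : IsUniformizer ϖ) {g : GL (Fin n ⊕ Fin n) F} :
    g ∈ parahoricGL F n ϖ ↔ g ∈ parahoric F n := by
  rw [mem_parahoric_iff]
  have h0 := norm_units_pos ϖ
  have h1 := hϖ.norm_lt_one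
  have hv : (MulAut.conj (tMat n ϖ) g).val = Matrix.fromBlocks g.val.toBlocks₁₁
      ((ϖ : F) • g.val.toBlocks₁₂) ((ϖ⁻¹ : F) • g.val.toBlocks₂₁) g.val.toBlocks₂₂ := by
    have e1 : (tMat n ϖ).val = Matrix.fromBlocks (Matrix.scalar (Fin n) (ϖ : F)) 0 0 1 := rfl
    have e2 : ((tMat n ϖ)⁻¹).val = Matrix.fromBlocks (Matrix.scalar (Fin n) (ϖ⁻¹ : F)) 0 0 1 := by
      have : ((tMat n ϖ)⁻¹).val = Matrix.fromBlocks
        (Matrix.scalar (Fin n) ((ϖ⁻¹ : Fˣ) : F)) 0 0 1 := rfl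
      rw [this, Units.val_inv_eq_inv_val]
    rw [MulAut.conj_apply, Units.val_mul, Units.val_mul, e1, e2]
    nth_rw 1 [← Matrix.fromBlocks_toBlocks g.val]
    rw [Matrix.fromBlocks_multiply, Matrix.fromBlocks_multiply]
    have hϖ0 : (ϖ : F) ≠ 0 := ϖ.ne_zero
    congr 1 <;> simp [Matrix.scalar_apply, ← Matrix.smul_eq_diagonal_mul, ← Matrix.smul_eq_mul_diagonal, smul_smul, hϖ0]
  constructor
  · rintro ⟨hg, hg'⟩
    refine ⟨hg, fun i j => ?_⟩
    have := (mem_intGL_iff.1 hg').1 (Sum.inr i) (Sum.inl j)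
    have h2 : ‖(ϖ : F)⁻¹ * g.val (Sum.inr i) (Sum.inl j)‖ ≤ 1 := by
      have e : (MulAut.conj (tMat n ϖ) g).val (Sum.inr i) (Sum.inl j) =
        (ϖ : F)⁻¹ * g.val (Sum.inr i) (Sum.inl j) := by rw [hv]; rfl
      rw [← e]; exact this
    rw [norm_mul, norm_inv, inv_mul_le_iff₀ h0, mul_one] at h2
    exact h2.trans_lt h1
  · rintro ⟨hg, hg'⟩
    refine ⟨hg, mem_intGL_of_det ?_ ?_⟩
    · have hK := (mem_intGL_iff.1 hg).1
      change ∀ i j, ‖(MulAut.conj (tMat n ϖ) g).val i j‖ ≤ 1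
      rw [hv]
      rintro (i | i) (j | j)
      · exact hK _ _
      · change ‖(ϖ : F) * g.val (Sum.inl i) (Sum.inr j)‖ ≤ 1
        rw [norm_mul]
        exact mul_le_one₀ h1.le (norm_nonneg _) (hK _ _)
      · change ‖(ϖ : F)⁻¹ * g.val (Sum.inr i) (Sum.inl j)‖ ≤ 1
        rw [norm_mul, norm_inv, inv_mul_le_iff₀ h0, mul_one]
        exact hϖ.norm_le_of_lt_one (hg' i j)
      · exact hK _ _
    · change ‖(MulAut.conj (tMat n ϖ) g).val.det‖ = 1
      rw [MulAut.conj_apply, Units.val_mul, Units.val_mul, Matrix.det_mul, Matrix.det_mul,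
        mul_right_comm, ← Matrix.det_mul, Units.mul_inv, Matrix.det_one, one_mul]
      exact norm_det_of_mem_intGL hg

theorem isOpen_parahoricGL [ProperSpace F] (ϖ : Fˣ) :
    IsOpen (parahoricGL F n ϖ : Set (GL (Fin n ⊕ Fin n) F)) := by
  refine isOpen_intGL.inter (isOpen_intGL.preimage ?_)
  change Continuous fun g => tMat n ϖ * g * (tMat n ϖ)⁻¹
  fun_prop

theorem antidiag_norm_le (i j : Fin n) : ‖antidiag F n i j‖ ≤ 1 := by
  simp only [antidiag, Matrix.of_apply]; split_ifs <;> simp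

theorem wLong_mem : wLong F n ∈ intGL F (Fin n) :=
  mem_intGL_iff.2 ⟨antidiag_norm_le, antidiag_norm_le⟩

theorem wLong₂_mem : wLong₂ F n ∈ intGL F (Fin n ⊕ Fin n) := by
  have h : ∀ i j, ‖Matrix.fromBlocks 0 (antidiag F n) (antidiag F n) 0 i j‖ ≤ 1 := by
    rintro (i | i) (j | j)
    · simp
    · exact antidiag_norm_le i j
    · exact antidiag_norm_le i j
    · simp
  exact mem_intGL_iff.2 ⟨h, h⟩

/-- The torus part in `B w J` is well defined up to units. -/
theorem norm_borelDiag_eq {b b' : borelGL F n} {j j' : GL (Fin n ⊕ Fin n) F}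
    (hj : j ∈ intGL F (Fin n ⊕ Fin n)) (hj' : j' ∈ intGL F (Fin n ⊕ Fin n))
    (h : (b : GL (Fin n ⊕ Fin n) F) * wLong₂ F n * j = b' * wLong₂ F n * j')
    (i : Fin n ⊕ Fin n) : ‖(borelDiag b i : F)‖ = ‖(borelDiag b' i : F)‖ := by
  have key : ∀ {b b' : borelGL F n} {j j' : GL (Fin n ⊕ Fin n) F},
      j ∈ intGL F (Fin n ⊕ Fin n) → j' ∈ intGL F (Fin n ⊕ Fin n) →
      (b : GL (Fin n ⊕ Fin n) F) * wLong₂ F n * j = b' * wLong₂ F n * j' →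
      ‖(borelDiag b' i : F)‖ ≤ ‖(borelDiag b i : F)‖ := by
    intro b b' j j' hj hj' h
    -- The quotient `b⁻¹ b'` is upper triangular and equals `w j j'⁻¹ w⁻¹`, so it is integral and
    -- its diagonal has norm at most `1`.
    have hk : ((b⁻¹ * b' : borelGL F n) : GL (Fin n ⊕ Fin n) F) ∈ intGL F _ := by
      have : ((b⁻¹ * b' : borelGL F n) : GL (Fin n ⊕ Fin n) F) =
          wLong₂ F n * j * j'⁻¹ * (wLong₂ F n)⁻¹ := by
        rw [Subgroup.coe_mul, Subgroup.coe_inv, inv_mul_eq_iff_eq_mul, ← mul_assoc, ← mul_assoc,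
          ← mul_assoc, h]
        group
      rw [this]
      exact mul_mem (mul_mem (mul_mem wLong₂_mem hj) (inv_mem hj')) (inv_mem wLong₂_mem)
    have e : borelDiag b' = borelDiag b * borelDiag (b⁻¹ * b') := by
      rw [← borelDiag_mul, mul_inv_cancel_left]
    rw [e, Pi.mul_apply, Units.val_mul, norm_mul]
    exact mul_le_of_le_one_right (norm_nonneg _) ((mem_intGL_iff.1 hk).1 i i)
  exact le_antisymm (key hj' hj h.symm) (key hj hj' h)

end Borel

/-! ### Existence and uniqueness of the normalised vector -/

section NormalisedVector

variable {F : Type*} [NontriviallyNormedField F] [IsUltrametricDist F] {n : ℕ} {ϖ : Fˣ} {δ : ℕ}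
  {θ : Fin n ⊕ Fin n → Fˣ →* ℂˣ}

theorem IsNormalisedVector.apply_borel_mul {f : GL (Fin n ⊕ Fin n) F → ℂ}
    (hf : IsNormalisedVector ϖ δ θ f) (b : borelGL F n) (g : GL (Fin n ⊕ Fin n) F) :
    f (b * g) = inducingChar ϖ θ (borelDiag b) * f g := by
  obtain ⟨v, hv, hb⟩ := exists_eq_torus_mul b
  rw [hb, hf.equivariant _ v hv]

/-- On `B w J` the value at `b w j` must be the inducing character of the diagonal of `b` times the
prescribed constant, which gives uniqueness. The recipe is consistent because that diagonal is
determined up to units and the `θ_i` are unramified. -/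
theorem existsUnique_isNormalisedVector (hϖ : IsUniformizer ϖ) (hθ : ∀ i, IsUnramified (θ i)) :
    ∃! f : GL (Fin n ⊕ Fin n) F → ℂ, IsNormalisedVector ϖ δ θ f := by
  classical
  set c : ℂ := alphaN ϖ θ ^ δ * ((resCard F : ℂ) ^ (δ * n ^ 2))⁻¹ with hc
  let C : GL (Fin n ⊕ Fin n) F → borelGL F n → Prop := fun g b =>
    ∃ j ∈ parahoricGL F n ϖ, g = b * wLong₂ F n * j
  let f : GL (Fin n ⊕ Fin n) F → ℂ := fun g =>
    if h : ∃ b, C g b then inducingChar ϖ θ (borelDiag h.choose) * c else 0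
  have hfC : ∀ {g b}, C g b → f g = inducingChar ϖ θ (borelDiag b) * c := by
    intro g b hgb
    have hex : ∃ b, C g b := ⟨b, hgb⟩
    obtain ⟨j, hj, hgj⟩ := hgb
    obtain ⟨j', hj', hgj'⟩ := hex.choose_spec
    simp only [f, dif_pos hex]
    congr 1
    exact inducingChar_congr hθ fun i =>
      norm_borelDiag_eq hj'.1 hj.1 (hgj'.symm.trans hgj) i
  have hf0 : ∀ {g}, (¬ ∃ b, C g b) → f g = 0 := fun h => by simp only [f, dif_neg h]
  have hfn : IsNormalisedVector ϖ δ θ f := by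
    refine ⟨fun t v hv g => ?_, fun g j hj => ?_, fun g hg => ?_, ?_⟩
    · let b₀ : borelGL F n := ⟨torus t * v, torus_mul_mem_borel hv⟩
      have hb₀ : borelDiag b₀ = t := borelDiag_torus_mul hv
      by_cases h : ∃ b, C g b
      · obtain ⟨b, hb⟩ := h
        have h' : C (torus t * v * g) (b₀ * b) := by
          obtain ⟨j, hj, rfl⟩ := hb
          exact ⟨j, hj, by simp only [b₀, Subgroup.coe_mul, mul_assoc]⟩
        rw [hfC hb, hfC h', borelDiag_mul, inducingChar_mul, hb₀, mul_assoc]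
      · have h' : ¬ ∃ b, C (torus t * v * g) b := by
          rintro ⟨b, j, hj, hb⟩
          refine h ⟨b₀⁻¹ * b, j, hj, ?_⟩
          rw [Subgroup.coe_mul, Subgroup.coe_inv, mul_assoc, mul_assoc,
            ← mul_assoc (b : GL (Fin n ⊕ Fin n) F), ← hb]
          exact (inv_mul_cancel_left (torus t * v) g).symm
        rw [hf0 h, hf0 h', mul_zero]
    · have hj' : j ∈ parahoricGL F n ϖ := (mem_parahoricGL_iff hϖ).2 hj
      by_cases h : ∃ b, C g b
      · obtain ⟨b, hb⟩ := h
        have h' : C (g * j) b := by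
          obtain ⟨j₁, hj₁, rfl⟩ := hb
          exact ⟨j₁ * j, mul_mem hj₁ hj', by simp only [mul_assoc]⟩
        rw [hfC hb, hfC h']
      · have h' : ¬ ∃ b, C (g * j) b := by
          rintro ⟨b, j₁, hj₁, hb⟩
          refine h ⟨b, j₁ * j⁻¹, mul_mem hj₁ (inv_mem hj'), ?_⟩
          rw [← mul_assoc, ← hb, mul_inv_cancel_right]
        rw [hf0 h, hf0 h']
    · by_cases h : ∃ b, C g b
      · obtain ⟨b, j, hj, hb⟩ := h
        obtain ⟨v, hv, hbv⟩ := exists_eq_torus_mul b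
        exact ⟨borelDiag b, v, hv, j, (mem_parahoricGL_iff hϖ).1 hj, by rw [← hbv]; exact hb⟩
      · exact absurd (hf0 h) hg
    · have h1 : C (wLong₂ F n) 1 := ⟨1, one_mem _, by simp⟩
      have h2 : inducingChar ϖ θ (borelDiag (1 : borelGL F n)) = 1 := by
        have : borelDiag (1 : borelGL F n) = fun _ => 1 := by
          ext i
          exact Matrix.one_apply_eq i
        rw [this]
        simp [inducingChar, normAbs]
      rw [hfC h1, h2, one_mul]
  refine ⟨f, hfn, fun f' hf' => ?_⟩
  have hagree : ∀ t, ∀ v ∈ upperUnip F n, ∀ j ∈ parahoric F n,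
      f' (torus t * v * wLong₂ F n * j) = f (torus t * v * wLong₂ F n * j) := by
    intro t v hv j hj
    rw [hf'.invariant _ j hj, hfn.invariant _ j hj, hf'.equivariant t v hv, hfn.equivariant t v hv,
      hf'.value, hfn.value]
  ext g
  by_cases h1 : f' g = 0
  · by_cases h2 : f g = 0
    · rw [h1, h2]
    · obtain ⟨t, v, hv, j, hj, rfl⟩ := hfn.support g h2
      exact hagree t v hv j hj
  · obtain ⟨t, v, hv, j, hj, rfl⟩ := hf'.support g h1
    exact hagree t v hv j hj

end NormalisedVector

/-! ### Values of the normalised vector on the opposite cell -/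

section LeviValues

variable {F : Type*} [NontriviallyNormedField F] [IsUltrametricDist F] {n : ℕ} {ϖ : Fˣ} {δ : ℕ}
  {θ : Fin n ⊕ Fin n → Fˣ →* ℂˣ}

theorem blockDiag_mem_parahoric {a d : GL (Fin n) F} (ha : a ∈ intGL F (Fin n))
    (hd : d ∈ intGL F (Fin n)) : blockDiag a d ∈ parahoric F n := by
  have h : ∀ {a d : Matrix (Fin n) (Fin n) F}, (∀ i j, ‖a i j‖ ≤ 1) → (∀ i j, ‖d i j‖ ≤ 1) →
      ∀ i j, ‖Matrix.fromBlocks a 0 0 d i j‖ ≤ 1 := by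
    rintro a d h1 h2 (i | i) (j | j)
    · exact h1 i j
    · simp
    · simp
    · exact h2 i j
  refine mem_parahoric_iff.2 ⟨mem_intGL_iff.2 ⟨h (mem_intGL_iff.1 ha).1 (mem_intGL_iff.1 hd).1,
    h (mem_intGL_iff.1 ha).2 (mem_intGL_iff.1 hd).2⟩, fun i j => ?_⟩
  change ‖(0 : F)‖ < 1
  simp

theorem unip_mem_parahoric {Z : Matrix (Fin n) (Fin n) F} (hZ : ∀ i j, ‖Z i j‖ ≤ 1) :
    unip Z ∈ parahoric F n := by
  have h : ∀ {Z : Matrix (Fin n) (Fin n) F}, (∀ i j, ‖Z i j‖ ≤ 1) →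
      ∀ i j, ‖(Matrix.fromBlocks 1 Z 0 1 : Matrix (Fin n ⊕ Fin n) (Fin n ⊕ Fin n) F) i j‖ ≤ 1 := by
    rintro Z hZ (i | i) (j | j)
    · simp only [Matrix.fromBlocks_apply₁₁, Matrix.one_apply]; split_ifs <;> simp
    · exact hZ i j
    · simp
    · simp only [Matrix.fromBlocks_apply₂₂, Matrix.one_apply]; split_ifs <;> simp
  refine mem_parahoric_iff.2 ⟨mem_intGL_iff.2 ⟨h hZ, h (Z := -Z) (by simpa using hZ)⟩, fun i j => ?_⟩
  change ‖(0 : F)‖ < 1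
  simp

theorem blockDiag_mul (a b c d : GL (Fin n) F) :
    blockDiag a b * blockDiag c d = blockDiag (a * c) (b * d) := by
  refine Units.ext ?_
  change Matrix.fromBlocks _ _ _ _ * Matrix.fromBlocks _ _ _ _ = Matrix.fromBlocks _ _ _ _
  simp [Matrix.fromBlocks_multiply]

theorem blockDiag_mul_blockSwap (a d : GL (Fin n) F) :
    blockDiag a d * blockSwap F n = blockSwap F n * blockDiag d a := by
  refine Units.ext ?_
  change Matrix.fromBlocks _ _ _ _ * Matrix.fromBlocks _ _ _ _ =
    Matrix.fromBlocks _ _ _ _ * Matrix.fromBlocks _ _ _ _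
  simp [Matrix.fromBlocks_multiply]

theorem blockSwap_eq : blockSwap F n = wLong₂ F n * blockDiag (wLong F n) (wLong F n) := by
  refine Units.ext ?_
  change Matrix.fromBlocks _ _ _ _ = Matrix.fromBlocks _ _ _ _ * Matrix.fromBlocks _ _ _ _
  have : (wLong F n).val = antidiag F n := rfl
  simp [Matrix.fromBlocks_multiply, this, antidiag_mul_antidiag]

/-- Since `b` is block upper triangular, `j (unip Z)⁻¹` is block lower triangular, that is, `j₂ = j₁
Z`. With `(P, Q)` the top block row of `j⁻¹`, the relation `P j₁ + Q j₃ = 1` yields `Z = P j₂ + Q j₃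
Z`. The entries of `j₃` have norm less than `1`, so an entry of `Z` of maximal norm cannot exceed
`1`. -/
theorem integral_of_mem_cell {a d : GL (Fin n) F} {Z : Matrix (Fin n) (Fin n) F}
    {b j : GL (Fin n ⊕ Fin n) F} (hb : b ∈ borelGL F n) (hj : j ∈ parahoric F n)
    (h : blockDiag a d * blockSwap F n * unip Z = b * wLong₂ F n * j) : ∀ i k, ‖Z i k‖ ≤ 1 := by
  obtain ⟨hjK, hjl⟩ := mem_parahoric_iff.1 hj
  set j₁ := j.val.toBlocks₁₁
  set j₂ := j.val.toBlocks₁₂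
  set j₃ := j.val.toBlocks₂₁
  set j₄ := j.val.toBlocks₂₂
  have hjb : j.val = Matrix.fromBlocks j₁ j₂ j₃ j₄ := (Matrix.fromBlocks_toBlocks _).symm
  set P := (j⁻¹).val.toBlocks₁₁
  set Q := (j⁻¹).val.toBlocks₁₂
  have hji : (j⁻¹).val = Matrix.fromBlocks P Q (j⁻¹).val.toBlocks₂₁ (j⁻¹).val.toBlocks₂₂ :=
    (Matrix.fromBlocks_toBlocks _).symm
  have hPQ : P * j₁ + Q * j₃ = 1 := by
    have := j.inv_mul
    rw [hjb, hji, Matrix.fromBlocks_multiply, ← Matrix.fromBlocks_one] at this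
    exact (Matrix.fromBlocks_inj.1 this).1
  have hbi : (b⁻¹).val.toBlocks₂₁ = 0 := by
    ext i k
    exact (borelGL F n).inv_mem hb (Sum.Lex.inl_lt_inr k i)
  have hj₂ : j₂ = j₁ * Z := by
    have h1 : j * (unip Z)⁻¹ = (wLong₂ F n)⁻¹ * (b⁻¹ * (blockDiag a d * blockSwap F n)) := by
      rw [mul_inv_eq_iff_eq_mul, eq_comm, mul_assoc, inv_mul_eq_iff_eq_mul, mul_assoc,
        inv_mul_eq_iff_eq_mul, h, mul_assoc]
    have h2 := congrArg Units.val h1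
    have e1 : ((unip Z)⁻¹ : GL (Fin n ⊕ Fin n) F).val = Matrix.fromBlocks 1 (-Z) 0 1 := rfl
    have e2 : ((wLong₂ F n)⁻¹).val = Matrix.fromBlocks 0 (antidiag F n) (antidiag F n) 0 := rfl
    have e3 : (blockDiag a d * blockSwap F n).val = Matrix.fromBlocks 0 a.val d.val 0 := by
      change Matrix.fromBlocks _ _ _ _ * Matrix.fromBlocks _ _ _ _ = _
      simp [Matrix.fromBlocks_multiply]
    rw [Units.val_mul, Units.val_mul, Units.val_mul, e1, e2, e3, hjb,
      ← Matrix.fromBlocks_toBlocks (b⁻¹).val, hbi, Matrix.fromBlocks_multiply,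
      Matrix.fromBlocks_multiply, Matrix.fromBlocks_multiply] at h2
    have h3 := (Matrix.fromBlocks_inj.1 h2).2.1
    simp only [mul_neg, mul_one, mul_zero, zero_mul, add_zero] at h3
    exact (neg_add_eq_zero.1 h3).symm
  have hZ : Z = P * j₂ + Q * (j₃ * Z) := by
    rw [hj₂, ← mul_assoc, ← mul_assoc, ← add_mul, hPQ, one_mul]
  rcases isEmpty_or_nonempty (Fin n) with hn | hn
  · exact fun i => (hn.false i).elim
  obtain ⟨⟨i₀, k₀⟩, hmax⟩ := Finite.exists_max fun p : Fin n × Fin n => ‖Z p.1 p.2‖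
  have hmax : ∀ i k, ‖Z i k‖ ≤ ‖Z i₀ k₀‖ := fun i k => hmax (i, k)
  by_contra! hcon
  obtain ⟨i, k, hik⟩ := hcon
  have hbig : 1 < ‖Z i₀ k₀‖ := hik.trans_le (hmax i k)
  obtain ⟨r, hr0, hr1, hr⟩ : ∃ r : ℝ, 0 ≤ r ∧ r < 1 ∧ ∀ i k, ‖j₃ i k‖ ≤ r := by
    obtain ⟨⟨i₁, k₁⟩, h1⟩ := Finite.exists_max fun p : Fin n × Fin n => ‖j₃ p.1 p.2‖
    exact ⟨‖j₃ i₁ k₁‖, norm_nonneg _, hjl i₁ k₁, fun i k => h1 (i, k)⟩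
  have h1 : ‖(P * j₂) i₀ k₀‖ ≤ 1 * 1 := norm_mul_apply_le zero_le_one zero_le_one
    (fun i k => (mem_intGL_iff.1 hjK).2 _ _) (fun i k => (mem_intGL_iff.1 hjK).1 _ _) _ _
  have h2 : ‖(Q * (j₃ * Z)) i₀ k₀‖ ≤ 1 * (r * ‖Z i₀ k₀‖) :=
    norm_mul_apply_le zero_le_one (by positivity) (fun i k => (mem_intGL_iff.1 hjK).2 _ _)
      (norm_mul_apply_le hr0 (norm_nonneg _) hr hmax) _ _
  have h3 : ‖Z i₀ k₀‖ ≤ max (1 * 1) (1 * (r * ‖Z i₀ k₀‖)) := by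
    conv_lhs => rw [hZ]
    exact (IsUltrametricDist.norm_add_le_max _ _).trans (max_le_max h1 h2)
  rcases le_max_iff.1 h3 with h4 | h4 <;> nlinarith

/-- The restriction of a function on `GL_{2n}` to the second factor of the Levi subgroup, translated
by `[[0, 1], [1, 0]]`. -/
def leviValue (f : GL (Fin n ⊕ Fin n) F → ℂ) (d : GL (Fin n) F) : ℂ :=
  f (blockDiag 1 d * blockSwap F n)

open Classical in
-- For integral `Z` the matrix `unip Z` lies in `J`. The factor `k` can be moved past `blockSwap`
-- and is then absorbed by `J` as well.
theorem IsNormalisedVector.apply_blockDiag {f : GL (Fin n ⊕ Fin n) F → ℂ}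
    (hf : IsNormalisedVector ϖ δ θ f) {k : GL (Fin n) F} (hk : k ∈ intGL F (Fin n))
    (d : GL (Fin n) F) (Z : Matrix (Fin n) (Fin n) F) :
    f (blockDiag k d * blockSwap F n * unip Z) =
      if ∀ i j, ‖Z i j‖ ≤ 1 then leviValue f d else 0 := by
  split_ifs with hZ
  · rw [hf.invariant _ _ (unip_mem_parahoric hZ), leviValue]
    have e1 : blockDiag k d = blockDiag 1 d * blockDiag k 1 := by rw [blockDiag_mul]; simp
    rw [e1, mul_assoc, blockDiag_mul_blockSwap k, ← mul_assoc,
      hf.invariant _ _ (blockDiag_mem_parahoric (one_mem _) hk)]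
  · by_contra hne
    obtain ⟨t, v, hv, j, hj, h⟩ := hf.support _ hne
    exact hZ (integral_of_mem_cell (torus_mul_mem_borel hv) hj h)

theorem IsNormalisedVector.leviValue_mul {f : GL (Fin n ⊕ Fin n) F → ℂ}
    (hf : IsNormalisedVector ϖ δ θ f) {k : GL (Fin n) F} (hk : k ∈ intGL F (Fin n))
    (d : GL (Fin n) F) : leviValue f (d * k) = leviValue f d := by
  have e1 : blockDiag 1 (d * k) = blockDiag 1 d * blockDiag 1 k := by rw [blockDiag_mul]; simp
  rw [leviValue, leviValue, e1, mul_assoc, blockDiag_mul_blockSwap 1 k, ← mul_assoc,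
    hf.invariant _ _ (blockDiag_mem_parahoric hk (one_mem _))]

theorem IsNormalisedVector.leviValue_one {f : GL (Fin n ⊕ Fin n) F → ℂ}
    (hf : IsNormalisedVector ϖ δ θ f) :
    leviValue f 1 = alphaN ϖ θ ^ δ * ((resCard F : ℂ) ^ (δ * n ^ 2))⁻¹ := by
  have e1 : blockDiag 1 1 = (1 : GL (Fin n ⊕ Fin n) F) := by
    refine Units.ext ?_
    change Matrix.fromBlocks 1 0 0 1 = 1
    exact Matrix.fromBlocks_one
  rw [leviValue, e1, one_mul, blockSwap_eq,
    hf.invariant _ _ (blockDiag_mem_parahoric wLong_mem wLong_mem), hf.value]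

theorem IsNormalisedVector.leviValue_upGL_mul {f : GL (Fin n ⊕ Fin n) F → ℂ}
    (hf : IsNormalisedVector ϖ δ θ f) (t : Fin n → Fˣ) (y : StrictPair n → F) (d : GL (Fin n) F) :
    leviValue f (upGL t y * d) =
      inducingChar ϖ θ (Sum.elim (fun _ => 1) t) * leviValue f d := by
  have hb : blockDiag 1 (upGL t y) ∈ borelGL F n := by
    change (Matrix.fromBlocks 1 0 0 (upMat t y)).BlockTriangular toLex
    rintro (i | i) (j | j) hij
    · have h : j < i := Sum.Lex.inl_lt_inl_iff.1 hij
      exact Matrix.one_apply_ne h.ne'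
    · rfl
    · rfl
    · have h : j < i := Sum.Lex.inr_lt_inr_iff.1 hij
      exact upMat_blockTriangular t y h
  have hd : borelDiag ⟨blockDiag 1 (upGL t y), hb⟩ = Sum.elim (fun _ => 1) t := by
    ext i
    rcases i with i | i
    · exact Matrix.one_apply_eq i
    · exact upMat_diag t y i
  have e1 : blockDiag 1 (upGL t y * d) = blockDiag 1 (upGL t y) * blockDiag 1 d := by
    rw [blockDiag_mul]; simp
  rw [leviValue, e1, mul_assoc]
  have := hf.apply_borel_mul ⟨_, hb⟩ (blockDiag 1 d * blockSwap F n)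
  rw [hd] at this
  exact this

theorem IsNormalisedVector.leviValue_upGL {f : GL (Fin n ⊕ Fin n) F → ℂ}
    (hf : IsNormalisedVector ϖ δ θ f) (t : Fin n → Fˣ) (y : StrictPair n → F) :
    leviValue f (upGL t y) = inducingChar ϖ θ (Sum.elim (fun _ => 1) t) * leviValue f 1 := by
  rw [← hf.leviValue_upGL_mul t y, mul_one]

end LeviValues

end ParahoricZeta

namespace ParahoricZeta

/-! ### Additive characters and their duality -/

section SmoothCharacter

variable {F : Type*} [NontriviallyNormedField F] [IsUltrametricDist F] {n : ℕ} {ϖ : Fˣ} {δ : ℕ}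
  {e : F → ℂ}

/-- `e` is a unitary additive character whose largest fractional ideal of triviality is
`ϖ ^ (-δ) 𝒪`. -/
structure IsSmoothChar (ϖ : Fˣ) (δ : ℕ) (e : F → ℂ) : Prop where
  map_add : ∀ x y, e (x + y) = e x * e y
  norm_eq_one : ∀ x, ‖e x‖ = 1
  dual : ∀ x, (∀ y, ‖y‖ ≤ 1 → e (x * y) = 1) ↔ ‖x‖ ≤ ‖(ϖ : F)‖ ^ (-(δ : ℤ))

theorem IsSmoothChar.ne_zero (he : IsSmoothChar ϖ δ e) (x : F) : e x ≠ 0 :=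
  norm_ne_zero_iff.1 (by rw [he.norm_eq_one]; exact one_ne_zero)

theorem IsSmoothChar.map_zero (he : IsSmoothChar ϖ δ e) : e 0 = 1 := by
  have h := he.map_add 0 0
  rw [add_zero] at h
  exact (mul_eq_left₀ (he.ne_zero 0)).1 h.symm

theorem IsSmoothChar.map_sum (he : IsSmoothChar ϖ δ e) {ι : Type*} (s : Finset ι) (f : ι → F) :
    e (∑ i ∈ s, f i) = ∏ i ∈ s, e (f i) := by
  classical
  induction s using Finset.induction_on with
  | empty => simpa using he.map_zero
  | insert a s ha ih => rw [Finset.sum_insert ha, Finset.prod_insert ha, he.map_add, ih]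

theorem IsSmoothChar.eq_one (he : IsSmoothChar ϖ δ e) {x : F}
    (hx : ‖x‖ ≤ ‖(ϖ : F)‖ ^ (-(δ : ℤ))) : e x = 1 := by
  simpa using (he.dual x).2 hx 1 (by simp)

theorem IsSmoothChar.continuous (he : IsSmoothChar ϖ δ e) : Continuous e := by
  refine continuous_iff_continuousAt.2 fun x => ?_
  have hr : 0 < ‖(ϖ : F)‖ ^ (-(δ : ℤ)) := zpow_pos (norm_units_pos ϖ) _
  have : e =ᶠ[nhds x] fun _ => e x := by
    filter_upwards [Metric.ball_mem_nhds x hr] with y hy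
    have h1 : e (y - x) = 1 := he.eq_one (by rw [← dist_eq_norm]; exact (Metric.mem_ball.1 hy).le)
    rw [← sub_add_cancel y x, he.map_add, h1, one_mul]
  exact (continuousAt_congr this).2 continuousAt_const

/-- Testing against multiples of elementary matrices isolates the entries of `A`, so duality for
matrices follows from duality for scalars. -/
theorem IsSmoothChar.trace_dual (he : IsSmoothChar ϖ δ e) (A : Matrix (Fin n) (Fin n) F) :
    (∀ Z : Matrix (Fin n) (Fin n) F, (∀ i j, ‖Z i j‖ ≤ 1) → e (A * Z).trace = 1) ↔
      ∀ i j, ‖A i j‖ ≤ ‖(ϖ : F)‖ ^ (-(δ : ℤ)) := by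
  constructor
  · intro h i j
    refine (he.dual _).1 fun y hy => ?_
    have := h (Matrix.single j i y) fun k l => by
      rw [Matrix.single_apply]; split_ifs <;> simp [hy]
    rwa [Matrix.trace_mul_single] at this
  · intro h Z hZ
    have hr : 0 ≤ ‖(ϖ : F)‖ ^ (-(δ : ℤ)) := (zpow_pos (norm_units_pos ϖ) _).le
    refine he.eq_one ?_
    refine IsUltrametricDist.norm_sum_le_of_forall_le_of_nonneg hr fun i _ => ?_
    simpa using norm_mul_apply_le hr zero_le_one h hZ i i

theorem IsSmoothChar.neg (he : IsSmoothChar ϖ δ e) : IsSmoothChar ϖ δ fun x => e (-x) := by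
  refine ⟨fun x y => ?_, fun x => he.norm_eq_one _, fun x => ?_⟩
  · rw [neg_add, he.map_add]
  · rw [← norm_neg x, ← he.dual (-x)]
    simp

end SmoothCharacter

/-! ### Evaluation of the Shalika function -/

section LatticeIntegral

variable {F : Type*} [NontriviallyNormedField F] [IsUltrametricDist F] {n : ℕ} [ProperSpace F]
  [MeasurableSpace F] [BorelSpace F]
  [MeasurableSpace (Matrix (Fin n) (Fin n) F)] [BorelSpace (Matrix (Fin n) (Fin n) F)]
  (dX : Measure (Matrix (Fin n) (Fin n) F)) [dX.IsAddHaarMeasure]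
  {ϖ : Fˣ} {δ : ℕ} {e : F → ℂ}

/-- The lattice `g M_n(𝒪)`. -/
def latticeGL (g : GL (Fin n) F) : AddSubgroup (Matrix (Fin n) (Fin n) F) where
  carrier := {X | ∀ i j, ‖((g⁻¹).val * X) i j‖ ≤ 1}
  zero_mem' := by simp
  add_mem' := by
    intro X Y hX hY i j
    rw [mul_add, Matrix.add_apply]
    exact (IsUltrametricDist.norm_add_le_max _ _).trans (max_le (hX i j) (hY i j))
  neg_mem' := by
    intro X hX i j
    rw [mul_neg, Matrix.neg_apply, norm_neg]
    exact hX i j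

theorem isClosed_latticeGL (g : GL (Fin n) F) :
    IsClosed (latticeGL g : Set (Matrix (Fin n) (Fin n) F)) :=
  (isClosed_matrix_norm_le (F := F) (n := n) 1).preimage
    (continuous_const.matrix_mul continuous_id : Continuous fun X => (g⁻¹).val * X)

open Classical in
-- Orthogonality applies: by duality `X ↦ e(-tr X)` is trivial on `g M_n(𝒪)` exactly when `g` has
-- entries in `ϖ^(-δ) 𝒪`, and the lattice has volume `|det g|^n`.
theorem setIntegral_lattice_coset (hϖ : IsUniformizer ϖ) (he : IsSmoothChar ϖ δ e)
    {μ : Measure F} [μ.IsAddHaarMeasure] (hμ : μ {x | ‖x‖ ≤ 1} = 1)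
    (hdX : dX {X | ∀ i j, ‖X i j‖ ≤ 1} = 1)
    (g : GL (Fin n) F) (A : Matrix (Fin n) (Fin n) F) :
    ∫ X in {X | X - A ∈ latticeGL g}, e (-X.trace) ∂dX =
      e (-A.trace) * if ∀ i j, ‖g.val i j‖ ≤ ‖(ϖ : F)‖ ^ (-(δ : ℤ)) then
        ((normAbs ϖ (Matrix.GeneralLinearGroup.det g : F) ^ n : ℝ) : ℂ) else 0 := by
  have hadd : ∀ X Y : Matrix (Fin n) (Fin n) F, e (-(X + Y).trace) = e (-X.trace) * e (-Y.trace) :=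
    fun X Y => by rw [Matrix.trace_add, neg_add, he.map_add]
  rw [setIntegral_char_coset dX (latticeGL g) (isClosed_latticeGL g).measurableSet
    (e := fun X => e (-X.trace)) hadd, setIntegral_char dX (latticeGL g)
    (isClosed_latticeGL g).measurableSet (e := fun X => e (-X.trace)) hadd]
  congr 1
  have h1 : (∀ X ∈ latticeGL g, e (-X.trace) = 1) ↔
      ∀ i j, ‖g.val i j‖ ≤ ‖(ϖ : F)‖ ^ (-(δ : ℤ)) := by
    rw [← he.neg.trace_dual]
    constructor
    · intro h Z hZ
      refine h (g.val * Z) fun i j => ?_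
      rw [← mul_assoc, g.inv_mul, one_mul]
      exact hZ i j
    · intro h X hX
      have := h ((g⁻¹).val * X) hX
      rwa [← mul_assoc, g.mul_inv, one_mul] at this
  rw [if_congr h1 rfl rfl]
  congr 2
  have h2 : dX (latticeGL g : Set (Matrix (Fin n) (Fin n) F)) =
      ENNReal.ofReal (normAbs ϖ (Matrix.GeneralLinearGroup.det g : F) ^ n) :=
    measure_lattice dX μ hϖ hdX hμ g
  rw [Measure.real, h2, ENNReal.toReal_ofReal (pow_nonneg (normAbs_pos _).le _)]

end LatticeIntegral

section Shalika

variable {F : Type*} [NontriviallyNormedField F] [IsUltrametricDist F] {n : ℕ} {ϖ : Fˣ} {δ : ℕ}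
  {e : F → ℂ} {θ : Fin n ⊕ Fin n → Fˣ →* ℂˣ} {η : Fˣ →* ℂˣ}

theorem tMat_pow (ϖ : Fˣ) (β : ℕ) :
    tMat n ϖ ^ β = blockDiag (Matrix.GeneralLinearGroup.scalar (Fin n) (ϖ ^ β)) 1 := by
  induction β with
  | zero =>
    rw [pow_zero, pow_zero, map_one]
    refine Units.ext ?_
    exact Matrix.fromBlocks_one.symm
  | succ b ih =>
    rw [pow_succ, ih, tMat, blockDiag_mul, ← map_mul, one_mul, pow_succ]

theorem scalar_val (c : Fˣ) :
    (Matrix.GeneralLinearGroup.scalar (Fin n) c).val = Matrix.scalar (Fin n) (c : F) := rfl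

theorem scalar_comm (c : Fˣ) (h : GL (Fin n) F) :
    h * Matrix.GeneralLinearGroup.scalar (Fin n) c =
      Matrix.GeneralLinearGroup.scalar (Fin n) c * h := by
  refine Units.ext ?_
  rw [Units.val_mul, Units.val_mul, scalar_val]
  exact (Matrix.scalar_commute (c : F) (fun r => Commute.all _ _) h.val).eq.symm

/-- The matrix identity behind the evaluation of the Shalika function. -/
theorem shalika_matrix_identity (ϖ : Fˣ) (β : ℕ) (h k : GL (Fin n) F)
    (X : Matrix (Fin n) (Fin n) F) :
    blockSwap F n * unip X * blockDiag k k *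
        (blockDiag h 1 * ((uMat F n)⁻¹ * tMat n ϖ ^ β)) =
      blockDiag k (k * h * Matrix.GeneralLinearGroup.scalar (Fin n) (ϖ ^ β)) * blockSwap F n *
        unip (((k * h * Matrix.GeneralLinearGroup.scalar (Fin n) (ϖ ^ β))⁻¹).val *
          (X - k.val * h.val * antidiag F n * (k⁻¹).val) * k.val) := by
  rw [tMat_pow]
  set c := Matrix.GeneralLinearGroup.scalar (Fin n) (ϖ ^ β)
  set g := k * h * c with hg
  have hcg : k.val * h.val * c.val = g.val := by rw [hg, Units.val_mul, Units.val_mul]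
  refine Units.ext ?_
  have e1 : ((uMat F n)⁻¹ : GL (Fin n ⊕ Fin n) F).val = Matrix.fromBlocks 1 (-antidiag F n) 0 1 := rfl
  have e2 : ∀ a d : GL (Fin n) F, (blockDiag a d).val = Matrix.fromBlocks a.val 0 0 d.val :=
    fun _ _ => rfl
  have e3 : (blockSwap F n).val = Matrix.fromBlocks 0 1 1 0 := rfl
  have e4 : ∀ Z : Matrix (Fin n) (Fin n) F, (unip Z).val = Matrix.fromBlocks 1 Z 0 1 := fun _ => rfl
  simp only [Units.val_mul, e1, e2, e3, e4, Matrix.fromBlocks_multiply, Units.val_one]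
  simp only [mul_zero, zero_mul, mul_one, one_mul, zero_add, add_zero, mul_neg, neg_zero]
  refine Matrix.fromBlocks_inj.2 ⟨rfl, rfl, ?_, ?_⟩
  · rw [← hcg, mul_assoc]
  · rw [← mul_assoc, ← mul_assoc g.val, ← mul_assoc g.val, g.mul_inv, one_mul, sub_mul,
      mul_assoc _ (k⁻¹).val k.val, k.inv_mul, mul_one, neg_add_eq_sub]

theorem det_unramified_eq_one (hη : IsUnramified η) {k : GL (Fin n) F} (hk : k ∈ intGL F (Fin n)) :
    η (Matrix.GeneralLinearGroup.det k) = 1 :=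
  hη _ (norm_det_of_mem_intGL hk)

theorem mul_mem_lattice_iff {g k : GL (Fin n) F} (hk : k ∈ intGL F (Fin n))
    (Y : Matrix (Fin n) (Fin n) F) :
    (∀ i j, ‖((g⁻¹).val * Y * k.val) i j‖ ≤ 1) ↔ Y ∈ latticeGL g := by
  have hK := mem_intGL_iff.1 hk
  constructor
  · intro h i j
    have e1 : (g⁻¹).val * Y = (g⁻¹).val * Y * k.val * (k⁻¹).val := by
      rw [mul_assoc, k.mul_inv, mul_one]
    rw [e1]
    simpa using norm_mul_apply_le zero_le_one zero_le_one h hK.2 i j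
  · intro h i j
    simpa using norm_mul_apply_le zero_le_one zero_le_one h hK.1 i j

open Classical in
theorem shalikaIntegrand_eq {F₀ : GL (Fin n ⊕ Fin n) F → ℂ} (hF : IsNormalisedVector ϖ δ θ F₀)
    (hη : IsUnramified η) (β : ℕ) (h : GL (Fin n) F) {k : GL (Fin n) F}
    (hk : k ∈ intGL F (Fin n)) (X : Matrix (Fin n) (Fin n) F) :
    shalikaIntegrand e η F₀ (blockDiag h 1 * ((uMat F n)⁻¹ * tMat n ϖ ^ β)) k X =
      if X - k.val * h.val * antidiag F n * (k⁻¹).val ∈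
          latticeGL (k * h * Matrix.GeneralLinearGroup.scalar (Fin n) (ϖ ^ β)) then
        leviValue F₀ (k * h * Matrix.GeneralLinearGroup.scalar (Fin n) (ϖ ^ β)) * e (-X.trace)
      else 0 := by
  rw [shalikaIntegrand, shalika_matrix_identity, hF.apply_blockDiag hk, det_unramified_eq_one hη hk,
    if_congr (mul_mem_lattice_iff hk _) rfl rfl]
  split_ifs <;> simp

/-- Scalars are central and upper triangular, so each factor `ϖ` comes out as the inducing character
at `diag(1, …, 1, ϖ, …, ϖ)`. -/
theorem IsNormalisedVector.leviValue_mul_scalar {f : GL (Fin n ⊕ Fin n) F → ℂ}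
    (hf : IsNormalisedVector ϖ δ θ f) (d : GL (Fin n) F) (β : ℕ) :
    leviValue f (d * Matrix.GeneralLinearGroup.scalar (Fin n) (ϖ ^ β)) =
      alphaN ϖ θ ^ β * leviValue f d := by
  induction β with
  | zero => simp
  | succ b ih =>
    have h1 : Matrix.GeneralLinearGroup.scalar (Fin n) ϖ = upGL (fun _ => ϖ) 0 := by
      refine eq_upGL (fun i j h => ?_) (fun i => ?_) fun p => ?_
      · rw [scalar_val, Matrix.scalar_apply, Matrix.diagonal_apply_ne _ h.ne']
      · rw [scalar_val, Matrix.scalar_apply, Matrix.diagonal_apply_eq]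
      · rw [scalar_val, Matrix.scalar_apply, Matrix.diagonal_apply_ne _ p.2.ne]; rfl
    rw [pow_succ, map_mul, ← mul_assoc, scalar_comm ϖ, h1, hf.leviValue_upGL_mul, ih, pow_succ',
      mul_assoc]
    rfl

end Shalika

section ShalikaValue

variable {F : Type*} [NontriviallyNormedField F] [IsUltrametricDist F] {n : ℕ} {ϖ : Fˣ} {δ : ℕ}
  {e : F → ℂ} {θ : Fin n ⊕ Fin n → Fˣ →* ℂˣ} {η : Fˣ →* ℂˣ} [ProperSpace F]
  [MeasurableSpace F] [BorelSpace F]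
  [MeasurableSpace (Matrix (Fin n) (Fin n) F)] [BorelSpace (Matrix (Fin n) (Fin n) F)]
  (dX : Measure (Matrix (Fin n) (Fin n) F)) [dX.IsAddHaarMeasure]
  (dk : Measure (GL (Fin n) F)) [dk.IsHaarMeasure]

theorem norm_mul_intGL_le_iff {k h : GL (Fin n) F} (hk : k ∈ intGL F (Fin n)) {r : ℝ} (hr : 0 ≤ r) :
    (∀ i j, ‖(k * h).val i j‖ ≤ r) ↔ ∀ i j, ‖h.val i j‖ ≤ r := by
  have hK := mem_intGL_iff.1 hk
  constructor
  · intro H i j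
    have e1 : h.val = (k⁻¹).val * (k * h).val := by rw [← Units.val_mul, inv_mul_cancel_left]
    rw [e1]
    simpa using norm_mul_apply_le zero_le_one hr hK.2 H i j
  · intro H i j
    simpa using norm_mul_apply_le zero_le_one hr hK.1 H i j

theorem norm_mul_intGL_right_le_iff {k h : GL (Fin n) F} (hk : k ∈ intGL F (Fin n)) {r : ℝ}
    (hr : 0 ≤ r) : (∀ i j, ‖(h * k).val i j‖ ≤ r) ↔ ∀ i j, ‖h.val i j‖ ≤ r := by
  have hK := mem_intGL_iff.1 hk
  constructor
  · intro H i j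
    have e1 : h.val = (h * k).val * (k⁻¹).val := by rw [← Units.val_mul, mul_inv_cancel_right]
    rw [e1]
    simpa using norm_mul_apply_le hr zero_le_one H hK.2 i j
  · intro H i j
    simpa using norm_mul_apply_le hr zero_le_one H hK.1 i j

open Classical in
-- For fixed `k` the integral over `X` runs over a lattice coset. Its centre `k h w_n k⁻¹` has trace
-- `tr(h w_n)`, and neither the determinant factor nor the cut-off depends on `k`, so only
-- `leviValue` stays under the integral over `k`. The power `q^(-β n²)` is `|det ϖ^β|^n`.
theorem shalikaFun_eq (hϖ : IsUniformizer ϖ) (he : IsSmoothChar ϖ δ e)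
    {μ : Measure F} [μ.IsAddHaarMeasure] (hμ : μ {x | ‖x‖ ≤ 1} = 1)
    (hdX : dX {X | ∀ i j, ‖X i j‖ ≤ 1} = 1)
    {F₀ : GL (Fin n ⊕ Fin n) F → ℂ} (hF : IsNormalisedVector ϖ δ θ F₀)
    (hη : IsUnramified η) (β : ℕ) (h : GL (Fin n) F) :
    shalikaFun dk dX e η F₀ (blockDiag h 1 * ((uMat F n)⁻¹ * tMat n ϖ ^ β)) =
      alphaN ϖ θ ^ β * ((resCard F : ℂ) ^ (β * n ^ 2))⁻¹ *
        (((normAbs ϖ (Matrix.GeneralLinearGroup.det h : F) ^ n : ℝ) : ℂ) *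
          e (-(h.val * antidiag F n).trace) *
          (if ∀ i j, ‖h.val i j‖ ≤ ‖(ϖ : F)‖ ^ (-((β + δ : ℕ) : ℤ)) then 1 else 0)) *
        ∫ k in (intGL F (Fin n) : Set (GL (Fin n) F)), leviValue F₀ (k * h) ∂dk := by
  have h0 := norm_units_pos ϖ
  rw [shalikaFun, maxCompact_eq, ← integral_const_mul]
  refine setIntegral_congr_fun isOpen_intGL.measurableSet fun k hk => ?_
  have hk : k ∈ intGL F (Fin n) := hk
  simp only [shalikaIntegrand_eq hF hη β h hk]
  set c := Matrix.GeneralLinearGroup.scalar (Fin n) (ϖ ^ β) with hc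
  set A := k.val * h.val * antidiag F n * (k⁻¹).val with hA
  have hms : MeasurableSet {X | X - A ∈ latticeGL (k * h * c)} :=
    ((isClosed_latticeGL (k * h * c)).preimage (continuous_sub_right A)).measurableSet
  have e1 : ∀ X, (if X - A ∈ latticeGL (k * h * c) then leviValue F₀ (k * h * c) * e (-X.trace)
      else 0) = {X | X - A ∈ latticeGL (k * h * c)}.indicator
        (fun X => leviValue F₀ (k * h * c) * e (-X.trace)) X := fun X => by
    simp only [Set.indicator, Set.mem_ofPred_eq]
  simp_rw [e1]
  rw [integral_indicator hms, integral_const_mul, setIntegral_lattice_coset dX hϖ he hμ hdX,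
    hF.leviValue_mul_scalar]
  have htr : A.trace = (h.val * antidiag F n).trace := by
    rw [hA, Matrix.trace_mul_comm, mul_assoc, ← mul_assoc, k.inv_mul, one_mul]
  have hentry : ∀ g : GL (Fin n) F, ∀ i j, (g * c).val i j = g.val i j * (ϖ : F) ^ β := by
    intro g i j
    rw [Units.val_mul, hc, scalar_val, Matrix.scalar_apply, Matrix.mul_diagonal, Units.val_pow_eq_pow_val]
  have hcut : (∀ i j, ‖(k * h * c).val i j‖ ≤ ‖(ϖ : F)‖ ^ (-(δ : ℤ))) ↔
      ∀ i j, ‖h.val i j‖ ≤ ‖(ϖ : F)‖ ^ (-((β + δ : ℕ) : ℤ)) := by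
    rw [← norm_mul_intGL_le_iff (h := h) hk (zpow_pos h0 _).le]
    refine forall_congr' fun i => forall_congr' fun j => ?_
    rw [hentry, norm_mul, norm_pow, ← le_div_iff₀ (pow_pos h0 β), ← zpow_natCast ‖(ϖ : F)‖ β,
      ← zpow_sub₀ h0.ne']
    have : -((β + δ : ℕ) : ℤ) = -(δ : ℤ) - β := by push_cast; ring
    rw [this]
  rw [if_congr hcut rfl rfl, htr]
  split_ifs with hcase
  · have hdet : normAbs ϖ (Matrix.GeneralLinearGroup.det (k * h * c) : F) =
        normAbs ϖ (Matrix.GeneralLinearGroup.det h : F) * ((resCard F : ℝ) ^ (β * n))⁻¹ := by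
      have e2 : ((Matrix.GeneralLinearGroup.det (k * h * c) : Fˣ) : F) =
          k.val.det * h.val.det * ((ϖ : F) ^ (β * n)) := by
        change (k * h * c).val.det = _
        rw [Units.val_mul, Units.val_mul, Matrix.det_mul, Matrix.det_mul, hc, scalar_val]
        simp [Matrix.scalar_apply, pow_mul]
      have e3 : normAbs ϖ ((ϖ : F) ^ (β * n)) = ((resCard F : ℝ) ^ (β * n))⁻¹ := by
        have := normAbs_eq_zpow hϖ (ϖ ^ (β * n))
        rw [Units.val_pow_eq_pow_val] at this
        rw [this, ← zpow_natCast ϖ, ord_zpow, zpow_neg, zpow_natCast]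
      rw [e2, normAbs_mul, normAbs_mul, normAbs_of_norm_one (norm_det_of_mem_intGL hk), one_mul, e3]
      rfl
    rw [hdet]
    push_cast
    ring
  · ring

theorem continuous_leviValue {F₀ : GL (Fin n ⊕ Fin n) F → ℂ}
    (hF : IsNormalisedVector ϖ δ θ F₀) : Continuous (leviValue F₀) :=
  continuous_of_mul_eq isOpen_intGL fun d _ hk => hF.leviValue_mul hk d

theorem IsNormalisedVector.continuous (hϖ : IsUniformizer ϖ) {F₀ : GL (Fin n ⊕ Fin n) F → ℂ}
    (hF : IsNormalisedVector ϖ δ θ F₀) : Continuous F₀ :=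
  continuous_of_mul_eq (isOpen_parahoricGL ϖ) fun g _ hj =>
    hF.invariant g _ ((mem_parahoricGL_iff hϖ).1 hj)

variable (F) in
/-- The group of units `𝒪ˣ`, as a subgroup of `Fˣ`. -/
def unitSubgroup : Subgroup Fˣ where
  carrier := unitSet F
  one_mem' := by simp [unitSet]
  mul_mem' := by
    intro a b ha hb
    have ha : ‖(a : F)‖ = 1 := ha
    have hb : ‖(b : F)‖ = 1 := hb
    simp [unitSet, ha, hb]
  inv_mem' := by
    intro a ha
    have ha : ‖(a : F)‖ = 1 := ha
    simp [unitSet, ha]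

theorem IsUnramified.continuous {χ : Fˣ →* ℂˣ} (hχ : IsUnramified χ) : Continuous χ :=
  continuous_of_mul_eq (H := unitSubgroup F) isOpen_unitSet fun g k hk => by
    rw [map_mul, hχ k hk, mul_one]

theorem continuous_blockDiag_self : Continuous fun k : GL (Fin n) F => blockDiag k k := by
  refine continuous_GL_of_val ?_
  exact Continuous.matrix_fromBlocks Units.continuous_val continuous_const continuous_const
    Units.continuous_val

theorem continuous_unip : Continuous (unip : Matrix (Fin n) (Fin n) F → _) := by
  refine continuous_GL_of_val ?_
  exact Continuous.matrix_fromBlocks continuous_const continuous_id continuous_const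
    continuous_const

/-- The integrand is continuous. For `k` in `GL_n(𝒪)` it is bounded and supported on `X` in a box
that depends only on `h`, so a constant on a set of finite measure dominates it. -/
theorem integrable_shalikaIntegrand (hϖ : IsUniformizer ϖ) (he : IsSmoothChar ϖ δ e)
    {F₀ : GL (Fin n ⊕ Fin n) F → ℂ} (hF : IsNormalisedVector ϖ δ θ F₀)
    (hη : IsUnramified η) (β : ℕ) (h : GL (Fin n) F) :
    Integrable (Function.uncurry
      (shalikaIntegrand e η F₀ (blockDiag h 1 * ((uMat F n)⁻¹ * tMat n ϖ ^ β))))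
      ((dk.restrict (maxCompact F n)).prod dX) := by
  have h0 := norm_units_pos ϖ
  have hcont : Continuous (Function.uncurry
      (shalikaIntegrand e η F₀ (blockDiag h 1 * ((uMat F n)⁻¹ * tMat n ϖ ^ β)))) := by
    refine Continuous.mul (Continuous.mul ((hF.continuous hϖ).comp ?_) (he.continuous.comp ?_)) ?_
    · exact ((continuous_const.mul (continuous_unip.comp continuous_snd)).mul
        (continuous_blockDiag_self.comp continuous_fst)).mul continuous_const
    · exact (Continuous.matrix_trace continuous_snd).neg
    · exact Units.continuous_val.comp
        ((hη.continuous.comp (continuous_GL_det.comp continuous_fst)).inv)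
  set c := Matrix.GeneralLinearGroup.scalar (Fin n) (ϖ ^ β) with hc
  obtain ⟨B, hB⟩ := isCompact_intGL.exists_bound_of_continuousOn
    (f := fun k : GL (Fin n) F => leviValue F₀ (k * h * c))
    ((continuous_leviValue hF).comp (by fun_prop)).continuousOn
  obtain ⟨H, hH0, hH⟩ : ∃ H : ℝ, 0 ≤ H ∧ ∀ i j, ‖h.val i j‖ ≤ H := by
    refine ⟨∑ i, ∑ j, ‖h.val i j‖, by positivity, fun i j => ?_⟩
    exact (Finset.single_le_sum (f := fun j => ‖h.val i j‖) (fun _ _ => norm_nonneg _)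
      (Finset.mem_univ j)).trans (Finset.single_le_sum (f := fun i => ∑ j, ‖h.val i j‖)
        (fun _ _ => Finset.sum_nonneg fun _ _ => norm_nonneg _) (Finset.mem_univ i))
  let S : Set (Matrix (Fin n) (Fin n) F) := {X | ∀ i j, ‖X i j‖ ≤ H}
  have hS : IsCompact S := isCompact_integral_matrices (Fin n) H
  have hKfin : IsFiniteMeasure (dk.restrict (maxCompact F n)) :=
    ⟨by rw [Measure.restrict_apply_univ, maxCompact_eq]; exact isCompact_intGL.measure_lt_top⟩
  have hdom : Integrable ((Set.univ ×ˢ S).indicator fun _ => B)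
      ((dk.restrict (maxCompact F n)).prod dX) := by
    rw [integrable_indicator_iff (MeasurableSet.univ.prod hS.measurableSet)]
    refine integrableOn_const ?_
    rw [Measure.prod_prod]
    exact ENNReal.mul_ne_top (measure_ne_top _ _) hS.measure_ne_top
  refine hdom.mono' hcont.aestronglyMeasurable ?_
  have hae : ∀ᵐ x ∂((dk.restrict (maxCompact F n)).prod dX), x.1 ∈ maxCompact F n := by
    have h1 : ∀ᵐ k ∂(dk.restrict (maxCompact F n)), k ∈ maxCompact F n :=
      ae_restrict_mem isOpen_intGL.measurableSet
    exact Measure.quasiMeasurePreserving_fst.ae h1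
  filter_upwards [hae] with x hx
  obtain ⟨k, X⟩ := x
  have hk : k ∈ intGL F (Fin n) := hx
  have hK := mem_intGL_iff.1 hk
  classical
  rw [Function.uncurry_apply_pair, shalikaIntegrand_eq hF hη β h hk]
  split_ifs with hX
  · have hXS : X ∈ S := by
      set A := k.val * h.val * antidiag F n * (k⁻¹).val with hA
      have hXA : X = A + (k * h * c).val * (((k * h * c)⁻¹).val * (X - A)) := by
        rw [← mul_assoc, Units.mul_inv, one_mul, add_sub_cancel]
      have h1 : ∀ i j, ‖(k.val * h.val) i j‖ ≤ H := fun i j => by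
        simpa using norm_mul_apply_le zero_le_one hH0 hK.1 hH i j
      have h2 : ∀ i j, ‖(k * h * c).val i j‖ ≤ H := fun i j => by
        have hcK : ∀ i j, ‖c.val i j‖ ≤ 1 := fun i j => by
          rw [hc, scalar_val, Matrix.scalar_apply, Matrix.diagonal_apply]
          split_ifs
          · rw [Units.val_pow_eq_pow_val, norm_pow]
            exact pow_le_one₀ h0.le hϖ.norm_lt_one.le
          · simp
        simpa using norm_mul_apply_le hH0 zero_le_one h1 hcK i j
      intro i j
      rw [hXA, Matrix.add_apply]
      refine (IsUltrametricDist.norm_add_le_max _ _).trans (max_le ?_ ?_)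
      · have h3 : ∀ i j, ‖(k.val * h.val * antidiag F n) i j‖ ≤ H := fun i j => by
          simpa using norm_mul_apply_le hH0 zero_le_one h1 antidiag_norm_le i j
        simpa only [mul_one] using norm_mul_apply_le hH0 zero_le_one h3 hK.2 i j
      · simpa only [mul_one] using norm_mul_apply_le hH0 zero_le_one h2 hX i j
    rw [Set.indicator_of_mem (show (k, X) ∈ Set.univ ×ˢ S from ⟨trivial, hXS⟩), norm_mul, he.norm_eq_one,
      mul_one]
    exact hB k hk
  · rw [norm_zero]
    exact Set.indicator_nonneg (fun _ _ => (norm_nonneg _).trans (hB k hk)) _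

end ShalikaValue

end ParahoricZeta

namespace ParahoricZeta

/-! ### Unfolding the average over the maximal compact subgroup -/

section Unfolding

variable {F : Type*} [NontriviallyNormedField F] [IsUltrametricDist F] {n : ℕ} {ϖ : Fˣ} {δ : ℕ}
  {e : F → ℂ} [ProperSpace F]
  [MeasurableSpace F] [BorelSpace F]
  [MeasurableSpace (Matrix (Fin n) (Fin n) F)] [BorelSpace (Matrix (Fin n) (Fin n) F)]
  (dk : Measure (GL (Fin n) F)) [dk.IsHaarMeasure]
  (dh : Measure (GL (Fin n) F)) [dh.IsHaarMeasure]

theorem isOpen_higherUnits (ϖ : Fˣ) (b : ℕ) : IsOpen (higherUnits ϖ b) := by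
  have h1 : IsOpen {x : F | ‖x‖ ≤ ‖(ϖ : F)‖ ^ b} := isOpen_norm_le (pow_pos (norm_units_pos ϖ) b)
  exact isOpen_unitSet.inter (h1.preimage (Units.continuous_val.sub continuous_const))

theorem continuous_of_higherUnits {χ : Fˣ →* ℂˣ} {b : ℕ} (h : ∀ c ∈ higherUnits ϖ b, χ c = 1) :
    Continuous χ := by
  refine continuous_of_continuousAt_one χ ?_
  have h1 : (1 : Fˣ) ∈ higherUnits ϖ b :=
    ⟨by simp [unitSet], by simp⟩
  have : χ =ᶠ[nhds 1] fun _ => 1 := by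
    filter_upwards [(isOpen_higherUnits ϖ b).mem_nhds h1] with c hc using h c hc
  exact (continuousAt_congr this).2 continuousAt_const

/-- The integral over `GL_n(𝒪)` of `χ (det k) e (tr (k h))`. -/
noncomputable def gaussKernel (χ : Fˣ →* ℂˣ) (e : F → ℂ) (h : GL (Fin n) F) : ℂ :=
  ∫ k in (intGL F (Fin n) : Set (GL (Fin n) F)),
    (χ (Matrix.GeneralLinearGroup.det k) : ℂ) * e (k.val * h.val).trace ∂dk

theorem setIntegral_intGL_mul_left {a : GL (Fin n) F} (ha : a ∈ intGL F (Fin n))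
    (f : GL (Fin n) F → ℂ) :
    ∫ k in (intGL F (Fin n) : Set (GL (Fin n) F)), f (a * k) ∂dk =
      ∫ k in (intGL F (Fin n) : Set (GL (Fin n) F)), f k ∂dk :=
  (measurePreserving_mul_left_restrict dk isOpen_intGL.measurableSet ha).integral_comp
    (measurableEmbedding_mulLeft a) f

theorem intGL_measure_ne_zero : dk (intGL F (Fin n) : Set (GL (Fin n) F)) ≠ 0 :=
  (isOpen_intGL.measure_pos dk ⟨1, one_mem _⟩).ne'

theorem setIntegral_intGL_inv (f : GL (Fin n) F → ℂ) :
    ∫ k in (intGL F (Fin n) : Set (GL (Fin n) F)), f k⁻¹ ∂dk =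
      ∫ k in (intGL F (Fin n) : Set (GL (Fin n) F)), f k ∂dk := by
  conv_rhs => rw [← map_inv_restrict dk isOpen_intGL.measurableSet (intGL_measure_ne_zero dk)
    isCompact_intGL.measure_ne_top]
  exact ((MeasurableEquiv.inv (GL (Fin n) F)).measurableEmbedding.integral_map _).symm

/-- Cyclicity of the trace moves `κ` to the left of `k`, where the translation `k ↦ κ k` absorbs it.
The resulting right invariance is what makes Iwasawa coordinates applicable to the kernel. -/
theorem gaussKernel_mul (χ : Fˣ →* ℂˣ) (e : F → ℂ) (h : GL (Fin n) F) {κ : GL (Fin n) F}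
    (hκ : κ ∈ intGL F (Fin n)) :
    (χ (Matrix.GeneralLinearGroup.det (h * κ)) : ℂ) * gaussKernel dk χ e (h * κ) =
      (χ (Matrix.GeneralLinearGroup.det h) : ℂ) * gaussKernel dk χ e h := by
  have h1 := setIntegral_intGL_mul_left dk hκ fun k =>
    (χ (Matrix.GeneralLinearGroup.det k) : ℂ) * e (k.val * h.val).trace
  rw [gaussKernel, gaussKernel, ← h1, ← integral_const_mul, ← integral_const_mul]
  congr 1
  ext k
  have e1 : (k.val * (h * κ).val).trace = ((κ * k).val * h.val).trace := by
    rw [Units.val_mul, Units.val_mul, ← mul_assoc, Matrix.trace_mul_comm, mul_assoc]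
  rw [e1]
  simp only [map_mul, Units.val_mul]
  ring

theorem neg_wLong_mem : -wLong F n ∈ intGL F (Fin n) := by
  refine mem_intGL_iff.2 ⟨fun i j => ?_, fun i j => ?_⟩
  · rw [Units.val_neg, Matrix.neg_apply, norm_neg]
    exact antidiag_norm_le i j
  · rw [inv_neg, Units.val_neg, Matrix.neg_apply, norm_neg]
    exact antidiag_norm_le i j

theorem neg_wLong_mul_self : -wLong F n * -wLong F n = 1 := by
  rw [neg_mul_neg]
  exact Units.ext antidiag_mul_antidiag

/-- Inversion turns `k⁻¹` into `k`, and the translation `k ↦ -w_n k` then removes both the sign and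
`w_n` from the trace. This is the origin of the factor `χ(det(-w_n))`. -/
theorem setIntegral_eq_gaussKernel (χ : Fˣ →* ℂˣ) (e : F → ℂ) (h : GL (Fin n) F) :
    ∫ k in (intGL F (Fin n) : Set (GL (Fin n) F)),
      (χ (Matrix.GeneralLinearGroup.det k⁻¹) : ℂ) *
        e (-((k⁻¹).val * h.val * antidiag F n).trace) ∂dk =
      (χ (Matrix.GeneralLinearGroup.det (-wLong F n)) : ℂ) * gaussKernel dk χ e h := by
  rw [setIntegral_intGL_inv dk fun k => (χ (Matrix.GeneralLinearGroup.det k) : ℂ) *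
        e (-(k.val * h.val * antidiag F n).trace), ← setIntegral_intGL_mul_left dk neg_wLong_mem,
    gaussKernel, ← integral_const_mul]
  congr 1
  ext k
  have e1 : -((-wLong F n * k).val * h.val * antidiag F n).trace = (k.val * h.val).trace := by
    have : ((-wLong F n * k).val * h.val * antidiag F n).trace =
        ((-wLong F n * -wLong F n * k).val * h.val).trace * (-1) := by
      rw [Matrix.trace_mul_comm, ← mul_assoc]
      simp only [Units.val_mul, Units.val_neg, neg_mul, mul_neg, Matrix.trace_neg,
        mul_one, neg_neg]
      simp only [← mul_assoc]
      rfl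
    rw [this, neg_wLong_mul_self, one_mul, mul_neg_one, neg_neg]
  rw [e1, map_mul, map_mul, Units.val_mul]
  ring

/-- The substitution `h ↦ k⁻¹ h` under Fubini frees `Φ` from `k` and leaves `k` only in the
characters. These have absolute value `1`, so integrability of the unaveraged integrand suffices. -/
theorem unfold_zeta {χ : Fˣ →* ℂˣ} (hχ : Continuous χ) (hχ1 : ∀ x, ‖(χ x : ℂ)‖ = 1)
    (he : IsSmoothChar ϖ δ e) {a Φ : GL (Fin n) F → ℂ}
    (ha : ∀ k ∈ intGL F (Fin n), ∀ h, a (k * h) = a h)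
    (hint : Integrable (fun h => a h * (χ (Matrix.GeneralLinearGroup.det h) : ℂ) * Φ h) dh) :
    Integrable (fun h => a h * e (-(h.val * antidiag F n).trace) *
        (χ (Matrix.GeneralLinearGroup.det h) : ℂ) *
        ∫ k in (intGL F (Fin n) : Set (GL (Fin n) F)), Φ (k * h) ∂dk) dh ∧
      ∫ h, a h * e (-(h.val * antidiag F n).trace) *
        (χ (Matrix.GeneralLinearGroup.det h) : ℂ) *
        (∫ k in (intGL F (Fin n) : Set (GL (Fin n) F)), Φ (k * h) ∂dk) ∂dh =
      (χ (Matrix.GeneralLinearGroup.det (-wLong F n)) : ℂ) *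
        ∫ h, a h * (χ (Matrix.GeneralLinearGroup.det h) : ℂ) * Φ h * gaussKernel dk χ e h ∂dh := by
  set K : Set (GL (Fin n) F) := (intGL F (Fin n) : Set (GL (Fin n) F)) with hKdef
  have hKm : MeasurableSet K := isOpen_intGL.measurableSet
  have hfin : IsFiniteMeasure (dk.restrict K) :=
    ⟨by rw [Measure.restrict_apply_univ]; exact isCompact_intGL.measure_lt_top⟩
  let c : GL (Fin n) F × GL (Fin n) F → ℂ := fun x =>
    (χ (Matrix.GeneralLinearGroup.det x.1⁻¹) : ℂ) *
      e (-((x.1⁻¹).val * x.2.val * antidiag F n).trace)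
  have hc : Continuous c := by
    refine (Units.continuous_val.comp (hχ.comp (continuous_GL_det.comp continuous_fst.inv))).mul
      (he.continuous.comp (Continuous.neg (Continuous.matrix_trace ?_)))
    exact ((Units.continuous_val.comp continuous_fst.inv).matrix_mul
      (Units.continuous_val.comp continuous_snd)).matrix_mul continuous_const
  have hc1 : ∀ x, ‖c x‖ ≤ 1 := fun x => by
    rw [norm_mul, hχ1, he.norm_eq_one, one_mul]
  let P : GL (Fin n) F × GL (Fin n) F → ℂ := fun x =>
    (a x.2 * (χ (Matrix.GeneralLinearGroup.det x.2) : ℂ) * Φ x.2) * c x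
  have hP : Integrable P ((dk.restrict K).prod dh) :=
    (hint.comp_snd (dk.restrict K)).mul_bdd hc.aestronglyMeasurable (Filter.Eventually.of_forall hc1)
  -- The shear `(k, h) ↦ (k, k h)` preserves the product measure and carries `P` to `Q`, which
  -- transfers integrability.
  have hmp := measurePreserving_prod_mul (dk.restrict K) dh
  let Q : GL (Fin n) F × GL (Fin n) F → ℂ := fun x =>
    (a x.2 * e (-(x.2.val * antidiag F n).trace) *
        (χ (Matrix.GeneralLinearGroup.det x.2) : ℂ)) * Φ (x.1 * x.2)
  have hPQ : ∀ x : GL (Fin n) F × GL (Fin n) F, x.1 ∈ K → P (x.1, x.1 * x.2) = Q x := by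
    rintro ⟨k, h⟩ hk
    change a (k * h) * (χ (Matrix.GeneralLinearGroup.det (k * h)) : ℂ) * Φ (k * h) *
      ((χ (Matrix.GeneralLinearGroup.det k⁻¹) : ℂ) *
      e (-((k⁻¹).val * (k * h).val * antidiag F n).trace)) = _
    have e1 : (k⁻¹).val * (k * h).val = h.val := by rw [← Units.val_mul, inv_mul_cancel_left]
    have e2 : (χ (Matrix.GeneralLinearGroup.det (k * h)) : ℂ) *
        (χ (Matrix.GeneralLinearGroup.det k⁻¹) : ℂ) = χ (Matrix.GeneralLinearGroup.det h) := by
      rw [← Units.val_mul, map_mul, map_mul, map_inv, map_inv, mul_inv_cancel_comm]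
    rw [e1, ha k hk]
    simp only [Q]
    linear_combination (a h * Φ (k * h) * e (-(h.val * antidiag F n).trace)) * e2
  have hQ : Integrable Q ((dk.restrict K).prod dh) := by
    refine (hmp.integrable_comp_of_integrable hP).congr ?_
    have hae : ∀ᵐ x ∂((dk.restrict K).prod dh), x.1 ∈ K :=
      Measure.quasiMeasurePreserving_fst.ae (ae_restrict_mem hKm)
    filter_upwards [hae] with x hx using hPQ x hx
  constructor
  · have := hQ.integral_prod_right
    refine this.congr (Filter.Eventually.of_forall fun h => ?_)
    simp only [Q]
    rw [integral_const_mul]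
  · have e1 : ∀ h, a h * e (-(h.val * antidiag F n).trace) *
        (χ (Matrix.GeneralLinearGroup.det h) : ℂ) * (∫ k in K, Φ (k * h) ∂dk) =
        ∫ k in K, Q (k, h) ∂dk := fun h => by
      simp only [Q]; rw [integral_const_mul]
    have e2 : ∀ h, (χ (Matrix.GeneralLinearGroup.det (-wLong F n)) : ℂ) *
        (a h * (χ (Matrix.GeneralLinearGroup.det h) : ℂ) * Φ h * gaussKernel dk χ e h) =
        ∫ k in K, P (k, h) ∂dk := fun h => by
      simp only [P, c]
      rw [integral_const_mul, setIntegral_eq_gaussKernel]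
      ring
    rw [← integral_const_mul]
    simp_rw [e1, e2]
    rw [integral_integral_swap (f := fun h k => Q (k, h)) hQ.swap,
      integral_integral_swap (f := fun h k => P (k, h)) hP.swap]
    refine setIntegral_congr_fun hKm fun k hk => ?_
    change ∫ h, Q (k, h) ∂dh = ∫ h, P (k, h) ∂dh
    rw [← integral_mul_left_eq_self (fun h => P (k, h)) k]
    exact integral_congr_ae (Filter.Eventually.of_forall fun h => (hPQ (k, h) hk).symm)

end Unfolding

end ParahoricZeta

namespace ParahoricZeta

/-! ### Splitting the Gauss kernel into one-dimensional kernels -/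

section TateKernel

variable {F : Type*} [NontriviallyNormedField F] [IsUltrametricDist F] {ϖ : Fˣ} {δ : ℕ}
  {e : F → ℂ} [ProperSpace F] [MeasurableSpace F] [BorelSpace F]
  (dc : Measure Fˣ) [dc.IsHaarMeasure]

open Classical in
/-- The extension by zero of a quasicharacter. -/
noncomputable def extChar (χ : Fˣ →* ℂˣ) (x : F) : ℂ :=
  if h : x ≠ 0 then (χ (Units.mk0 x h) : ℂ) else 0

theorem extChar_coe (χ : Fˣ →* ℂˣ) (c : Fˣ) : extChar χ (c : F) = χ c := by
  rw [extChar, dif_pos c.ne_zero]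
  congr 2
  exact Units.ext rfl

theorem setIntegral_units_mul_left {a : Fˣ} (ha : a ∈ unitSet F) (f : Fˣ → ℂ) :
    ∫ c in unitSet F, f (a * c) ∂dc = ∫ c in unitSet F, f c ∂dc :=
  (measurePreserving_mul_left_restrict dc (K := unitSubgroup F) isOpen_unitSet.measurableSet
    ha).integral_comp (measurableEmbedding_mulLeft a) f

/-- The integral over `𝒪ˣ` of `χ(c) e(c t)`. -/
noncomputable def tateKernel (χ : Fˣ →* ℂˣ) (e : F → ℂ) (t : F) : ℂ :=
  ∫ c in unitSet F, (χ c : ℂ) * e (c * t) ∂dc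

theorem setIntegral_extChar (χ : Fˣ →* ℂˣ) (e : F → ℂ) {x : F} (hx : ‖x‖ = 1) (t : F) :
    ∫ c in unitSet F, (χ c : ℂ) * extChar χ x * e (c * x * t) ∂dc = tateKernel dc χ e t := by
  have h0 : x ≠ 0 := norm_ne_zero_iff.1 (hx ▸ one_ne_zero)
  obtain ⟨u, rfl⟩ : ∃ u : Fˣ, (u : F) = x := ⟨Units.mk0 x h0, rfl⟩
  refine Eq.trans ?_ (setIntegral_units_mul_left dc (a := u) hx _)
  congr 1
  ext c
  rw [extChar_coe, map_mul, Units.val_mul, Units.val_mul, mul_comm (u : F), mul_comm (χ u : ℂ)]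

end TateKernel

section BoxIntegral

variable {F : Type*} [NontriviallyNormedField F] [IsUltrametricDist F] {n : ℕ} {ϖ : Fˣ} {δ β : ℕ}
  {e : F → ℂ} [ProperSpace F]
  [MeasurableSpace F] [BorelSpace F]
  [MeasurableSpace (Matrix (Fin n) (Fin n) F)] [BorelSpace (Matrix (Fin n) (Fin n) F)]
  (dk : Measure (GL (Fin n) F)) [dk.IsHaarMeasure] (dc : Measure Fˣ) [dc.IsHaarMeasure]
  (μ : Measure F) [μ.IsAddHaarMeasure]

/-- The vectors all of whose coordinates have norm at most `r`. -/
def normBox (F : Type*) [NontriviallyNormedField F] [IsUltrametricDist F] (ι : Type*) {r : ℝ}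
    (hr : 0 ≤ r) : AddSubgroup (ι → F) where
  carrier := {y | ∀ p, ‖y p‖ ≤ r}
  zero_mem' := by simp [hr]
  add_mem' := fun ha hb p => (IsUltrametricDist.norm_add_le_max _ _).trans (max_le (ha p) (hb p))
  neg_mem' := fun ha p => by simpa using ha p

theorem normBox_eq_pi (ι : Type*) {r : ℝ} (hr : 0 ≤ r) :
    (normBox F ι hr : Set (ι → F)) = Set.pi Set.univ fun _ => {x | ‖x‖ ≤ r} := by
  ext y
  simp [normBox]

theorem measurableSet_normBox (ι : Type*) [Countable ι] {r : ℝ} (hr : 0 ≤ r) :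
    MeasurableSet (normBox F ι hr : Set (ι → F)) := by
  rw [normBox_eq_pi]
  exact MeasurableSet.univ_pi fun _ => (isCompact_norm_le r).isClosed.measurableSet

theorem isCompact_normBox (ι : Type*) {r : ℝ} (hr : 0 ≤ r) :
    IsCompact (normBox F ι hr : Set (ι → F)) := by
  rw [normBox_eq_pi]
  exact isCompact_univ_pi fun _ => isCompact_norm_le r

theorem measure_normBox (hϖ : IsUniformizer ϖ) (hμ : μ {x | ‖x‖ ≤ 1} = 1) (ι : Type*) [Fintype ι]
    (m : ℕ) (hr : 0 ≤ ‖(ϖ : F)‖ ^ (-(m : ℤ))) :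
    (Measure.pi fun _ : ι => μ).real (normBox F ι hr) =
      (resCard F : ℝ) ^ (m * Fintype.card ι) := by
  rw [Measure.real, normBox_eq_pi, Measure.pi_pi, Finset.prod_const, Finset.card_univ,
    measure_norm_le_zpow hϖ μ hμ, neg_neg, zpow_natCast, ← pow_mul]
  simp

open Classical in
-- Orthogonality again: the box has radius `|ϖ|^(-β-δ)` and `e` is trivial exactly up to `ϖ^(-δ)`,
-- so the character is trivial on the box if and only if all coefficients lie in `𝔭^β`.
theorem setIntegral_normBox (he : IsSmoothChar ϖ δ e) {ι : Type*} [Fintype ι] (β : ℕ)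
    (hr : 0 ≤ ‖(ϖ : F)‖ ^ (-((β + δ : ℕ) : ℤ))) (a : ι → F) :
    ∫ y in (normBox F ι hr : Set (ι → F)), e (∑ p, a p * y p) ∂(Measure.pi fun _ => μ) =
      if ∀ p, ‖a p‖ ≤ ‖(ϖ : F)‖ ^ β then
        ((Measure.pi fun _ : ι => μ).real (normBox F ι hr) : ℂ) else 0 := by
  have h0 := norm_units_pos ϖ
  rw [setIntegral_char _ (normBox F ι hr) (measurableSet_normBox ι hr)
    (e := fun y => e (∑ p, a p * y p)) (fun x y => by
      rw [← he.map_add, ← Finset.sum_add_distrib]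
      simp_rw [Pi.add_apply, mul_add])]
  refine if_congr ?_ rfl rfl
  have hz : ‖(ϖ : F)‖ ^ (-(δ : ℤ)) = ‖(ϖ : F)‖ ^ β * ‖(ϖ : F)‖ ^ (-((β + δ : ℕ) : ℤ)) := by
    rw [← zpow_natCast, ← zpow_add₀ h0.ne']
    congr 1
    push_cast
    ring
  constructor
  · intro h p
    have h1 : ‖a p * ((ϖ ^ (-((β + δ : ℕ) : ℤ)) : Fˣ) : F)‖ ≤ ‖(ϖ : F)‖ ^ (-(δ : ℤ)) := by
      refine (he.dual _).1 fun y hy => ?_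
      have := h (Pi.single p (((ϖ ^ (-((β + δ : ℕ) : ℤ)) : Fˣ) : F) * y)) fun p' => by
        by_cases hp : p' = p
        · subst hp
          rw [Pi.single_eq_same, norm_mul, Units.val_zpow_eq_zpow_val, norm_zpow]
          exact mul_le_of_le_one_right hr hy
        · rw [Pi.single_eq_of_ne hp, norm_zero]; exact hr
      rwa [Finset.sum_eq_single p (fun b _ hb => by rw [Pi.single_eq_of_ne hb, mul_zero])
        (fun hp => (hp (Finset.mem_univ p)).elim), Pi.single_eq_same, ← mul_assoc] at this
    rw [norm_mul, Units.val_zpow_eq_zpow_val, norm_zpow, hz] at h1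
    exact le_of_mul_le_mul_right h1 (zpow_pos h0 _)
  · intro h y hy
    refine he.eq_one (IsUltrametricDist.norm_sum_le_of_forall_le_of_nonneg (zpow_pos h0 _).le
      fun p _ => ?_)
    rw [norm_mul, hz]
    exact mul_le_mul (h p) (hy p) (norm_nonneg _) (pow_nonneg h0.le _)

theorem trace_mul_upMat (A : Matrix (Fin n) (Fin n) F) (t : Fin n → Fˣ) (y : StrictPair n → F) :
    (A * upMat t y).trace = ∑ i, A i i * t i + ∑ p : StrictPair n, A p.1.2 p.1.1 * y p := by
  rw [upMat_eq_add, mul_add, Matrix.trace_add]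
  congr 1
  · simp [Matrix.trace, Matrix.mul_diagonal]
  · let f : Fin n × Fin n → F := fun q => A q.2 q.1 * extMat (P := fun p => p.1 < p.2) y q.1 q.2
    have h1 : ∑ p : StrictPair n, A p.1.2 p.1.1 * y p = ∑ p : StrictPair n, f p.1 :=
      Finset.sum_congr rfl fun p _ => by simp only [f]; rw [extMat_apply]
    rw [h1, ← Finset.sum_subtype (Finset.univ.filter fun q : Fin n × Fin n => q.1 < q.2)
      (by simp) f, Finset.sum_filter_of_ne fun q _ hq => ?_, Fintype.sum_prod_type_right]
    · simp only [Matrix.trace, Matrix.diag_apply, Matrix.mul_apply, f]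
    · by_contra h
      exact hq (by simp only [f]; rw [extMat_of_not y h, mul_zero])

/-- Averaging over the box turns the kernel into an integral over a congruence subgroup. -/
theorem setIntegral_gaussKernel {χ : Fˣ →* ℂˣ} (hχ : Continuous χ) (hχ1 : ∀ x, ‖(χ x : ℂ)‖ = 1)
    (he : IsSmoothChar ϖ δ e) (hr : 0 ≤ ‖(ϖ : F)‖ ^ (-((β + δ : ℕ) : ℤ))) (t : Fin n → Fˣ) :
    ∫ y in (normBox F (StrictPair n) hr : Set (StrictPair n → F)),
        gaussKernel dk χ e (upGL t y) ∂(Measure.pi fun _ => μ) =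
      ((Measure.pi fun _ : StrictPair n => μ).real (normBox F (StrictPair n) hr) : ℂ) *
        ∫ k in iwahoriLevel F n (‖(ϖ : F)‖ ^ β),
          (χ (Matrix.GeneralLinearGroup.det k) : ℂ) * e (∑ i, k.val i i * t i) ∂dk := by
  classical
  set B : Set (StrictPair n → F) := (normBox F (StrictPair n) hr : Set (StrictPair n → F))
  set K : Set (GL (Fin n) F) := (intGL F (Fin n) : Set (GL (Fin n) F)) with hKdef
  have hK1 : IsFiniteMeasure (dk.restrict K) :=
    ⟨by rw [Measure.restrict_apply_univ]; exact isCompact_intGL.measure_lt_top⟩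
  have hB1 : IsFiniteMeasure ((Measure.pi fun _ : StrictPair n => μ).restrict B) :=
    ⟨by rw [Measure.restrict_apply_univ]; exact (isCompact_normBox _ hr).measure_lt_top⟩
  simp only [gaussKernel]
  have hcont : Continuous fun x : (StrictPair n → F) × GL (Fin n) F =>
      (χ (Matrix.GeneralLinearGroup.det x.2) : ℂ) * e (x.2.val * (upGL t x.1).val).trace := by
    refine (Units.continuous_val.comp (hχ.comp (continuous_GL_det.comp continuous_snd))).mul
      (he.continuous.comp (Continuous.matrix_trace ?_))
    refine (Units.continuous_val.comp continuous_snd).matrix_mul ?_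
    exact continuous_upMat.comp (continuous_const.prodMk continuous_fst)
  rw [integral_integral_swap]
  swap
  · refine Integrable.of_bound hcont.aestronglyMeasurable 1 (Filter.Eventually.of_forall fun x => ?_)
    simp only [Function.uncurry, norm_mul, hχ1, he.norm_eq_one, mul_one, le_refl]
  have hlev : MeasurableSet (iwahoriLevel F n (‖(ϖ : F)‖ ^ β)) := by
    have : iwahoriLevel F n (‖(ϖ : F)‖ ^ β) = K ∩ ⋂ i, ⋂ j, ⋂ (_ : j < i),
        {g : GL (Fin n) F | ‖g.val i j‖ ≤ ‖(ϖ : F)‖ ^ β} := by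
      ext g; simp [iwahoriLevel, hKdef]
    rw [this]
    refine isOpen_intGL.measurableSet.inter (MeasurableSet.iInter fun i => MeasurableSet.iInter
      fun j => MeasurableSet.iInter fun _ => ?_)
    exact (isClosed_le (continuous_GL_apply i j).norm continuous_const).measurableSet
  have hsub : iwahoriLevel F n (‖(ϖ : F)‖ ^ β) ⊆ K := fun g hg => hg.1
  rw [← integral_const_mul, ← Set.inter_eq_right.2 hsub, ← setIntegral_indicator hlev]
  refine setIntegral_congr_fun isOpen_intGL.measurableSet fun k hk => ?_
  -- In the trace the variables `y` above the diagonal pair with the entries of `k` below it, so the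
  -- integral over `y` detects that these lie in `𝔭^β`.
  have h1 : ∀ y, (χ (Matrix.GeneralLinearGroup.det k) : ℂ) * e (k.val * (upGL t y).val).trace =
      ((χ (Matrix.GeneralLinearGroup.det k) : ℂ) * e (∑ i, k.val i i * t i)) *
        e (∑ p : StrictPair n, k.val p.1.2 p.1.1 * y p) := fun y => by
    rw [upGL_val, trace_mul_upMat, he.map_add, mul_assoc]
  simp only [h1]
  rw [integral_const_mul, setIntegral_normBox μ he]
  have h2 : (∀ p : StrictPair n, ‖k.val p.1.2 p.1.1‖ ≤ ‖(ϖ : F)‖ ^ β) ↔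
      k ∈ iwahoriLevel F n (‖(ϖ : F)‖ ^ β) :=
    ⟨fun h => ⟨hk, fun i j hij => h ⟨(j, i), hij⟩⟩, fun h p => h.2 _ _ p.2⟩
  rw [if_congr h2 rfl rfl, Set.indicator_apply]
  split_ifs
  · rw [mul_comm]
  · rw [mul_zero]

/-- The determinant agrees with the product of the diagonal entries up to a factor in `1 + 𝔭^β`, on
which `χ` is trivial. -/
theorem map_det_of_mem_iwahoriLevel {χ : Fˣ →* ℂˣ} (hϖ : IsUniformizer ϖ)
    (hχ : ∀ c ∈ higherUnits ϖ β, χ c = 1)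
    (hβ : 1 ≤ β) {k : GL (Fin n) F} (hk : k ∈ iwahoriLevel F n (‖(ϖ : F)‖ ^ β)) :
    (χ (Matrix.GeneralLinearGroup.det k) : ℂ) = ∏ i, extChar χ (k.val i i) := by
  have h0 := norm_units_pos ϖ
  have hlt : ‖(ϖ : F)‖ ^ β < 1 := pow_lt_one₀ h0.le hϖ.norm_lt_one (by omega)
  have hd := norm_diag_of_mem_iwahoriLevel (pow_nonneg h0.le β) hlt hk
  have hne : ∀ i, k.val i i ≠ 0 := fun i => norm_ne_zero_iff.1 (by rw [hd i]; exact one_ne_zero)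
  let u : Fin n → Fˣ := fun i => Units.mk0 _ (hne i)
  have hu : ∀ i, (u i : F) = k.val i i := fun i => rfl
  have hun : ‖((∏ i, u i : Fˣ) : F)‖ = 1 := by
    rw [Units.coe_prod, norm_prod]
    exact Finset.prod_eq_one fun i _ => hd i
  have h1 : Matrix.GeneralLinearGroup.det k * (∏ i, u i)⁻¹ ∈ higherUnits ϖ β := by
    constructor
    · change ‖((Matrix.GeneralLinearGroup.det k * (∏ i, u i)⁻¹ : Fˣ) : F)‖ = 1
      rw [Units.val_mul, norm_mul, Units.val_inv_eq_inv_val, norm_inv, hun, inv_one, mul_one]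
      exact norm_det_of_mem_intGL hk.1
    · have e1 : ((Matrix.GeneralLinearGroup.det k * (∏ i, u i)⁻¹ : Fˣ) : F) - 1 =
          (k.val.det - ∏ i, k.val i i) * (((∏ i, u i)⁻¹ : Fˣ) : F) := by
        rw [sub_mul, Units.val_mul]
        congr 1
        have : ∏ i, k.val i i = ((∏ i, u i : Fˣ) : F) := by
          rw [Units.coe_prod]; rfl
        rw [this, ← Units.val_mul, mul_inv_cancel, Units.val_one]
      rw [e1, norm_mul, Units.val_inv_eq_inv_val, norm_inv, hun, inv_one, mul_one]
      exact norm_det_sub_prod_diag_le (pow_nonneg h0.le _) (mem_intGL_iff.1 hk.1).1 hk.2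
  have h2 := hχ _ h1
  rw [map_mul, map_inv, mul_inv_eq_one] at h2
  rw [h2, map_prod, Units.coe_prod]
  exact Finset.prod_congr rfl fun i _ => by rw [← hu, extChar_coe]

/-- Left translation by a diagonal matrix of units `c` preserves the level and Haar measure, so the
integrand may be averaged over `c`. For fixed `k` the average factors over the diagonal, and each
unit `k i i` is absorbed by a translation of `c i`. The result does not depend on `k`, and
integrating over `k` only contributes the volume. -/
theorem setIntegral_iwahoriLevel {χ : Fˣ →* ℂˣ} (hϖ : IsUniformizer ϖ)
    (hχ : ∀ c ∈ higherUnits ϖ β, χ c = 1) (hχ1 : ∀ x, ‖(χ x : ℂ)‖ = 1)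
    (hβ : 1 ≤ β) (he : IsSmoothChar ϖ δ e) (hdc : dc (unitSet F) = 1) (t : Fin n → Fˣ) :
    ∫ k in iwahoriLevel F n (‖(ϖ : F)‖ ^ β),
        (χ (Matrix.GeneralLinearGroup.det k) : ℂ) * e (∑ i, k.val i i * t i) ∂dk =
      (dk.real (iwahoriLevel F n (‖(ϖ : F)‖ ^ β)) : ℂ) * ∏ i, tateKernel dc χ e (t i) := by
  have h0 := norm_units_pos ϖ
  have hlt : ‖(ϖ : F)‖ ^ β < 1 := pow_lt_one₀ h0.le hϖ.norm_lt_one (by omega)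
  have hχc : Continuous χ := continuous_of_higherUnits hχ
  set S := iwahoriLevel F n (‖(ϖ : F)‖ ^ β) with hSdef
  let φ : GL (Fin n) F → ℂ := fun k =>
    (χ (Matrix.GeneralLinearGroup.det k) : ℂ) * e (∑ i, k.val i i * t i)
  have hφ : Continuous φ := by
    refine (Units.continuous_val.comp (hχc.comp continuous_GL_det)).mul (he.continuous.comp ?_)
    exact continuous_finsetSum _ fun i _ => (continuous_GL_apply i i).mul continuous_const
  have hφ1 : ∀ k, ‖φ k‖ = 1 := fun k => by rw [norm_mul, hχ1, he.norm_eq_one, one_mul]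
  have hS : MeasurableSet S :=
    (isOpen_of_mul_mem (isOpen_congruenceGL (pow_pos h0 β)) fun g hg k hk =>
      iwahoriLevel_mul_mem (pow_pos h0 β).le le_rfl hg hk).measurableSet
  have hSfin : IsFiniteMeasure (dk.restrict S) := ⟨by
    rw [Measure.restrict_apply_univ]
    exact (measure_mono fun g hg => hg.1).trans_lt (isCompact_intGL (F := F)).measure_lt_top⟩
  have hνp : IsProbabilityMeasure (dc.restrict (unitSet F)) :=
    ⟨by rw [Measure.restrict_apply_univ, hdc]⟩
  let ν : Measure (Fin n → Fˣ) := Measure.pi fun _ => dc.restrict (unitSet F)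
  have hν : ∀ᵐ c ∂ν, ∀ i, c i ∈ unitSet F := by
    have h1 : ν = (Measure.pi fun _ => dc).restrict (Set.pi Set.univ fun _ => unitSet F) :=
      (Measure.restrict_pi_pi _ _).symm
    rw [h1]
    filter_upwards [ae_restrict_mem (MeasurableSet.univ_pi fun _ => isOpen_unitSet.measurableSet)]
      with c hc i using hc i trivial
  have hdiag : ∀ (c : Fin n → Fˣ) (k : GL (Fin n) F) (i j : Fin n),
      (upGL c 0 * k).val i j = c i * k.val i j := fun c k i j => by
    have : (upGL c 0).val = Matrix.diagonal fun i => (c i : F) := by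
      ext i j
      rw [upGL_val, upMat_eq_add, Matrix.add_apply]
      simp [extMat]
    rw [Units.val_mul, this, Matrix.diagonal_mul]
  have hinv : ∀ c : Fin n → Fˣ, (∀ i, c i ∈ unitSet F) →
      ∫ k in S, φ (upGL c 0 * k) ∂dk = ∫ k in S, φ k ∂dk := by
    intro c hc
    have hcK : upGL c 0 ∈ intGL F (Fin n) := by
      refine mem_intGL_of_det (fun i j => ?_) ?_
      · have := hdiag c 1 i j
        rw [mul_one] at this
        rw [this, norm_mul, show ‖(c i : F)‖ = 1 from hc i, one_mul, Units.val_one,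
          Matrix.one_apply]
        split_ifs <;> simp
      · rw [upGL_val, det_upMat, norm_prod]
        exact Finset.prod_eq_one fun i _ => hc i
    have hpre : (upGL c 0 * ·) ⁻¹' S = S := by
      ext k
      refine and_congr (Subgroup.mul_mem_cancel_left _ hcK) ?_
      refine forall_congr' fun i => forall_congr' fun j => imp_congr_right fun _ => ?_
      change ‖(upGL c 0 * k).val i j‖ ≤ _ ↔ _
      rw [hdiag, norm_mul, show ‖(c i : F)‖ = 1 from hc i, one_mul]
    have hmp := (measurePreserving_mul_left dk (upGL c 0)).restrict_preimage hS
    rw [hpre] at hmp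
    exact hmp.integral_comp (measurableEmbedding_mulLeft _) φ
  have hI : ∫ k in S, φ k ∂dk = ∫ c, ∫ k in S, φ (upGL c 0 * k) ∂dk ∂ν := by
    rw [integral_congr_ae (g := fun _ => ∫ k in S, φ k ∂dk)
      (hν.mono fun c hc => hinv c hc), integral_const]
    simp
  change ∫ k in S, φ k ∂dk = _
  rw [hI, integral_integral_swap]
  swap
  · refine Integrable.of_bound (Continuous.aestronglyMeasurable ?_) 1
      (Filter.Eventually.of_forall fun x => (hφ1 _).le)
    exact hφ.comp ((continuous_upGL.comp (continuous_fst.prodMk continuous_const)).mul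
      continuous_snd)
  rw [setIntegral_congr_fun hS (g := fun _ => ∏ i, tateKernel dc χ e (t i))]
  · rw [setIntegral_const, Complex.real_smul]
  intro k hk
  have h1 : ∀ c : Fin n → Fˣ, φ (upGL c 0 * k) =
      ∏ i, ((χ (c i) : ℂ) * extChar χ (k.val i i) * e (c i * k.val i i * t i)) := fun c => by
    have e1 : Matrix.GeneralLinearGroup.det (upGL c 0) = ∏ i, c i := by
      refine Units.ext ?_
      rw [Units.coe_prod]
      exact det_upMat c 0
    simp only [φ]
    rw [map_mul, map_mul, Units.val_mul, e1, map_prod, Units.coe_prod,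
      map_det_of_mem_iwahoriLevel hϖ hχ hβ hk, he.map_sum, ← Finset.prod_mul_distrib,
      ← Finset.prod_mul_distrib]
    simp_rw [hdiag]
  simp only [h1]
  rw [integral_fintype_prod_eq_prod (f := fun i (c : Fˣ) =>
    (χ c : ℂ) * extChar χ (k.val i i) * e (c * k.val i i * t i))]
  refine Finset.prod_congr rfl fun i _ => ?_
  exact setIntegral_extChar dc χ e (norm_diag_of_mem_iwahoriLevel (pow_nonneg h0.le β) hlt hk i) _

end BoxIntegral

end ParahoricZeta

namespace ParahoricZeta

/-! ### Reduction of the zeta integral to Tate integrals -/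

section IwasawaEvaluation

variable {F : Type*} [NontriviallyNormedField F] [IsUltrametricDist F] {n : ℕ} {ϖ : Fˣ} {δ β : ℕ}
  {e : F → ℂ} {θ : Fin n ⊕ Fin n → Fˣ →* ℂˣ} {η χ : Fˣ →* ℂˣ} {F₀ : GL (Fin n ⊕ Fin n) F → ℂ}
  [ProperSpace F]
  [MeasurableSpace F] [BorelSpace F]
  [MeasurableSpace (Matrix (Fin n) (Fin n) F)] [BorelSpace (Matrix (Fin n) (Fin n) F)]
  (dk : Measure (GL (Fin n) F)) [dk.IsHaarMeasure] (dh : Measure (GL (Fin n) F)) [dh.IsHaarMeasure]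
  (dc : Measure Fˣ) [dc.IsHaarMeasure]
  (μ : Measure F) [μ.IsAddHaarMeasure]

theorem prod_strictPair {M : Type*} [CommMonoid M] (g : Fin n → M) :
    ∏ p : StrictPair n, g p.1.1 = ∏ i, g i ^ (n - 1 - i : ℕ) := by
  rw [← Finset.prod_subtype (Finset.univ.filter fun q : Fin n × Fin n => q.1 < q.2) (by simp)
    fun q => g q.1, Finset.prod_filter, Fintype.prod_prod_type]
  refine Finset.prod_congr rfl fun i _ => ?_
  have h1 : (Finset.univ.filter fun j : Fin n => i < j) = Finset.Ioi i := by ext j; simp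
  rw [← Finset.prod_filter]
  dsimp only
  rw [Finset.prod_const, h1, Fin.card_Ioi]

theorem two_mul_card_strictPair : 2 * Fintype.card (StrictPair n) = n * (n - 1) := by
  have h := prod_strictPair (M := Multiplicative ℕ) (fun _ : Fin n => Multiplicative.ofAdd 1)
  have h1 : Fintype.card (StrictPair n) = ∑ i : Fin n, (n - 1 - i : ℕ) := by
    have := congrArg Multiplicative.toAdd h
    simpa [toAdd_prod] using this
  rw [h1, Fin.sum_univ_eq_sum_range (fun i => n - 1 - i) n,
    Finset.sum_range_reflect (fun i => i) n, mul_comm, Finset.sum_range_id_mul_two]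

theorem upperDensity_lt_top (x : (Fin n → Fˣ) × (StrictPair n → F)) : upperDensity ϖ x < ⊤ := by
  rw [upperDensity, ENNReal.inv_lt_top, pos_iff_ne_zero]
  exact Finset.prod_ne_zero_iff.2 fun p _ => by simpa using normAbs_pos _

theorem upperDensity_toReal (x : (Fin n → Fˣ) × (StrictPair n → F)) :
    (upperDensity ϖ x).toReal = ∏ i, (normAbs ϖ (x.1 i : F) ^ (n - 1 - i : ℕ))⁻¹ := by
  rw [upperDensity, ENNReal.toReal_inv, ENNReal.toReal_prod, Finset.prod_inv_distrib,
    ← prod_strictPair]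
  congr 1
  exact Finset.prod_congr rfl fun p _ => ENNReal.toReal_ofReal (normAbs_pos _).le

open Classical in
/-- The integrand of a Tate integral over a fractional ideal. -/
noncomputable def tateTerm (ϖ : Fˣ) (s : ℂ) (m : ℕ) (ω : Fˣ →* ℂˣ) (t : Fˣ) : ℂ :=
  if ‖(t : F)‖ ≤ ‖(ϖ : F)‖ ^ (-(m : ℤ)) then
    (ω t : ℂ) * ((normAbs ϖ (t : F) : ℝ) : ℂ) ^ s else 0

open Classical in
/-- The power of the determinant, cut off to a lattice of matrices. -/
noncomputable def detWeight (ϖ : Fˣ) (z : ℂ) (m : ℕ) (h : GL (Fin n) F) : ℂ :=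
  ((normAbs ϖ (Matrix.GeneralLinearGroup.det h : F) : ℝ) : ℂ) ^ z *
    if ∀ i j, ‖h.val i j‖ ≤ ‖(ϖ : F)‖ ^ (-(m : ℤ)) then 1 else 0

theorem normAbs_det_mul (h k : GL (Fin n) F) :
    normAbs ϖ (Matrix.GeneralLinearGroup.det (h * k) : F) =
      normAbs ϖ (Matrix.GeneralLinearGroup.det h : F) *
        normAbs ϖ (Matrix.GeneralLinearGroup.det k : F) := by
  rw [map_mul, Units.val_mul, normAbs_mul]

theorem normAbs_det_of_mem {k : GL (Fin n) F} (hk : k ∈ intGL F (Fin n)) :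
    normAbs ϖ (Matrix.GeneralLinearGroup.det k : F) = 1 :=
  normAbs_of_norm_one (norm_det_of_mem_intGL hk)

theorem detWeight_mul_left (z : ℂ) (m : ℕ) {k : GL (Fin n) F} (hk : k ∈ intGL F (Fin n))
    (h : GL (Fin n) F) : detWeight ϖ z m (k * h) = detWeight ϖ z m h := by
  have h0 := norm_units_pos ϖ
  rw [detWeight, detWeight, normAbs_det_mul, normAbs_det_of_mem hk, one_mul,
    if_congr (norm_mul_intGL_le_iff hk (zpow_pos h0 _).le) rfl rfl]

theorem detWeight_mul_right (z : ℂ) (m : ℕ) {k : GL (Fin n) F} (hk : k ∈ intGL F (Fin n))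
    (h : GL (Fin n) F) : detWeight ϖ z m (h * k) = detWeight ϖ z m h := by
  have h0 := norm_units_pos ϖ
  rw [detWeight, detWeight, normAbs_det_mul, normAbs_det_of_mem hk, mul_one,
    if_congr (norm_mul_intGL_right_le_iff hk (zpow_pos h0 _).le) rfl rfl]

theorem det_upGL (t : Fin n → Fˣ) (y : StrictPair n → F) :
    Matrix.GeneralLinearGroup.det (upGL t y) = ∏ i, t i := by
  refine Units.ext ?_
  rw [Units.coe_prod]
  exact det_upMat t y

theorem inducingChar_lower (t : Fin n → Fˣ) :
    inducingChar ϖ θ (Sum.elim (fun _ => 1) t) =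
      ∏ i, ((normAbs ϖ (t i : F) ^ ((2 * (n : ℝ) - 1 - 2 * (n + i : ℕ)) / 2) : ℝ) : ℂ) *
        (θ (Sum.inr i) (t i) : ℂ) := by
  rw [inducingChar, Fintype.prod_sum_type, Finset.prod_eq_one, one_mul]
  · rfl
  · intro i _
    simp [normAbs_of_norm_one]

/-- The exponent of `|t_i|` collects `s - 1/2` from the zeta integral, `n` from the Shalika
function, `-i - 1/2` from `δ_B^(1/2)` and `-(n - 1 - i)` from the density. The sum is `s` in every
row. -/
theorem cpow_balance {x : ℝ} (hx : 0 < x) (s : ℂ) (i : Fin n) :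
    (x : ℂ) ^ (s - 1 / 2 + n) *
      (((x ^ ((2 * (n : ℝ) - 1 - 2 * (n + i : ℕ)) / 2) : ℝ) : ℂ) *
        (((x ^ (n - 1 - i : ℕ))⁻¹ : ℝ) : ℂ)) = (x : ℂ) ^ s := by
  have hx' : (x : ℂ) ≠ 0 := by exact_mod_cast hx.ne'
  have h1 : n - 1 - (i : ℕ) + (i + 1) = n := by have := i.2; omega
  have h2 : ((n - 1 - i : ℕ) : ℂ) = n - 1 - i := by
    have : (((n - 1 - i : ℕ) : ℂ)) + (i + 1) = n := by exact_mod_cast h1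
    linear_combination this
  rw [Complex.ofReal_cpow hx.le, Complex.ofReal_inv, Complex.ofReal_pow, ← Complex.cpow_natCast,
    ← Complex.cpow_neg, ← Complex.cpow_add _ _ hx', ← Complex.cpow_add _ _ hx']
  congr 1
  push_cast
  rw [h2]
  ring

theorem ofReal_prod_cpow {ι : Type*} (s : Finset ι) {x : ι → ℝ} (hx : ∀ i, 0 ≤ x i) (z : ℂ) :
    ((∏ i ∈ s, x i : ℝ) : ℂ) ^ z = ∏ i ∈ s, (x i : ℂ) ^ z := by
  classical
  induction s using Finset.induction_on with
  | empty => simp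
  | insert a s ha ih =>
    rw [Finset.prod_insert ha, Finset.prod_insert ha, Complex.ofReal_mul,
      Complex.mul_cpow_ofReal_nonneg (hx a) (Finset.prod_nonneg fun i _ => hx i), ih]

/-- In Iwasawa coordinates everything except the Gauss kernel separates into functions of the single
`t i` and the indicator of a box in `y`. The cut-off on entries is a condition on each coordinate by
itself. -/
theorem upperDensity_smul_eq (hF : IsNormalisedVector ϖ δ θ F₀) (s : ℂ) (m : ℕ)
    (hr : 0 ≤ ‖(ϖ : F)‖ ^ (-(m : ℤ)))
    (x : (Fin n → Fˣ) × (StrictPair n → F)) :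
    (upperDensity ϖ x).toReal • (detWeight ϖ (s - 1 / 2 + n) m (upGL x.1 x.2) *
      (χ (Matrix.GeneralLinearGroup.det (upGL x.1 x.2)) : ℂ) * leviValue F₀ (upGL x.1 x.2)) =
    (leviValue F₀ 1 * ∏ i, tateTerm ϖ s m (θ (Sum.inr i) * χ) (x.1 i)) *
      (normBox F (StrictPair n) hr : Set (StrictPair n → F)).indicator 1 x.2 := by
  classical
  obtain ⟨t, y⟩ := x
  have hcut : (∀ i j, ‖(upGL t y).val i j‖ ≤ ‖(ϖ : F)‖ ^ (-(m : ℤ))) ↔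
      (∀ i, ‖(t i : F)‖ ≤ ‖(ϖ : F)‖ ^ (-(m : ℤ))) ∧
        y ∈ (normBox F (StrictPair n) hr : Set (StrictPair n → F)) := by
    rw [upGL_val]
    constructor
    · intro h
      refine ⟨fun i => by simpa [upMat_diag] using h i i, fun p => ?_⟩
      have := h p.1.1 p.1.2
      rwa [upMat_of_lt t y p.2] at this
    · rintro ⟨h1, h2⟩ i j
      rcases lt_trichotomy i j with h | rfl | h
      · rw [upMat_of_lt t y h]; exact h2 _
      · rw [upMat_diag]; exact h1 i
      · rw [upMat_blockTriangular t y h, norm_zero]; exact hr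
  dsimp only
  rw [Complex.real_smul, upperDensity_toReal, detWeight, if_congr hcut rfl rfl,
    hF.leviValue_upGL, inducingChar_lower, det_upGL, map_prod, Units.coe_prod, Units.coe_prod,
    normAbs_prod]
  by_cases h1 : ∀ i, ‖(t i : F)‖ ≤ ‖(ϖ : F)‖ ^ (-(m : ℤ))
  swap
  · rw [if_neg fun h => h1 h.1]
    push Not at h1
    obtain ⟨i, hi⟩ := h1
    rw [Finset.prod_eq_zero (f := fun i => tateTerm ϖ s m (θ (Sum.inr i) * χ) (t i))
      (Finset.mem_univ i) (by rw [tateTerm, if_neg hi.not_ge])]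
    simp
  by_cases h2 : y ∈ (normBox F (StrictPair n) hr : Set (StrictPair n → F))
  swap
  · rw [if_neg fun h => h2 h.2, Set.indicator_of_notMem h2]
    simp
  rw [if_pos ⟨h1, h2⟩, Set.indicator_of_mem h2, Pi.one_apply, mul_one, mul_one]
  have h3 : ∀ i, tateTerm ϖ s m (θ (Sum.inr i) * χ) (t i) =
      (((normAbs ϖ (t i : F) ^ (n - 1 - i : ℕ))⁻¹ : ℝ) : ℂ) *
      ((normAbs ϖ (t i : F) : ℝ) : ℂ) ^ (s - 1 / 2 + n) * (χ (t i) : ℂ) *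
      (((normAbs ϖ (t i : F) ^ ((2 * (n : ℝ) - 1 - 2 * (n + i : ℕ)) / 2) : ℝ) : ℂ) *
        (θ (Sum.inr i) (t i) : ℂ)) := fun i => by
    rw [tateTerm, if_pos (h1 i), ← cpow_balance (normAbs_pos (t i)) s i, MonoidHom.mul_apply,
      Units.val_mul]
    ring
  simp_rw [h3]
  simp only [Finset.prod_mul_distrib]
  rw [Complex.ofReal_prod, ofReal_prod_cpow _ fun i => (normAbs_pos (t i)).le]
  ring

theorem integrable_detWeight (hϖ : IsUniformizer ϖ) (hdc : dc (unitSet F) = 1)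
    (hμ : μ {x | ‖x‖ ≤ 1} = 1) (hF : IsNormalisedVector ϖ δ θ F₀) (hχ : Continuous χ)
    (hχ1 : ∀ x, ‖(χ x : ℂ)‖ = 1) (s : ℂ) (m : ℕ)
    (hint : ∀ i, Integrable (tateTerm ϖ s m (θ (Sum.inr i) * χ)) dc) :
    Integrable (fun h => detWeight ϖ (s - 1 / 2 + n) m h *
      (χ (Matrix.GeneralLinearGroup.det h) : ℂ) * leviValue F₀ h) dh ∧
    Integrable (fun x : (Fin n → Fˣ) × (StrictPair n → F) => (upperDensity ϖ x).toReal •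
      (detWeight ϖ (s - 1 / 2 + n) m (upGL x.1 x.2) *
        (χ (Matrix.GeneralLinearGroup.det (upGL x.1 x.2)) : ℂ) * leviValue F₀ (upGL x.1 x.2)))
      ((Measure.pi fun _ => dc).prod (Measure.pi fun _ => μ)) := by
  have hr : 0 ≤ ‖(ϖ : F)‖ ^ (-(m : ℤ)) := (zpow_pos (norm_units_pos ϖ) _).le
  set M : GL (Fin n) F → ℂ := fun h => detWeight ϖ (s - 1 / 2 + n) m h *
      (χ (Matrix.GeneralLinearGroup.det h) : ℂ) * leviValue F₀ h with hM
  have h2 : Integrable (fun x : (Fin n → Fˣ) × (StrictPair n → F) => (upperDensity ϖ x).toReal •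
      M (upGL x.1 x.2)) ((Measure.pi fun _ => dc).prod (Measure.pi fun _ => μ)) := by
    simp only [hM, upperDensity_smul_eq hF s m hr]
    refine ((Integrable.fintype_prod hint).const_mul _).mul_prod ?_
    rw [integrable_indicator_iff (measurableSet_normBox _ hr)]
    exact integrableOn_const (isCompact_normBox _ hr).measure_ne_top
  refine ⟨?_, h2⟩
  have hcont : Continuous M := by
    refine ((continuous_of_mul_eq isOpen_intGL fun h k hk => ?_).mul
      (Units.continuous_val.comp (hχ.comp continuous_GL_det))).mul (continuous_leviValue hF)
    exact detWeight_mul_right _ _ hk h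
  -- `M` need not be right invariant under `GL_n(𝒪)`, because of the factor `χ(det h)`. Its absolute
  -- value is, since `χ` is unitary, so the Iwasawa criterion is applied to that.
  have h3 : Integrable (fun h => ((‖M h‖ : ℝ) : ℂ)) dh := by
    refine integrable_iwasawa hϖ dc hdc μ hμ dh (fun h k hk => ?_) ?_
    · simp only [hM, norm_mul, hχ1]
      rw [detWeight_mul_right _ _ hk, hF.leviValue_mul hk]
    · rw [upperMeasure, integrable_withDensity_iff_integrable_smul' (measurable_upperDensity ϖ)
        (Filter.Eventually.of_forall upperDensity_lt_top)]
      refine h2.norm.ofReal.congr (Filter.Eventually.of_forall fun x => ?_)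
      change ((‖(upperDensity ϖ x).toReal • M (upGL x.1 x.2)‖ : ℝ) : ℂ) =
        (upperDensity ϖ x).toReal • ((‖M (upGL x.1 x.2)‖ : ℝ) : ℂ)
      rw [norm_smul, Real.norm_of_nonneg ENNReal.toReal_nonneg, Complex.ofReal_mul,
        Complex.real_smul]
  refine h3.norm.mono' hcont.aestronglyMeasurable (Filter.Eventually.of_forall fun h => ?_)
  rw [Complex.norm_real, norm_norm]

/-- The kernel is bounded by a volume, so integrability carries over from the integrand without it
and Fubini applies. The inner integral over the box in `y` is the one that splits the kernel into a
product over the `t i`. -/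
theorem integral_detWeight (hϖ : IsUniformizer ϖ) (hdc : dc (unitSet F) = 1)
    (hμ : μ {x | ‖x‖ ≤ 1} = 1) (hF : IsNormalisedVector ϖ δ θ F₀) (he : IsSmoothChar ϖ δ e)
    (hχ : ∀ c ∈ higherUnits ϖ β, χ c = 1) (hχ1 : ∀ x, ‖(χ x : ℂ)‖ = 1) (hβ : 1 ≤ β) (s : ℂ)
    (hint : ∀ i, Integrable (tateTerm ϖ s (β + δ) (θ (Sum.inr i) * χ)) dc) :
    ∫ h, detWeight ϖ (s - 1 / 2 + n) (β + δ) h *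
      (χ (Matrix.GeneralLinearGroup.det h) : ℂ) * leviValue F₀ h * gaussKernel dk χ e h ∂dh =
    (dh.real (intGL F (Fin n)) : ℂ) * leviValue F₀ 1 *
      (resCard F : ℂ) ^ ((β + δ) * Fintype.card (StrictPair n)) *
      (dk.real (iwahoriLevel F n (‖(ϖ : F)‖ ^ β)) : ℂ) *
      ∏ i : Fin n, ∫ t, tateTerm ϖ s (β + δ) (θ (Sum.inr i) * χ) t * tateKernel dc χ e t ∂dc := by
  have hr : 0 ≤ ‖(ϖ : F)‖ ^ (-((β + δ : ℕ) : ℤ)) := (zpow_pos (norm_units_pos ϖ) _).le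
  have hχc : Continuous χ := continuous_of_higherUnits hχ
  have hint2 := (integrable_detWeight dh dc μ hϖ hdc hμ hF hχc hχ1 s (β + δ) hint).2
  have hgc : Continuous fun h => (χ (Matrix.GeneralLinearGroup.det h) : ℂ) * gaussKernel dk χ e h :=
    continuous_of_mul_eq isOpen_intGL fun h k hk => gaussKernel_mul dk χ e h hk
  have hg : Continuous (gaussKernel dk χ e) := by
    have h1 : gaussKernel dk χ e = fun h => (((χ (Matrix.GeneralLinearGroup.det h))⁻¹ : ℂˣ) : ℂ) *
        ((χ (Matrix.GeneralLinearGroup.det h) : ℂ) * gaussKernel dk χ e h) := by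
      ext h
      rw [← mul_assoc, Units.inv_mul, one_mul]
    rw [h1]
    exact (Units.continuous_val.comp (hχc.comp continuous_GL_det).inv).mul hgc
  have hg1 : ∀ h, ‖gaussKernel dk χ e h‖ ≤ dk.real (intGL F (Fin n)) := fun h => by
    have := norm_setIntegral_le_of_norm_le_const (μ := dk) (C := 1)
      (s := (intGL F (Fin n) : Set (GL (Fin n) F)))
      (f := fun k => (χ (Matrix.GeneralLinearGroup.det k) : ℂ) * e (k.val * h.val).trace)
      isCompact_intGL.measure_lt_top
      (fun k _ => by rw [norm_mul, hχ1, he.norm_eq_one, one_mul])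
    rw [gaussKernel]
    simpa using this
  rw [integral_iwasawa hϖ dc hdc μ hμ dh (fun h k hk => by
    have := gaussKernel_mul dk χ e h hk
    rw [detWeight_mul_right _ _ hk, hF.leviValue_mul hk]
    linear_combination (detWeight ϖ (s - 1 / 2 + n) (β + δ) h * leviValue F₀ h) * this),
    upperMeasure, integral_withDensity_eq_integral_toReal_smul (measurable_upperDensity ϖ)
      (Filter.Eventually.of_forall upperDensity_lt_top)]
  have h1 : ∀ x : (Fin n → Fˣ) × (StrictPair n → F), (upperDensity ϖ x).toReal •
      (detWeight ϖ (s - 1 / 2 + n) (β + δ) (upGL x.1 x.2) *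
        (χ (Matrix.GeneralLinearGroup.det (upGL x.1 x.2)) : ℂ) * leviValue F₀ (upGL x.1 x.2) *
          gaussKernel dk χ e (upGL x.1 x.2)) =
      ((leviValue F₀ 1 * ∏ i, tateTerm ϖ s (β + δ) (θ (Sum.inr i) * χ) (x.1 i)) *
      (normBox F (StrictPair n) hr : Set (StrictPair n → F)).indicator 1 x.2) *
        gaussKernel dk χ e (upGL x.1 x.2) := fun x => by
    rw [← upperDensity_smul_eq hF s (β + δ) hr, smul_mul_assoc]
  simp only [upperDensity_smul_eq hF s (β + δ) hr] at hint2
  simp only [h1]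
  have hint3 : Integrable (fun x : (Fin n → Fˣ) × (StrictPair n → F) =>
      ((leviValue F₀ 1 * ∏ i, tateTerm ϖ s (β + δ) (θ (Sum.inr i) * χ) (x.1 i)) *
      (normBox F (StrictPair n) hr : Set (StrictPair n → F)).indicator 1 x.2) *
        gaussKernel dk χ e (upGL x.1 x.2))
      ((Measure.pi fun _ => dc).prod (Measure.pi fun _ => μ)) :=
    hint2.mul_bdd (hg.comp continuous_upGL).aestronglyMeasurable
      (Filter.Eventually.of_forall fun x => hg1 _)
  rw [integral_prod _ hint3]
  have h2 : ∀ t : Fin n → Fˣ, ∫ y, (leviValue F₀ 1 *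
      ∏ i, tateTerm ϖ s (β + δ) (θ (Sum.inr i) * χ) (t i)) *
      (normBox F (StrictPair n) hr : Set (StrictPair n → F)).indicator 1 y *
        gaussKernel dk χ e (upGL t y) ∂(Measure.pi fun _ => μ) =
      leviValue F₀ 1 * (resCard F : ℂ) ^ ((β + δ) * Fintype.card (StrictPair n)) *
      (dk.real (iwahoriLevel F n (‖(ϖ : F)‖ ^ β)) : ℂ) *
        ∏ i, (tateTerm ϖ s (β + δ) (θ (Sum.inr i) * χ) (t i) * tateKernel dc χ e (t i)) := by
    intro t
    have h3 : ∀ y, (normBox F (StrictPair n) hr : Set (StrictPair n → F)).indicator 1 y *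
        gaussKernel dk χ e (upGL t y) =
        (normBox F (StrictPair n) hr : Set (StrictPair n → F)).indicator
          (fun y => gaussKernel dk χ e (upGL t y)) y := fun y => by
      classical
      rw [Set.indicator_apply, Set.indicator_apply]
      split_ifs <;> simp
    simp_rw [mul_assoc _ (Set.indicator _ _ _), h3]
    rw [integral_const_mul, integral_indicator (measurableSet_normBox _ hr),
      setIntegral_gaussKernel dk μ hχc hχ1 he hr, setIntegral_iwahoriLevel dk dc hϖ hχ hχ1 hβ he hdc,
      measure_normBox μ hϖ hμ, Finset.prod_mul_distrib]
    push_cast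
    ring
  simp_rw [h2]
  rw [integral_const_mul, integral_fintype_prod_eq_prod (f := fun i (t : Fˣ) =>
    tateTerm ϖ s (β + δ) (θ (Sum.inr i) * χ) t * tateKernel dc χ e t)]
  ring

theorem zeta_eq_prod_tate (hϖ : IsUniformizer ϖ) (hdc : dc (unitSet F) = 1)
    (hμ : μ {x | ‖x‖ ≤ 1} = 1) (hF : IsNormalisedVector ϖ δ θ F₀) (he : IsSmoothChar ϖ δ e)
    (hη : IsUnramified η) (dX : Measure (Matrix (Fin n) (Fin n) F)) [dX.IsAddHaarMeasure]
    (hdX : dX {X | ∀ i j, ‖X i j‖ ≤ 1} = 1)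
    (hχ : ∀ c ∈ higherUnits ϖ β, χ c = 1) (hχ1 : ∀ x, ‖(χ x : ℂ)‖ = 1) (hβ : 1 ≤ β) (s : ℂ)
    (hint : ∀ i, Integrable (tateTerm ϖ s (β + δ) (θ (Sum.inr i) * χ)) dc) :
    Integrable (zetaIntegrand ϖ s (rightTranslate ((uMat F n)⁻¹ * tMat n ϖ ^ β)
      (shalikaFun dk dX e η F₀)) χ) dh ∧
    zetaIntegral dh ϖ s (rightTranslate ((uMat F n)⁻¹ * tMat n ϖ ^ β)
      (shalikaFun dk dX e η F₀)) χ =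
    alphaN ϖ θ ^ β * ((resCard F : ℂ) ^ (β * n ^ 2))⁻¹ *
      ((χ (Matrix.GeneralLinearGroup.det (-wLong F n)) : ℂ) *
      ((dh.real (intGL F (Fin n)) : ℂ) * leviValue F₀ 1 *
      (resCard F : ℂ) ^ ((β + δ) * Fintype.card (StrictPair n)) *
      (dk.real (iwahoriLevel F n (‖(ϖ : F)‖ ^ β)) : ℂ) *
      ∏ i : Fin n,
        ∫ t, tateTerm ϖ s (β + δ) (θ (Sum.inr i) * χ) t * tateKernel dc χ e t ∂dc)) := by
  have hχc : Continuous χ := continuous_of_higherUnits hχ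
  have h1 : zetaIntegrand ϖ s (rightTranslate ((uMat F n)⁻¹ * tMat n ϖ ^ β)
      (shalikaFun dk dX e η F₀)) χ = fun h => alphaN ϖ θ ^ β * ((resCard F : ℂ) ^ (β * n ^ 2))⁻¹ *
        (detWeight ϖ (s - 1 / 2 + n) (β + δ) h * e (-(h.val * antidiag F n).trace) *
        (χ (Matrix.GeneralLinearGroup.det h) : ℂ) *
        ∫ k in (intGL F (Fin n) : Set (GL (Fin n) F)), leviValue F₀ (k * h) ∂dk) := by
    ext h
    rw [zetaIntegrand, rightTranslate, shalikaFun_eq dX dk hϖ he hμ hdX hF hη, detWeight,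
      Complex.cpow_add _ _ (by exact_mod_cast (normAbs_pos _).ne'), Complex.cpow_natCast,
      Complex.ofReal_pow]
    ring
  obtain ⟨h2, h3⟩ := unfold_zeta dk dh hχc hχ1 he
    (fun k hk h => detWeight_mul_left (ϖ := ϖ) (s - 1 / 2 + n) (β + δ) hk h)
    (integrable_detWeight dh dc μ hϖ hdc hμ hF hχc hχ1 s (β + δ) hint).1
  rw [zetaIntegral, h1, integral_const_mul, h3,
    integral_detWeight dk dh dc μ hϖ hdc hμ hF he hχ hχ1 hβ s hint]
  exact ⟨h2.const_mul _, rfl⟩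

end IwasawaEvaluation

end ParahoricZeta

namespace ParahoricZeta

/-! ### Radial integrals as sums over valuations -/

section RadialIntegrals

variable {F : Type*} [NontriviallyNormedField F] [IsUltrametricDist F] {ϖ : Fˣ}
  [ProperSpace F] [MeasurableSpace F] [BorelSpace F] (dc : Measure Fˣ) [dc.IsHaarMeasure]

theorem ord_mul_of_mem (hϖ : IsUniformizer ϖ) (t : Fˣ) {u : Fˣ} (hu : u ∈ unitSet F) :
    ord hϖ (t * u) = ord hϖ t :=
  (ord_eq_iff hϖ).2 (by rw [Units.val_mul, norm_mul, show ‖(u : F)‖ = 1 from hu, mul_one])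

theorem measurable_ord (hϖ : IsUniformizer ϖ) : Measurable (ord hϖ) :=
  (continuous_of_mul_eq (H := unitSubgroup F) isOpen_unitSet fun t _ hu =>
    ord_mul_of_mem hϖ t hu).measurable

/-- Every shell of fixed valuation is a translate of the units and so has volume `1`. -/
theorem map_ord (hϖ : IsUniformizer ϖ) (hdc : dc (unitSet F) = 1) :
    dc.map (ord hϖ) = Measure.count := by
  refine Measure.ext_of_singleton fun k => ?_
  rw [Measure.map_apply (measurable_ord hϖ) (measurableSet_singleton k), Measure.count_singleton,
    ← measure_norm_eq dc hdc (ϖ ^ k)]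
  congr 1
  ext c
  rw [Set.mem_preimage, Set.mem_singleton_iff, Set.mem_ofPred_eq, ← ord_eq_iff hϖ, ord_zpow]

theorem integrable_comp_ord (hϖ : IsUniformizer ϖ) (hdc : dc (unitSet F) = 1) (h : ℤ → ℂ) :
    Integrable (fun t => h (ord hϖ t)) dc ↔ Summable fun k => ‖h k‖ := by
  rw [← integrable_count_iff, ← map_ord dc hϖ hdc,
    integrable_map_measure (measurable_of_countable h).aestronglyMeasurable
      (measurable_ord hϖ).aemeasurable]
  rfl

theorem integral_comp_ord (hϖ : IsUniformizer ϖ) (hdc : dc (unitSet F) = 1) {h : ℤ → ℂ}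
    (hs : Summable fun k => ‖h k‖) : ∫ t, h (ord hϖ t) ∂dc = ∑' k, h k := by
  rw [← integral_map (φ := ord hϖ) (f := h) (measurable_ord hϖ).aemeasurable
    (measurable_of_countable h).aestronglyMeasurable, map_ord dc hϖ hdc,
    integral_countable (integrable_count_iff.2 hs)]
  simp [Measure.real]

/-- A function on `ℤ` supported on `k ≥ -m` with geometric values. -/
noncomputable def geomTail (m : ℕ) (Z : ℂ) (g : ℤ → ℂ) (k : ℤ) : ℂ :=
  if -(m : ℤ) ≤ k then Z ^ k * g k else 0

theorem geomTail_support (m : ℕ) (Z : ℂ) (g : ℤ → ℂ) :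
    ∀ k ∉ Set.range (fun j : ℕ => (j : ℤ) - m), geomTail m Z g k = 0 := by
  intro k hk
  rw [geomTail, if_neg]
  intro h
  exact hk ⟨(k + m).toNat, by simp only; omega⟩

theorem sub_natCast_injective (m : ℕ) : Function.Injective (fun j : ℕ => (j : ℤ) - m) :=
  fun a b h => by simpa using h

theorem geomTail_shift {Z : ℂ} (hZ0 : Z ≠ 0) (m : ℕ) (g : ℤ → ℂ) (j : ℕ) :
    geomTail m Z g ((j : ℤ) - m) = (Z ^ m)⁻¹ * (Z ^ j * g ((j : ℤ) - m)) := by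
  rw [geomTail, if_pos (by omega), zpow_sub₀ hZ0, zpow_natCast, zpow_natCast, div_eq_mul_inv]
  ring

theorem summable_geomTail {Z : ℂ} (hZ0 : Z ≠ 0) (hZ : ‖Z‖ < 1) (m : ℕ) {g : ℤ → ℂ}
    (hg : ∀ k, ‖g k‖ ≤ 1) : Summable fun k => ‖geomTail m Z g k‖ := by
  rw [← (sub_natCast_injective m).summable_iff fun k hk => by
    rw [geomTail_support m Z g k hk, norm_zero]]
  refine Summable.of_nonneg_of_le (fun _ => norm_nonneg _) (fun j => ?_)
    ((summable_geometric_of_lt_one (norm_nonneg Z) hZ).mul_left ‖(Z ^ m)⁻¹‖)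
  rw [Function.comp_apply, geomTail_shift hZ0, norm_mul, norm_mul, norm_pow]
  gcongr
  exact mul_le_of_le_one_right (by positivity) (hg _)

theorem tsum_geomTail_of_eq_zero {Z : ℂ} (m : ℕ) {g : ℤ → ℂ}
    (hg : ∀ k, -(m : ℤ) < k → g k = 0) :
    ∑' k, geomTail m Z g k = (Z ^ m)⁻¹ * g (-(m : ℤ)) := by
  rw [tsum_eq_single (-(m : ℤ))]
  · rw [geomTail, if_pos le_rfl, zpow_neg, zpow_natCast]
  · intro k hk
    rw [geomTail]
    split_ifs with h
    · rw [hg k (lt_of_le_of_ne h hk.symm), mul_zero]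
    · rfl

theorem tsum_geomTail_of_eq_one {Z : ℂ} (hZ0 : Z ≠ 0) (hZ : ‖Z‖ < 1) (m : ℕ) {g : ℤ → ℂ}
    (hg : ∀ k, -(m : ℤ) < k → g k = 1) :
    ∑' k, geomTail m Z g k = (Z ^ m)⁻¹ * (g (-(m : ℤ)) + Z / (1 - Z)) := by
  have h1 : ∀ j : ℕ, Z ^ (j + 1) * g (((j + 1 : ℕ) : ℤ) - m) = Z * Z ^ j := fun j => by
    rw [hg _ (by push_cast; omega), mul_one, pow_succ']
  have hs : Summable fun j : ℕ => Z ^ j * g ((j : ℤ) - m) := by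
    rw [← summable_nat_add_iff 1]
    simp_rw [h1]
    exact (summable_geometric_of_norm_lt_one hZ).mul_left Z
  rw [← (sub_natCast_injective m).tsum_eq (fun k hk => by
    by_contra h
    exact hk (geomTail_support m Z g k h))]
  simp_rw [geomTail_shift hZ0]
  rw [tsum_mul_left, hs.tsum_eq_zero_add]
  simp_rw [h1]
  rw [tsum_mul_left, tsum_geometric_of_norm_lt_one hZ, pow_zero, one_mul, div_eq_mul_inv]
  simp

end RadialIntegrals

/-! ### Evaluation of the Tate integrals -/

section TateIntegrals

variable {F : Type*} [NontriviallyNormedField F] [IsUltrametricDist F] {ϖ : Fˣ} {δ : ℕ}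
  {e : F → ℂ} {ω χ : Fˣ →* ℂˣ}
  [ProperSpace F] [MeasurableSpace F] [BorelSpace F] (dc : Measure Fˣ) [dc.IsHaarMeasure]

/-- The variable `ω(ϖ) q ^ (-s)`. -/
noncomputable def satake (ϖ : Fˣ) (s : ℂ) (ω : Fˣ →* ℂˣ) : ℂ :=
  (ω ϖ : ℂ) * (resCard F : ℂ) ^ (-s)

theorem resCard_ne_zero : (resCard F : ℂ) ≠ 0 := by
  have := two_le_resCard F
  exact_mod_cast (by omega : resCard F ≠ 0)

theorem satake_ne_zero (ϖ : Fˣ) (s : ℂ) (ω : Fˣ →* ℂˣ) : satake ϖ s ω ≠ 0 := by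
  refine mul_ne_zero (ω ϖ).ne_zero ?_
  rw [Complex.cpow_def_of_ne_zero resCard_ne_zero]
  exact Complex.exp_ne_zero _

theorem norm_satake (ϖ : Fˣ) (s : ℂ) (ω : Fˣ →* ℂˣ) :
    ‖satake ϖ s ω‖ = ‖(ω ϖ : ℂ)‖ * (resCard F : ℝ) ^ (-s.re) := by
  have := two_le_resCard F
  rw [satake, norm_mul, Complex.norm_natCast_cpow_of_pos (by omega), Complex.neg_re]

theorem tateTerm_zpow (hϖ : IsUniformizer ϖ) (s : ℂ) (m : ℕ) (k : ℤ) :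
    tateTerm ϖ s m ω (ϖ ^ k) = geomTail m (satake ϖ s ω) 1 k := by
  have hq : (0 : ℝ) < resCard F := by
    have := two_le_resCard F
    exact_mod_cast (by omega : 0 < resCard F)
  have h1 : ‖((ϖ ^ k : Fˣ) : F)‖ ≤ ‖(ϖ : F)‖ ^ (-(m : ℤ)) ↔ -(m : ℤ) ≤ k := by
    rw [Units.val_zpow_eq_zpow_val, norm_zpow]
    exact (norm_zpow_strictAnti hϖ).le_iff_ge
  rw [tateTerm, geomTail, if_congr h1 rfl rfl]
  refine if_congr Iff.rfl ?_ rfl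
  rw [normAbs_eq_zpow hϖ, ord_zpow, map_zpow, Units.val_zpow_eq_zpow_val, satake, mul_zpow,
    Pi.one_apply, mul_one]
  congr 1
  rw [Complex.cpow_def_of_ne_zero (by exact_mod_cast (zpow_pos hq _).ne'), ← Complex.ofReal_log
    (zpow_pos hq _).le, Real.log_zpow, Complex.cpow_def_of_ne_zero resCard_ne_zero,
    ← Complex.exp_int_mul, Complex.ofReal_mul, Complex.natCast_log]
  congr 1
  push_cast
  ring

theorem norm_tateTerm (hϖ : IsUniformizer ϖ) (s : ℂ) (m : ℕ) (hω : IsUnramified ω)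
    (hχ1 : ∀ x, ‖(χ x : ℂ)‖ = 1) (t : Fˣ) :
    ‖tateTerm ϖ s m (ω * χ) t‖ = ‖geomTail m (satake ϖ s (ω * χ)) 1 (ord hϖ t)‖ := by
  rw [← tateTerm_zpow hϖ, tateTerm, tateTerm]
  have h1 : ‖((ϖ ^ ord hϖ t : Fˣ) : F)‖ = ‖(t : F)‖ := by
    rw [Units.val_zpow_eq_zpow_val, norm_zpow, ← norm_eq_zpow_ord]
  rw [h1]
  split_ifs
  · rw [norm_mul, norm_mul, normAbs_eq_of_norm h1, MonoidHom.mul_apply, MonoidHom.mul_apply,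
      Units.val_mul, Units.val_mul, norm_mul, norm_mul, hχ1, hχ1, hω.map_eq h1]
  · rfl

theorem continuous_tateTerm (s : ℂ) (m : ℕ) (hω : IsUnramified ω) (hχ : Continuous χ) :
    Continuous (tateTerm ϖ s m (ω * χ)) := by
  have h1 : tateTerm ϖ s m (ω * χ) = fun t => (χ t : ℂ) * tateTerm ϖ s m ω t := by
    ext t
    rw [tateTerm, tateTerm, MonoidHom.mul_apply, Units.val_mul]
    split_ifs <;> ring
  rw [h1]
  refine (Units.continuous_val.comp hχ).mul (continuous_of_mul_eq (H := unitSubgroup F)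
    isOpen_unitSet fun t u hu => ?_)
  have h2 : ‖((t * u : Fˣ) : F)‖ = ‖(t : F)‖ := by
    rw [Units.val_mul, norm_mul, show ‖(u : F)‖ = 1 from hu, mul_one]
  rw [tateTerm, tateTerm, h2, hω.map_eq h2, normAbs_eq_of_norm h2]

theorem integrable_tateTerm (hϖ : IsUniformizer ϖ) (hdc : dc (unitSet F) = 1) (s : ℂ) (m : ℕ)
    (hω : IsUnramified ω) (hχ : Continuous χ) (hχ1 : ∀ x, ‖(χ x : ℂ)‖ = 1)
    (hZ : ‖satake ϖ s (ω * χ)‖ < 1) : Integrable (tateTerm ϖ s m (ω * χ)) dc := by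
  have h1 := (integrable_comp_ord dc hϖ hdc (geomTail m (satake ϖ s (ω * χ)) 1)).2
    (summable_geomTail (satake_ne_zero ϖ s _) hZ m fun k => by simp)
  exact h1.norm.mono' (continuous_tateTerm s m hω hχ).aestronglyMeasurable
    (Filter.Eventually.of_forall fun t => (norm_tateTerm hϖ s m hω hχ1 t).le)

theorem tateKernel_mul (χ : Fˣ →* ℂˣ) (e : F → ℂ) {u : Fˣ} (hu : u ∈ unitSet F) (t : Fˣ) :
    (χ (u * t) : ℂ) * tateKernel dc χ e ((u * t : Fˣ) : F) =
      (χ t : ℂ) * tateKernel dc χ e (t : F) := by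
  rw [tateKernel, tateKernel, ← integral_const_mul, ← integral_const_mul,
    ← setIntegral_units_mul_left dc hu fun c => (χ t : ℂ) * ((χ c : ℂ) * e (c * t))]
  congr 1
  ext c
  rw [map_mul, map_mul, Units.val_mul, Units.val_mul, Units.val_mul, Units.val_mul,
    mul_left_comm (c : F), ← mul_assoc (u : F)]
  ring

/-- For ramified `χ` neither factor is radial, but `χ(t)` times the kernel is invariant under units
by `tateKernel_mul`, and the rest depends only on `‖t‖`. -/
theorem tateTerm_mul_tateKernel (hϖ : IsUniformizer ϖ) (s : ℂ) (m : ℕ) (hω : IsUnramified ω)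
    (t : Fˣ) : tateTerm ϖ s m (ω * χ) t * tateKernel dc χ e t =
      geomTail m (satake ϖ s (ω * χ))
        (fun k => tateKernel dc χ e ((ϖ ^ k : Fˣ) : F)) (ord hϖ t) := by
  have h1 : ‖((ϖ ^ ord hϖ t : Fˣ) : F)‖ = ‖(t : F)‖ := by
    rw [Units.val_zpow_eq_zpow_val, norm_zpow, ← norm_eq_zpow_ord]
  have hu : t * (ϖ ^ ord hϖ t)⁻¹ ∈ unitSet F := by
    change ‖((t * (ϖ ^ ord hϖ t)⁻¹ : Fˣ) : F)‖ = 1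
    rw [Units.val_mul, norm_mul, Units.val_inv_eq_inv_val, norm_inv, h1,
      mul_inv_cancel₀ (norm_units_pos t).ne']
  have h2 := tateKernel_mul dc χ e hu (ϖ ^ ord hϖ t)
  rw [inv_mul_cancel_right] at h2
  have h3 : geomTail m (satake ϖ s (ω * χ))
        (fun k => tateKernel dc χ e ((ϖ ^ k : Fˣ) : F)) (ord hϖ t) =
      tateTerm ϖ s m (ω * χ) (ϖ ^ ord hϖ t) * tateKernel dc χ e ((ϖ ^ ord hϖ t : Fˣ) : F) := by
    rw [tateTerm_zpow hϖ, geomTail, geomTail]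
    split_ifs
    · rw [Pi.one_apply, mul_one]
    · rw [zero_mul]
  rw [h3, tateTerm, tateTerm, h1, normAbs_eq_of_norm h1, MonoidHom.mul_apply, MonoidHom.mul_apply,
    Units.val_mul, Units.val_mul, hω.map_eq h1]
  split_ifs
  · linear_combination ((ω t : ℂ) * ((normAbs ϖ (t : F) : ℝ) : ℂ) ^ s) * h2
  · rw [zero_mul, zero_mul]

theorem norm_tateKernel_le (hχ1 : ∀ x, ‖(χ x : ℂ)‖ = 1) (he : IsSmoothChar ϖ δ e)
    (hdc : dc (unitSet F) = 1) (t : F) : ‖tateKernel dc χ e t‖ ≤ 1 := by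
  have := norm_setIntegral_le_of_norm_le_const (μ := dc) (C := 1) (s := unitSet F)
    (f := fun c => (χ c : ℂ) * e (c * t)) (by rw [hdc]; exact ENNReal.one_lt_top)
    (fun k _ => by rw [norm_mul, hχ1, he.norm_eq_one, one_mul])
  rw [tateKernel]
  simpa [Measure.real, hdc] using this

theorem integral_tate (hϖ : IsUniformizer ϖ) (hdc : dc (unitSet F) = 1) (s : ℂ) (m : ℕ)
    (hω : IsUnramified ω) (hχ1 : ∀ x, ‖(χ x : ℂ)‖ = 1) (he : IsSmoothChar ϖ δ e)
    (hZ : ‖satake ϖ s (ω * χ)‖ < 1) :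
    ∫ t, tateTerm ϖ s m (ω * χ) t * tateKernel dc χ e t ∂dc =
      ∑' k, geomTail m (satake ϖ s (ω * χ))
        (fun k => tateKernel dc χ e ((ϖ ^ k : Fˣ) : F)) k := by
  simp_rw [tateTerm_mul_tateKernel dc hϖ s m hω]
  exact integral_comp_ord dc hϖ hdc (summable_geomTail (satake_ne_zero ϖ s _) hZ m fun k =>
    norm_tateKernel_le dc hχ1 he hdc _)

theorem norm_zpow_units (ϖ : Fˣ) (k : ℤ) : ‖((ϖ ^ k : Fˣ) : F)‖ = ‖(ϖ : F)‖ ^ k := by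
  rw [Units.val_zpow_eq_zpow_val, norm_zpow]

/-- By minimality of the conductor there is a `u` at level `b - 1` with `χ u ≠ 1`. For `k > -(b +
δ)` the difference `(u - 1) c ϖ^k` lies in `ϖ^(-δ) 𝒪`, so `c ↦ u c` leaves the additive character
unchanged and multiplies the kernel by `χ u`. -/
theorem tateKernel_eq_zero (hϖ : IsUniformizer ϖ) (he : IsSmoothChar ϖ δ e) {b : ℕ} (hb : 1 ≤ b)
    (hχ : HasConductor ϖ χ b) {k : ℤ} (hk : -((b + δ : ℕ) : ℤ) < k) :
    tateKernel dc χ e ((ϖ ^ k : Fˣ) : F) = 0 := by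
  have h0 := norm_units_pos ϖ
  have h1 := hχ.2 (b - 1) (by omega)
  push Not at h1
  obtain ⟨u, ⟨hu, hu1⟩, hne⟩ := h1
  have h2 : tateKernel dc χ e ((ϖ ^ k : Fˣ) : F) =
      (χ u : ℂ) * tateKernel dc χ e ((ϖ ^ k : Fˣ) : F) := by
    conv_lhs => rw [tateKernel, ← setIntegral_units_mul_left dc hu]
    rw [tateKernel, ← integral_const_mul]
    refine setIntegral_congr_fun isOpen_unitSet.measurableSet fun c hc => ?_
    have hc : ‖(c : F)‖ = 1 := hc
    have h3 : ((u * c : Fˣ) : F) * ((ϖ ^ k : Fˣ) : F) =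
        ((u : F) - 1) * (c * ((ϖ ^ k : Fˣ) : F)) + c * ((ϖ ^ k : Fˣ) : F) := by
      rw [Units.val_mul]; ring
    have h4 : e (((u : F) - 1) * (c * ((ϖ ^ k : Fˣ) : F))) = 1 := by
      refine he.eq_one ?_
      rw [norm_mul, norm_mul, hc, one_mul, norm_zpow_units]
      refine (mul_le_mul_of_nonneg_right hu1 (zpow_pos h0 _).le).trans ?_
      rw [← zpow_natCast, ← zpow_add₀ h0.ne']
      exact (norm_zpow_strictAnti hϖ).antitone (by omega)
    rw [h3, he.map_add, h4, one_mul, map_mul, Units.val_mul, mul_assoc]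
  have h5 : ((χ u : ℂ) - 1) * tateKernel dc χ e ((ϖ ^ k : Fˣ) : F) = 0 := by
    linear_combination -h2
  refine (mul_eq_zero.1 h5).resolve_left (sub_ne_zero.2 fun h => hne (Units.ext h))

/-- Only the valuation `-(b + δ)` contributes, and the kernel there is the Gauss sum up to its
normalising factor and a power of `χ(ϖ)`. That power cancels against the one in the Satake variable
of `ω * χ`, which is why `satake ϖ s ω` remains. -/
theorem tate_ramified (hϖ : IsUniformizer ϖ) (hdc : dc (unitSet F) = 1) (s : ℂ)
    (hω : IsUnramified ω) (hχ1 : ∀ x, ‖(χ x : ℂ)‖ = 1) (he : IsSmoothChar ϖ δ e)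
    (hZ : ‖satake ϖ s (ω * χ)‖ < 1) {b : ℕ} (hb : 1 ≤ b) (hχ : HasConductor ϖ χ b) :
    ∫ t, tateTerm ϖ s (b + δ) (ω * χ) t * tateKernel dc χ e t ∂dc =
      (satake ϖ s ω ^ (b + δ))⁻¹ * ((resCard F : ℂ) ^ b * (1 - (resCard F : ℂ)⁻¹))⁻¹ *
        localGaussSum dc ϖ δ b e χ := by
  rw [integral_tate dc hϖ hdc s _ hω hχ1 he hZ,
    tsum_geomTail_of_eq_zero _ fun k hk => tateKernel_eq_zero dc hϖ he hb hχ hk]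
  have h1 : localGaussSum dc ϖ δ b e χ = (resCard F : ℂ) ^ b * (1 - (resCard F : ℂ)⁻¹) *
      (((χ ϖ : ℂ) ^ (b + δ))⁻¹ *
        tateKernel dc χ e ((ϖ ^ (-((b + δ : ℕ) : ℤ)) : Fˣ) : F)) := by
    rw [localGaussSum, tateKernel]
    congr 1
    rw [← integral_const_mul]
    refine integral_congr_ae (Filter.Eventually.of_forall fun c => ?_)
    have e1 : (-(b + δ : ℤ)) = -((b + δ : ℕ) : ℤ) := by push_cast; rfl
    dsimp only
    rw [e1, map_mul, map_zpow, Units.val_mul, Units.val_mul, zpow_neg (χ ϖ), zpow_natCast,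
      Units.val_inv_eq_inv_val, Units.val_pow_eq_pow_val]
    ring
  have h2 : satake ϖ s (ω * χ) = satake ϖ s ω * (χ ϖ : ℂ) := by
    rw [satake, satake, MonoidHom.mul_apply, Units.val_mul]; ring
  have hq : (resCard F : ℂ) ^ b * (1 - (resCard F : ℂ)⁻¹) ≠ 0 := by
    refine mul_ne_zero (pow_ne_zero _ resCard_ne_zero) ?_
    rw [sub_ne_zero]
    intro h
    have h3 : (resCard F : ℂ) = 1 := by rw [← inv_inv (resCard F : ℂ), ← h, inv_one]
    have := two_le_resCard F
    have h4 : resCard F = 1 := by exact_mod_cast h3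
    omega
  rw [h1, h2, mul_pow, mul_inv]
  generalize (resCard F : ℂ) ^ b * (1 - (resCard F : ℂ)⁻¹) = A at hq ⊢
  field_simp

theorem tateKernel_eq_one (hϖ : IsUniformizer ϖ) (he : IsSmoothChar ϖ δ e) (hχ : IsUnramified χ)
    (hdc : dc (unitSet F) = 1) {k : ℤ} (hk : -(δ : ℤ) ≤ k) :
    tateKernel dc χ e ((ϖ ^ k : Fˣ) : F) = 1 := by
  rw [tateKernel, setIntegral_congr_fun isOpen_unitSet.measurableSet (g := fun _ => (1 : ℂ))]
  · simp [Measure.real, hdc]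
  · intro c hc
    have hc' : ‖(c : F)‖ = 1 := hc
    dsimp only
    rw [hχ c hc, Units.val_one, one_mul]
    refine he.eq_one ?_
    rw [norm_mul, hc', one_mul, norm_zpow_units]
    exact (norm_zpow_strictAnti hϖ).antitone hk

theorem resCard_sub_one_ne_zero : (resCard F : ℂ) - 1 ≠ 0 := by
  rw [sub_ne_zero]
  intro h
  have := two_le_resCard F
  have h4 : resCard F = 1 := by exact_mod_cast h
  omega

/-- The units are the integers minus the maximal ideal. At this valuation of `a` the character is
nontrivial on the integers and trivial on the maximal ideal, which contributes its volume `q⁻¹`. -/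
theorem setIntegral_norm_eq_one (hϖ : IsUniformizer ϖ) (he : IsSmoothChar ϖ δ e) (μ : Measure F)
    [μ.IsAddHaarMeasure] (hμ : μ {x | ‖x‖ ≤ 1} = 1) {a : F}
    (ha : ‖a‖ = ‖(ϖ : F)‖ ^ (-(δ : ℤ) - 1)) :
    ∫ x in {x | ‖x‖ = 1}, e (x * a) ∂μ = -(resCard F : ℂ)⁻¹ := by
  classical
  have h0 := norm_units_pos ϖ
  let H : ∀ {r : ℝ}, 0 ≤ r → AddSubgroup F := fun {r} hr =>
    { carrier := {x | ‖x‖ ≤ r}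
      zero_mem' := by simpa using hr
      add_mem' := fun ha hb => (IsUltrametricDist.norm_add_le_max _ _).trans (max_le ha hb)
      neg_mem' := fun ha => by simpa using ha }
  have hm : ∀ r : ℝ, MeasurableSet {x : F | ‖x‖ ≤ r} := fun r =>
    (isCompact_norm_le r).isClosed.measurableSet
  have hadd : ∀ x y, e ((x + y) * a) = e (x * a) * e (y * a) := fun x y => by
    rw [add_mul, he.map_add]
  have h1 : ∫ x in {x | ‖x‖ ≤ 1}, e (x * a) ∂μ = 0 := by
    refine (setIntegral_char μ (H zero_le_one) (hm 1) (e := fun x => e (x * a)) hadd).trans ?_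
    refine if_neg fun h => ?_
    have h2 := (he.dual a).1 fun y hy => by rw [mul_comm]; exact h y hy
    rw [ha] at h2
    exact absurd ((norm_zpow_strictAnti hϖ).le_iff_ge.1 h2) (by omega)
  have h2 : ∫ x in {x | ‖x‖ ≤ ‖(ϖ : F)‖ ^ (1 : ℤ)}, e (x * a) ∂μ = (resCard F : ℂ)⁻¹ := by
    refine (setIntegral_char μ (H (zpow_pos h0 1).le) (hm _) (e := fun x => e (x * a)) hadd).trans ?_
    refine (if_pos fun x hx => he.eq_one ?_).trans ?_
    · rw [norm_mul, ha]
      refine (mul_le_mul_of_nonneg_right hx (zpow_pos h0 _).le).trans ?_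
      rw [← zpow_add₀ h0.ne']
      exact (norm_zpow_strictAnti hϖ).antitone (by omega)
    · change ((μ.real {x | ‖x‖ ≤ ‖(ϖ : F)‖ ^ (1 : ℤ)} : ℝ) : ℂ) = _
      rw [Measure.real, measure_norm_le_zpow hϖ μ hμ, zpow_neg_one, ENNReal.toReal_inv,
        ENNReal.toReal_natCast, Complex.ofReal_inv, Complex.ofReal_natCast]
  have h3 : {x : F | ‖x‖ = 1} = {x | ‖x‖ ≤ 1} \ {x | ‖x‖ ≤ ‖(ϖ : F)‖ ^ (1 : ℤ)} := by
    ext x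
    simp only [Set.mem_ofPred_eq, Set.mem_sdiff, zpow_one, not_le]
    constructor
    · intro h; rw [h]; exact ⟨le_rfl, hϖ.norm_lt_one⟩
    · rintro ⟨h4, h5⟩
      refine le_antisymm h4 (not_lt.1 fun h => h5.not_ge (hϖ.norm_le_of_lt_one h))
  have hint : IntegrableOn (fun x => e (x * a)) {x | ‖x‖ ≤ 1} μ :=
    (he.continuous.comp (continuous_mul_const a)).continuousOn.integrableOn_compact
      (isCompact_norm_le 1)
  rw [h3, setIntegral_sdiff (hm _) hint, h1, h2, zero_sub]
  intro x hx
  have hx : ‖x‖ ≤ ‖(ϖ : F)‖ ^ (1 : ℤ) := hx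
  rw [zpow_one] at hx
  exact hx.trans hϖ.norm_lt_one.le

theorem measure_real_norm_eq_one (hϖ : IsUniformizer ϖ) (μ : Measure F) [μ.IsAddHaarMeasure]
    (hμ : μ {x | ‖x‖ ≤ 1} = 1) : (μ.real {x | ‖x‖ = 1} : ℂ) = 1 - (resCard F : ℂ)⁻¹ := by
  have hm : ∀ r : ℝ, MeasurableSet {x : F | ‖x‖ ≤ r} := fun r =>
    (isCompact_norm_le r).isClosed.measurableSet
  have hsub : {x : F | ‖x‖ ≤ ‖(ϖ : F)‖ ^ (1 : ℤ)} ⊆ {x | ‖x‖ ≤ 1} := fun x hx => by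
    have hx : ‖x‖ ≤ ‖(ϖ : F)‖ ^ (1 : ℤ) := hx
    rw [zpow_one] at hx
    exact hx.trans hϖ.norm_lt_one.le
  have h3 : {x : F | ‖x‖ = 1} = {x | ‖x‖ ≤ 1} \ {x | ‖x‖ ≤ ‖(ϖ : F)‖ ^ (1 : ℤ)} := by
    ext x
    simp only [Set.mem_ofPred_eq, Set.mem_sdiff, zpow_one, not_le]
    constructor
    · intro h; rw [h]; exact ⟨le_rfl, hϖ.norm_lt_one⟩
    · rintro ⟨h4, h5⟩
      refine le_antisymm h4 (not_lt.1 fun h => h5.not_ge (hϖ.norm_le_of_lt_one h))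
  rw [h3, measureReal_sdiff hsub (hm _) (isCompact_norm_le _).measure_ne_top, Measure.real,
    Measure.real, hμ, measure_norm_le_zpow hϖ μ hμ, zpow_neg_one, ENNReal.toReal_inv,
    ENNReal.toReal_natCast, ENNReal.toReal_one]
  push_cast
  rfl

/-- Integrate `e (x c t)` over units `x` for the additive and units `c` for the multiplicative
measure. One order gives `(1 - q⁻¹)` times the kernel, the other gives `-q⁻¹`. No explicit relation
between the two measures is needed. -/
theorem tateKernel_boundary (hϖ : IsUniformizer ϖ) (he : IsSmoothChar ϖ δ e) (hχ : IsUnramified χ)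
    (hdc : dc (unitSet F) = 1) (μ : Measure F) [μ.IsAddHaarMeasure] (hμ : μ {x | ‖x‖ ≤ 1} = 1) :
    tateKernel dc χ e ((ϖ ^ (-(δ : ℤ) - 1) : Fˣ) : F) = -((resCard F : ℂ) - 1)⁻¹ := by
  set t : F := ((ϖ ^ (-(δ : ℤ) - 1) : Fˣ) : F) with ht
  have hI : tateKernel dc χ e t = ∫ c in unitSet F, e (c * t) ∂dc := by
    rw [tateKernel]
    refine setIntegral_congr_fun isOpen_unitSet.measurableSet fun c hc => ?_
    rw [hχ c hc, Units.val_one, one_mul]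
  have hU : MeasurableSet {x : F | ‖x‖ = 1} :=
    (isClosed_eq continuous_norm continuous_const).measurableSet
  have hfin1 : IsFiniteMeasure (μ.restrict {x : F | ‖x‖ = 1}) := ⟨by
    rw [Measure.restrict_apply_univ]
    exact (measure_mono fun x (hx : ‖x‖ = 1) => hx.le).trans_lt (isCompact_norm_le 1).measure_lt_top⟩
  have hfin2 : IsFiniteMeasure (dc.restrict (unitSet F)) :=
    ⟨by rw [Measure.restrict_apply_univ, hdc]; exact ENNReal.one_lt_top⟩
  have h1 : ∫ x in {x : F | ‖x‖ = 1}, ∫ c in unitSet F, e (x * (c * t)) ∂dc ∂μ =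
      (1 - (resCard F : ℂ)⁻¹) * tateKernel dc χ e t := by
    rw [setIntegral_congr_fun hU (g := fun _ => tateKernel dc χ e t), setIntegral_const,
      Complex.real_smul, measure_real_norm_eq_one hϖ μ hμ]
    intro x hx
    have h0 : x ≠ 0 := norm_ne_zero_iff.1 (by rw [show ‖x‖ = 1 from hx]; exact one_ne_zero)
    dsimp only
    rw [hI]
    conv_rhs => rw [← setIntegral_units_mul_left dc (a := Units.mk0 x h0) hx]
    congr 1
    ext c
    rw [Units.val_mul, Units.val_mk0, mul_assoc]
  have h2 : ∫ c in unitSet F, ∫ x in {x : F | ‖x‖ = 1}, e (x * (c * t)) ∂μ ∂dc =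
      -(resCard F : ℂ)⁻¹ := by
    rw [setIntegral_congr_fun isOpen_unitSet.measurableSet (g := fun _ => -(resCard F : ℂ)⁻¹),
      setIntegral_const, Measure.real, hdc]
    · simp
    intro c hc
    refine setIntegral_norm_eq_one hϖ he μ hμ ?_
    rw [norm_mul, show ‖(c : F)‖ = 1 from hc, one_mul, ht, norm_zpow_units]
  rw [integral_integral_swap, h2] at h1
  · have hq := resCard_ne_zero (F := F)
    have hq1 := resCard_sub_one_ne_zero (F := F)
    field_simp at h1 ⊢
    linear_combination -h1
  · refine Integrable.of_bound (Continuous.aestronglyMeasurable (he.continuous.comp ?_)) 1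
      (Filter.Eventually.of_forall fun x => (he.norm_eq_one _).le)
    exact continuous_fst.mul ((Units.continuous_val.comp continuous_snd).mul continuous_const)

/-- With `Z` the Satake variable, the lowest term and the geometric tail combine as `-1/(q - 1) +
Z/(1 - Z) = (1 - q Z)/((1 - q)(1 - Z))`. -/
theorem tate_unramified (hϖ : IsUniformizer ϖ) (hdc : dc (unitSet F) = 1) (s : ℂ)
    (hω : IsUnramified ω) (hχ1 : ∀ x, ‖(χ x : ℂ)‖ = 1) (he : IsSmoothChar ϖ δ e)
    (hZ : ‖satake ϖ s (ω * χ)‖ < 1) (hχ : IsUnramified χ) (μ : Measure F) [μ.IsAddHaarMeasure]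
    (hμ : μ {x | ‖x‖ ≤ 1} = 1) :
    ∫ t, tateTerm ϖ s (1 + δ) (ω * χ) t * tateKernel dc χ e t ∂dc =
      (satake ϖ s (ω * χ) ^ (1 + δ))⁻¹ * (1 - (resCard F : ℂ))⁻¹ *
        ((1 - resCard F * satake ϖ s (ω * χ)) / (1 - satake ϖ s (ω * χ))) := by
  rw [integral_tate dc hϖ hdc s _ hω hχ1 he hZ,
    tsum_geomTail_of_eq_one (satake_ne_zero ϖ s _) hZ _ fun k hk =>
      tateKernel_eq_one dc hϖ he hχ hdc (by push_cast at hk; omega)]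
  have e1 : -((1 + δ : ℕ) : ℤ) = -(δ : ℤ) - 1 := by push_cast; ring
  rw [e1, tateKernel_boundary dc hϖ he hχ hdc μ hμ, mul_assoc]
  congr 1
  have hq1 := resCard_sub_one_ne_zero (F := F)
  have hq2 : 1 - (resCard F : ℂ) ≠ 0 := by rw [← neg_sub, neg_ne_zero]; exact hq1
  have hz : 1 - satake ϖ s (ω * χ) ≠ 0 := by
    rw [sub_ne_zero]
    intro h
    rw [← h, norm_one] at hZ
    exact lt_irrefl _ hZ
  rw [← neg_sub, inv_neg, neg_neg]
  field_simp
  ring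

end TateIntegrals

end ParahoricZeta

namespace ParahoricZeta

/-! ### The character attached to the trace -/

section TraceCharacter

variable {p : ℕ} [Fact p.Prime] {F : Type*} [NontriviallyNormedField F] [IsUltrametricDist F]
  [NormedAlgebra ℚ_[p] F] {ϖ : Fˣ} {δ : ℕ} {ψ₀ : AddChar ℚ_[p] ℂ}

/-- A power of `p` multiplies `x` into `ℤ_p`, so `ψ₀ x` is a root of unity. -/
theorem norm_addChar_eq_one (hψ₀ : ∀ x, ‖x‖ ≤ 1 → ψ₀ x = 1) (x : ℚ_[p]) : ‖ψ₀ x‖ = 1 := by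
  have hp : 1 < p := (Fact.out : p.Prime).one_lt
  obtain ⟨m, hm⟩ : ∃ m : ℕ, ‖x‖ ≤ (p : ℝ) ^ m :=
    (pow_unbounded_of_one_lt ‖x‖ (by exact_mod_cast hp)).imp fun _ h => h.le
  have h1 : ψ₀ x ^ (p ^ m) = 1 := by
    rw [← AddChar.map_nsmul_eq_pow]
    refine hψ₀ _ ?_
    rw [nsmul_eq_mul, norm_mul, Nat.cast_pow, norm_pow, Padic.norm_p, inv_pow]
    exact inv_mul_le_one_of_le₀ hm (by positivity)
  exact Complex.norm_eq_one_of_pow_eq_one h1 (pow_pos (by omega) m).ne'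

theorem isSmoothChar_traceChar (hδ : IsDifferentExponent p ϖ δ) (hψ₀ : ∀ x, ψ₀ x = 1 ↔ ‖x‖ ≤ 1) :
    IsSmoothChar ϖ δ (traceChar ψ₀ : F → ℂ) where
  map_add x y := by rw [traceChar, map_add, AddChar.map_add_eq_mul]; rfl
  norm_eq_one x := norm_addChar_eq_one (fun x => (hψ₀ x).2) _
  dual x := by
    have h0 := norm_units_pos ϖ
    rw [zpow_neg, zpow_natCast, ← one_div, le_div_iff₀ (pow_pos h0 δ), ← norm_pow, ← norm_mul,
      ← mem_integer_iff, ← hδ x]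
    refine forall_congr' fun y => ?_
    rw [mem_integer_iff, traceChar, hψ₀]

end TraceCharacter

theorem prod_range_cpow {q : ℂ} (hq : q ≠ 0) (n : ℕ) :
    ∏ i ∈ Finset.range n, q ^ ((i : ℂ) + 1 / 2) = q ^ ((n : ℂ) ^ 2 / 2) := by
  induction n with
  | zero => simp
  | succ m ih =>
    rw [Finset.prod_range_succ, ih, ← Complex.cpow_add _ _ hq]
    congr 1
    push_cast
    ring

/-! ### Constants -/

section Constants

variable {F : Type*} [NontriviallyNormedField F] [IsUltrametricDist F] {n : ℕ} {ϖ : Fˣ} {δ : ℕ}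
  {e : F → ℂ} {θ : Fin n ⊕ Fin n → Fˣ →* ℂˣ} {χ : Fˣ →* ℂˣ}
  [ProperSpace F] [MeasurableSpace F] [BorelSpace F]

variable (F) in
theorem exists_addHaar_normalised :
    ∃ μ : Measure F, μ.IsAddHaarMeasure ∧ μ {x | ‖x‖ ≤ 1} = 1 := by
  let K : TopologicalSpace.PositiveCompacts F :=
    ⟨⟨{x | ‖x‖ ≤ 1}, isCompact_norm_le 1⟩, ⟨0, by
      change (0 : F) ∈ interior {x : F | ‖x‖ ≤ 1}
      rw [(isOpen_norm_le one_pos).interior_eq]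
      simp⟩⟩
  exact ⟨Measure.addHaarMeasure K, inferInstance, Measure.addHaarMeasure_self⟩

theorem IsUnramified.mul {ω₁ ω₂ : Fˣ →* ℂˣ} (h₁ : IsUnramified ω₁) (h₂ : IsUnramified ω₂) :
    IsUnramified (ω₁ * ω₂) := fun c hc => by
  rw [MonoidHom.mul_apply, h₁ c hc, h₂ c hc, one_mul]

theorem norm_eq_one_of_isOfFinOrder (hχ : IsOfFinOrder χ) (x : Fˣ) : ‖(χ x : ℂ)‖ = 1 := by
  obtain ⟨m, hm, h⟩ := isOfFinOrder_iff_pow_eq_one.1 hχ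
  refine Complex.norm_eq_one_of_pow_eq_one (n := m) ?_ hm.ne'
  rw [← Units.val_pow_eq_pow_val, ← MonoidHom.pow_apply, h]
  rfl

theorem higherUnits_subset (hϖ : IsUniformizer ϖ) {a b : ℕ} (h : a ≤ b) :
    higherUnits ϖ b ⊆ higherUnits ϖ a := fun _ hc =>
  ⟨hc.1, hc.2.trans (pow_le_pow_of_le_one (norm_nonneg _) hϖ.norm_lt_one.le h)⟩

theorem isUnramified_of_hasConductor_zero (h : HasConductor ϖ χ 0) : IsUnramified χ := by
  intro c hc
  refine h.1 c ⟨hc, ?_⟩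
  rw [pow_zero, sub_eq_add_neg]
  refine (IsUltrametricDist.norm_add_le_max _ _).trans (max_le (le_of_eq hc) ?_)
  simp

variable [MeasurableSpace (Matrix (Fin n) (Fin n) F)] [BorelSpace (Matrix (Fin n) (Fin n) F)]
  (dk : Measure (GL (Fin n) F)) [dk.IsHaarMeasure] (dh : Measure (GL (Fin n) F)) [dh.IsHaarMeasure]
  (dc : Measure Fˣ) [dc.IsHaarMeasure] (μ : Measure F) [μ.IsAddHaarMeasure]

/-- The half modulus contributes `q^(i + 1/2)` for `0 ≤ i < n`, with exponents adding up to `n²/2`.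
-/
theorem alphaN_eq (hϖ : IsUniformizer ϖ) :
    alphaN ϖ θ = (resCard F : ℂ) ^ ((n : ℂ) ^ 2 / 2) * ∏ i : Fin n, (θ (Sum.inr i) ϖ : ℂ) := by
  have hq : (0 : ℝ) < resCard F := by
    have := two_le_resCard F
    exact_mod_cast (by omega : 0 < resCard F)
  have h1 : normAbs ϖ (ϖ : F) = (resCard F : ℝ)⁻¹ :=
    normAbs_uniformizer ϖ hϖ.norm_lt_one (by exact_mod_cast hq)
  rw [alphaN, inducingChar_lower, Finset.prod_mul_distrib]
  congr 1
  have h2 : ∀ i : Fin n,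
      (((normAbs ϖ (ϖ : F) ^ ((2 * (n : ℝ) - 1 - 2 * (n + i : ℕ)) / 2) : ℝ)) : ℂ) =
        (resCard F : ℂ) ^ ((((i : ℕ) : ℂ)) + 1 / 2) := fun i => by
    rw [h1, Real.inv_rpow hq.le, ← Real.rpow_neg hq.le, Complex.ofReal_cpow hq.le,
      Complex.ofReal_natCast]
    congr 1
    push_cast
    ring
  rw [Finset.prod_congr rfl fun i _ => h2 i,
    Fin.prod_univ_eq_prod_range (fun i => (resCard F : ℂ) ^ ((i : ℂ) + 1 / 2)) n]
  exact prod_range_cpow resCard_ne_zero n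

/-- By uniqueness of Haar measure `dh` is a multiple of `dk`, and evaluating on `GL_n(𝒪)` identifies
the factor. -/
theorem measure_intGL_mul (hdk : dk (intGL F (Fin n)) = 1) (S : Set (GL (Fin n) F)) :
    dh.real (intGL F (Fin n)) * dk.real S = dh.real S := by
  have h := Measure.isMulLeftInvariant_eq_smul dh dk
  rw [h, Measure.real, Measure.real, Measure.real, Measure.smul_apply, Measure.smul_apply, hdk,
    ENNReal.smul_def, ENNReal.smul_def, smul_eq_mul, mul_one, smul_eq_mul, ENNReal.toReal_mul]

theorem prod_tate_eq (hϖ : IsUniformizer ϖ) (hdc : dc (unitSet F) = 1)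
    (hμ : μ {x | ‖x‖ ≤ 1} = 1) (s : ℂ) (hθ : ∀ i, IsUnramified (θ i))
    (hχ1 : ∀ x, ‖(χ x : ℂ)‖ = 1) (he : IsSmoothChar ϖ δ e) {b : ℕ} (hb : HasConductor ϖ χ b)
    (hZ : ∀ i : Fin n, ‖satake ϖ s (θ (Sum.inr i) * χ)‖ < 1) :
    ∏ i : Fin n, ∫ t, tateTerm ϖ s (max 1 b + δ) (θ (Sum.inr i) * χ) t *
        tateKernel dc χ e t ∂dc =
      ((∏ i : Fin n, satake ϖ s (θ (Sum.inr i))) ^ (max 1 b + δ))⁻¹ *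
        Qfactor ϖ δ b θ χ (localGaussSum dc ϖ δ b e χ) s := by
  have hq := resCard_ne_zero (F := F)
  have hq1 := resCard_sub_one_ne_zero (F := F)
  rw [Qfactor]
  split_ifs with h
  · subst h
    have hχ := isUnramified_of_hasConductor_zero hb
    rw [max_eq_left (Nat.zero_le 1)]
    have h1 : ∀ i : Fin n, ∫ t, tateTerm ϖ s (1 + δ) (θ (Sum.inr i) * χ) t *
        tateKernel dc χ e t ∂dc = (satake ϖ s (θ (Sum.inr i)) ^ (1 + δ))⁻¹ *
        (((χ ϖ : ℂ) ^ (1 + δ))⁻¹ * (1 - (resCard F : ℂ))⁻¹) *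
        ((1 - (θ (Sum.inr i) ϖ : ℂ) * (χ ϖ : ℂ) * (resCard F : ℂ) ^ (1 - s)) /
        (1 - (θ (Sum.inr i) ϖ : ℂ) * (χ ϖ : ℂ) * (resCard F : ℂ) ^ (-s))) := fun i => by
      rw [tate_unramified dc hϖ hdc s (hθ _) hχ1 he (hZ i) hχ μ hμ]
      have e1 : satake ϖ s (θ (Sum.inr i) * χ) =
          (θ (Sum.inr i) ϖ : ℂ) * (χ ϖ : ℂ) * (resCard F : ℂ) ^ (-s) := by
        rw [satake, MonoidHom.mul_apply, Units.val_mul]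
      have e2 : satake ϖ s (θ (Sum.inr i) * χ) = satake ϖ s (θ (Sum.inr i)) * (χ ϖ : ℂ) := by
        rw [e1, satake]; ring
      have e3 : (resCard F : ℂ) * satake ϖ s (θ (Sum.inr i) * χ) =
          (θ (Sum.inr i) ϖ : ℂ) * (χ ϖ : ℂ) * (resCard F : ℂ) ^ (1 - s) := by
        rw [e1, sub_eq_add_neg, Complex.cpow_add _ _ hq, Complex.cpow_one]; ring
      rw [e3, ← e1, e2, mul_pow, mul_inv]
      ring
    rw [Finset.prod_congr rfl fun i _ => h1 i, Finset.prod_mul_distrib, Finset.prod_mul_distrib,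
      Finset.prod_const, Finset.card_univ, Fintype.card_fin, Finset.prod_inv_distrib,
      Finset.prod_pow, mul_pow, inv_pow, inv_pow, ← pow_mul, mul_comm n (δ + 1), add_comm 1 δ]
    ring
  · rw [max_eq_right (by omega : 1 ≤ b),
      Finset.prod_congr rfl fun i _ =>
        tate_ramified dc hϖ hdc s (hθ (Sum.inr i)) hχ1 he (hZ i) (by omega) hb,
      Finset.prod_mul_distrib, Finset.prod_mul_distrib, Finset.prod_const, Finset.prod_const,
      Finset.card_univ, Fintype.card_fin, Finset.prod_inv_distrib, Finset.prod_pow]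
    have e1 : (1 - (resCard F : ℂ)⁻¹) = ((resCard F : ℂ) - 1) / resCard F := by field_simp
    rw [e1, mul_inv, mul_pow, inv_pow, inv_pow, ← pow_mul, div_pow, inv_div, mul_assoc]

end Constants

end ParahoricZeta

namespace ParahoricZeta

/-! ### The formula and its meromorphic continuation -/

section Evaluation

variable {F : Type*} [NontriviallyNormedField F] [IsUltrametricDist F] {n : ℕ} {ϖ : Fˣ} {δ : ℕ}
  {e : F → ℂ} {θ : Fin n ⊕ Fin n → Fˣ →* ℂˣ} {η χ : Fˣ →* ℂˣ} {F₀ : GL (Fin n ⊕ Fin n) F → ℂ}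
  [ProperSpace F] [MeasurableSpace F] [BorelSpace F]
  [MeasurableSpace (Matrix (Fin n) (Fin n) F)] [BorelSpace (Matrix (Fin n) (Fin n) F)]
  (dk : Measure (GL (Fin n) F)) [dk.IsHaarMeasure] (dh : Measure (GL (Fin n) F)) [dh.IsHaarMeasure]
  (dX : Measure (Matrix (Fin n) (Fin n) F)) [dX.IsAddHaarMeasure]
  (dc : Measure Fˣ) [dc.IsHaarMeasure] (μ : Measure F) [μ.IsAddHaarMeasure]

/-- The left side gathers the powers of `q` from `α^(β+δ)`, from `|det ϖ^β|^n` and the normalisation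
of `F₀`, from the volume of the box, and from the Satake variables. The right side has the ratio of
the Iwahori volumes, the volume factor and the power in the formula. Here `N` stands for the number
of positions above the diagonal. -/
theorem cpow_exponent {q : ℂ} (hq : q ≠ 0) (s : ℂ) (n N β δ : ℕ) (hβ : 1 ≤ β)
    (hN : 2 * N = n * (n - 1)) :
    (q ^ ((n : ℂ) ^ 2 / 2)) ^ (β + δ) * (q ^ ((β + δ) * n ^ 2))⁻¹ * q ^ ((β + δ) * N) *
        (((q ^ (-s)) ^ n) ^ (β + δ))⁻¹ =
      q ^ ((β - 1) * N) * q ^ ((n : ℂ) * (n - 1) / 2 + (δ : ℂ) * n * (n + 1) / 2) *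
        q ^ ((β : ℂ) * n * (s - n / 2) + (δ : ℂ) * n * (s - n / 2 - 1)) := by
  have hN' : (N : ℂ) = n * (n - 1) / 2 := by
    have h : (2 : ℂ) * N = n * (n - 1 : ℕ) := by exact_mod_cast hN
    rcases Nat.eq_zero_or_pos n with rfl | hn
    · simpa using h
    · rw [Nat.cast_sub hn, Nat.cast_one] at h
      linear_combination h / 2
  simp only [← Complex.cpow_natCast]
  rw [← Complex.cpow_neg]
  simp only [Complex.cpow_natCast, ← Complex.cpow_nat_mul]
  rw [← Complex.cpow_neg, ← Complex.cpow_natCast q ((β + δ) * N),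
    ← Complex.cpow_natCast q ((β - 1) * N), ← Complex.cpow_add _ _ hq, ← Complex.cpow_add _ _ hq,
    ← Complex.cpow_add _ _ hq, ← Complex.cpow_add _ _ hq, ← Complex.cpow_add _ _ hq]
  congr 1
  push_cast [Nat.cast_sub hβ]
  rw [hN']
  ring

theorem zeta_formula (hϖ : IsUniformizer ϖ) (hdc : dc (unitSet F) = 1)
    (hμ : μ {x | ‖x‖ ≤ 1} = 1) (hdX : dX {X | ∀ i j, ‖X i j‖ ≤ 1} = 1)
    (hdk : dk (intGL F (Fin n)) = 1) (hθ : ∀ i, IsUnramified (θ i)) (hη : IsUnramified η)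
    (hχ1 : ∀ x, ‖(χ x : ℂ)‖ = 1) (he : IsSmoothChar ϖ δ e) {b : ℕ} (hb : HasConductor ϖ χ b)
    (hF : IsNormalisedVector ϖ δ θ F₀) (s : ℂ)
    (hs : ∀ i : Fin n, ‖(θ (Sum.inr i) ϖ : ℂ)‖ * (resCard F : ℝ) ^ (-s.re) < 1) :
    Integrable (zetaIntegrand ϖ s (rightTranslate ((uMat F n)⁻¹ * tMat n ϖ ^ max 1 b)
      (shalikaFun dk dX e η F₀)) χ) dh ∧
    zetaIntegral dh ϖ s (rightTranslate ((uMat F n)⁻¹ * tMat n ϖ ^ max 1 b)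
      (shalikaFun dk dX e η F₀)) χ =
    volFactor F n dh δ * zetaFormula ϖ δ b θ χ (localGaussSum dc ϖ δ b e χ) s := by
  have hZ : ∀ i : Fin n, ‖satake ϖ s (θ (Sum.inr i) * χ)‖ < 1 := fun i => by
    rw [norm_satake, MonoidHom.mul_apply, Units.val_mul, norm_mul, hχ1, mul_one]
    exact hs i
  have hβ : 1 ≤ max 1 b := le_max_left _ _
  have hχ : ∀ c ∈ higherUnits ϖ (max 1 b), χ c = 1 := fun c hc =>
    hb.1 c (higherUnits_subset hϖ (le_max_right 1 b) hc)
  obtain ⟨h1, h2⟩ := zeta_eq_prod_tate dk dh dc μ hϖ hdc hμ hF he hη dX hdX hχ hχ1 hβ s fun i =>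
    integrable_tateTerm dc hϖ hdc s _ (hθ _) (continuous_of_higherUnits hχ) hχ1 (hZ i)
  refine ⟨h1, ?_⟩
  rw [h2, prod_tate_eq dc μ hϖ hdc hμ s hθ hχ1 he hb hZ, hF.leviValue_one, alphaN_eq hϖ, volFactor,
    zetaFormula]
  have hlev : (dh.real (iwahori F n) : ℂ) =
      (resCard F : ℂ) ^ ((max 1 b - 1) * Fintype.card (StrictPair n)) *
        ((dh.real (intGL F (Fin n)) : ℂ) *
          (dk.real (iwahoriLevel F n (‖(ϖ : F)‖ ^ max 1 b)) : ℂ)) := by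
    rw [← Complex.ofReal_mul, measure_intGL_mul dk dh hdk, Measure.real,
      measure_iwahori dX μ hϖ hdX hμ dh hβ, ENNReal.toReal_mul, ENNReal.toReal_pow,
      ENNReal.toReal_natCast]
    push_cast
    rfl
  have hexp := cpow_exponent (resCard_ne_zero (F := F)) s n (Fintype.card (StrictPair n)) (max 1 b) δ
    hβ two_mul_card_strictPair
  have hsat : ∏ i : Fin n, satake ϖ s (θ (Sum.inr i)) =
      (∏ i : Fin n, (θ (Sum.inr i) ϖ : ℂ)) * ((resCard F : ℂ) ^ (-s)) ^ n := by
    simp_rw [satake]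
    rw [Finset.prod_mul_distrib, Finset.prod_const, Finset.card_univ, Fintype.card_fin]
  have ha : (∏ i : Fin n, (θ (Sum.inr i) ϖ : ℂ)) ≠ 0 :=
    Finset.prod_ne_zero_iff.2 fun i _ => Units.ne_zero _
  rw [hlev, hsat]
  generalize (∏ i : Fin n, (θ (Sum.inr i) ϖ : ℂ)) = a at ha ⊢
  generalize Qfactor ϖ δ b θ χ (localGaussSum dc ϖ δ b e χ) s = Q
  generalize (χ (Matrix.GeneralLinearGroup.det (-wLong F n)) : ℂ) = w
  generalize (dh.real (intGL F (Fin n)) : ℂ) = K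
  generalize (dk.real (iwahoriLevel F n (‖(ϖ : F)‖ ^ max 1 b)) : ℂ) = D
  generalize max 1 b = β at hexp ⊢
  -- The product `a` of the `θ_{n+i}(ϖ)` enters with exponent `β` from the Shalika function, `δ`
  -- from the normalisation of `F₀`, and `-(β + δ)` from the Tate integrals.
  have ha1 : a ^ (β + δ) * (a ^ (β + δ))⁻¹ = 1 := mul_inv_cancel₀ (pow_ne_zero _ ha)
  rw [mul_pow a, mul_inv, mul_pow, mul_pow]
  have h3 : (((resCard F : ℂ) ^ (β * n ^ 2))⁻¹ * ((resCard F : ℂ) ^ (δ * n ^ 2))⁻¹) =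
      ((resCard F : ℂ) ^ ((β + δ) * n ^ 2))⁻¹ := by
    rw [← mul_inv, ← pow_add, ← add_mul]
  rw [← h3, pow_add _ β δ] at hexp
  rw [pow_add a β δ] at ha1 ⊢
  linear_combination (K * D * w * Q) * hexp +
    ((resCard F : ℂ) ^ ((n : ℂ) ^ 2 / 2)) ^ β * ((resCard F : ℂ) ^ ((n : ℂ) ^ 2 / 2)) ^ δ *
      (((resCard F : ℂ) ^ (β * n ^ 2))⁻¹ * ((resCard F : ℂ) ^ (δ * n ^ 2))⁻¹) *
      (resCard F : ℂ) ^ ((β + δ) * Fintype.card (StrictPair n)) *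
      ((((resCard F : ℂ) ^ (-s)) ^ n) ^ (β + δ))⁻¹ * (K * D * w * Q) * ha1

theorem exists_halfPlane (ϖ : Fˣ) (θ : Fin n ⊕ Fin n → Fˣ →* ℂˣ) :
    ∃ σ : ℝ, ∀ s : ℂ, σ < s.re →
      ∀ i : Fin n, ‖(θ (Sum.inr i) ϖ : ℂ)‖ * (resCard F : ℝ) ^ (-s.re) < 1 := by
  have hq : (1 : ℝ) < resCard F := by
    have := two_le_resCard F
    exact_mod_cast (by omega : 1 < resCard F)
  have h1 : ∀ i : Fin n, ∀ᶠ x : ℝ in Filter.atTop,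
      ‖(θ (Sum.inr i) ϖ : ℂ)‖ * (resCard F : ℝ) ^ (-x) < 1 := fun i => by
    have h2 : Filter.Tendsto (fun x : ℝ => ‖(θ (Sum.inr i) ϖ : ℂ)‖ * ((resCard F : ℝ)⁻¹) ^ x)
        Filter.atTop (nhds (‖(θ (Sum.inr i) ϖ : ℂ)‖ * 0)) :=
      (tendsto_rpow_atTop_of_base_lt_one _ (by linarith [inv_pos.2 (zero_lt_one.trans hq)])
        (inv_lt_one_of_one_lt₀ hq)).const_mul _
    rw [mul_zero] at h2
    filter_upwards [h2.eventually_lt_const one_pos] with x hx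
    rwa [Real.rpow_neg (zero_lt_one.trans hq).le, ← Real.inv_rpow (zero_lt_one.trans hq).le]
  obtain ⟨σ, hσ⟩ := Filter.eventually_atTop.1 (Filter.eventually_all.2 h1)
  exact ⟨σ, fun s hs => hσ _ hs.le⟩

theorem meromorphicOn_zetaFormula (δ b : ℕ) (θ : Fin n ⊕ Fin n → Fˣ →* ℂˣ) (χ : Fˣ →* ℂˣ)
    (c τ : ℂ) : MeromorphicOn (fun s => c * zetaFormula ϖ δ b θ χ τ s) Set.univ := by
  intro s _
  have hq := resCard_ne_zero (F := F)
  have hpow : ∀ {f : ℂ → ℂ}, Differentiable ℂ f →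
      MeromorphicAt (fun s => (resCard F : ℂ) ^ f s) s := fun hf =>
    (Differentiable.analyticAt (fun x => (hf x).const_cpow (Or.inl hq)) s).meromorphicAt
  refine (MeromorphicAt.const c s).fun_mul ?_
  refine ((hpow (by fun_prop)).fun_mul (MeromorphicAt.const _ s)).fun_mul ?_
  change MeromorphicAt (fun s => Qfactor ϖ δ b θ χ τ s) s
  by_cases h : b = 0
  · simp only [Qfactor, if_pos h]
    refine (MeromorphicAt.const _ s).fun_mul (MeromorphicAt.fun_prod fun i _ => ?_)
    exact ((MeromorphicAt.const _ s).fun_sub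
        ((MeromorphicAt.const _ s).fun_mul (hpow (by fun_prop)))).fun_div
      ((MeromorphicAt.const _ s).fun_sub ((MeromorphicAt.const _ s).fun_mul (hpow (by fun_prop))))
  · simp only [Qfactor, if_neg h]
    exact MeromorphicAt.const _ s

/-- Meromorphic functions on `ℂ` that agree on a half plane agree off a discrete closed set. -/
theorem eq_codiscrete_of_halfPlane {f g : ℂ → ℂ} (hf : MeromorphicOn f Set.univ)
    (hg : MeromorphicOn g Set.univ) {σ : ℝ} (h : ∀ s : ℂ, σ < s.re → f s = g s) :
    f =ᶠ[Filter.codiscrete ℂ] g := by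
  have hd : MeromorphicOn (f - g) Set.univ := hf.sub hg
  -- On a connected set the difference has infinite order everywhere as soon as it does at one
  -- point, here a point of the half plane.
  have h1 := hd.exists_meromorphicOrderAt_ne_top_iff_forall isConnected_univ
  have h2 : meromorphicOrderAt (f - g) ((σ + 1 : ℝ) : ℂ) = ⊤ := by
    rw [meromorphicOrderAt_eq_top_iff]
    refine eventually_nhdsWithin_of_eventually_nhds ?_
    have : {s : ℂ | σ < s.re} ∈ nhds ((σ + 1 : ℝ) : ℂ) :=
      (isOpen_lt continuous_const Complex.continuous_re).mem_nhds (by simp)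
    filter_upwards [this] with s hs
    rw [Pi.sub_apply, h s hs, sub_self]
  have h3 : ∀ s : ℂ, meromorphicOrderAt (f - g) s = ⊤ := by
    by_contra hne
    push Not at hne
    obtain ⟨s, hs⟩ := hne
    exact h1.1 ⟨⟨s, trivial⟩, hs⟩ ⟨_, trivial⟩ h2
  rw [Filter.EventuallyEq, Filter.Eventually, mem_codiscrete]
  intro s
  rw [Filter.disjoint_principal_right, compl_compl]
  filter_upwards [meromorphicOrderAt_eq_top_iff.1 (h3 s)] with z hz
  exact sub_eq_zero.1 hz

end Evaluation

end ParahoricZeta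

/-! ### The main theorem -/

open ParahoricZeta
theorem mainTheorem7 {p : ℕ} [Fact p.Prime]
    {F : Type*} [NontriviallyNormedField F] [IsUltrametricDist F] [NormedAlgebra ℚ_[p] F]
    [FiniteDimensional ℚ_[p] F] [MeasurableSpace F] [BorelSpace F]
    {n : ℕ} (hn : 1 ≤ n)
    [MeasurableSpace (Matrix (Fin n) (Fin n) F)] [BorelSpace (Matrix (Fin n) (Fin n) F)]
    -- a uniformiser and the exponent of the different
    (ϖ : Fˣ) (hϖ : IsUniformizer ϖ) (δ : ℕ) (hδ : IsDifferentExponent p ϖ δ)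
    -- the additive character `ψ = ψ₀ ∘ Tr`, with `ψ₀` trivial exactly on `ℤ_p`
    (ψ₀ : AddChar ℚ_[p] ℂ) (hψ₀ : ∀ x, ψ₀ x = 1 ↔ ‖x‖ ≤ 1)
    -- unramified characters with `θ_i θ_{n+i} = η`
    (θ : Fin n ⊕ Fin n → Fˣ →* ℂˣ) (hθ : ∀ i, IsUnramified (θ i))
    (η : Fˣ →* ℂˣ) (hη : ∀ i : Fin n, θ (Sum.inl i) * θ (Sum.inr i) = η)
    -- a finite-order character of conductor `𝔭 ^ b`
    (χ : Fˣ →* ℂˣ) (hχ : IsOfFinOrder χ) (b : ℕ) (hb : HasConductor ϖ χ b)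
    -- Haar measures: any on `GL_n(F)` (for the zeta integral), and those giving `GL_n(𝒪)`,
    -- `M_n(𝒪)` and `𝒪ˣ` volume `1`
    (dh : Measure (GL (Fin n) F)) [dh.IsHaarMeasure]
    (dk : Measure (GL (Fin n) F)) [dk.IsHaarMeasure] (hdk : dk (maxCompact F n) = 1)
    (dX : Measure (Matrix (Fin n) (Fin n) F)) [dX.IsAddHaarMeasure]
    (hdX : dX {X | ∀ i j, X i j ∈ 𝒪[F]} = 1)
    (dc : Measure Fˣ) [dc.IsHaarMeasure] (hdc : dc (unitSet F) = 1) :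
    (∃! F₀ : GL (Fin n ⊕ Fin n) F → ℂ, IsNormalisedVector ϖ δ θ F₀) ∧
    ∀ F₀ : GL (Fin n ⊕ Fin n) F → ℂ, IsNormalisedVector ϖ δ θ F₀ →
      let W₀ := shalikaFun dk dX (traceChar ψ₀) η F₀
      let g₀ := (uMat F n)⁻¹ * tMat n ϖ ^ max 1 b
      let R : ℂ → ℂ := fun s => volFactor F n dh δ *
        zetaFormula ϖ δ b θ χ (localGaussSum dc ϖ δ b (traceChar ψ₀) χ) s
      -- absolute convergence of the integrals defining the values of `W₀` that occur
      (∀ h : GL (Fin n) F, Integrable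
        (Function.uncurry (shalikaIntegrand (traceChar ψ₀) η F₀ (blockDiag h 1 * g₀)))
        ((dk.restrict (maxCompact F n)).prod dX)) ∧
      -- the formula where the zeta integral converges absolutely
      (∀ s : ℂ, (∀ i : Fin n, ‖(θ (Sum.inr i) ϖ : ℂ)‖ * (resCard F : ℝ) ^ (-s.re) < 1) →
        Integrable (zetaIntegrand ϖ s (rightTranslate g₀ W₀) χ) dh ∧
        zetaIntegral dh ϖ s (rightTranslate g₀ W₀) χ = R s) ∧
      -- the formula for the meromorphic continuation
      IsLocalZeta dh ϖ (rightTranslate g₀ W₀) χ R ∧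
      ∀ Z : ℂ → ℂ, IsLocalZeta dh ϖ (rightTranslate g₀ W₀) χ Z →
        Z =ᶠ[Filter.codiscrete ℂ] R := by 
  have : ProperSpace F := FiniteDimensional.proper ℚ_[p] F
  obtain ⟨μ, hμ, hμ1⟩ := exists_addHaar_normalised F
  have he : IsSmoothChar ϖ δ (traceChar ψ₀ : F → ℂ) := isSmoothChar_traceChar hδ hψ₀
  -- Since `n ≥ 1`, `η` is a product of two of the unramified `θ_i`.
  have hηu : IsUnramified η := hη ⟨0, hn⟩ ▸ (hθ _).mul (hθ _)
  have hχ1 := norm_eq_one_of_isOfFinOrder hχ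
  simp only [mem_integer_iff] at hdX
  rw [maxCompact_eq] at hdk
  refine ⟨existsUnique_isNormalisedVector hϖ hθ, fun F₀ hF => ?_⟩
  intro W₀ g₀ R
  have hR : ∀ s : ℂ, (∀ i : Fin n, ‖(θ (Sum.inr i) ϖ : ℂ)‖ * (resCard F : ℝ) ^ (-s.re) < 1) →
      Integrable (zetaIntegrand ϖ s (rightTranslate g₀ W₀) χ) dh ∧
      zetaIntegral dh ϖ s (rightTranslate g₀ W₀) χ = R s :=
    zeta_formula dk dh dX dc μ hϖ hdc hμ1 hdX hdk hθ hηu hχ1 he hb hF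
  obtain ⟨σ, hσ⟩ := exists_halfPlane ϖ θ
  have hRm : MeromorphicOn R Set.univ := meromorphicOn_zetaFormula δ b θ χ _ _
  refine ⟨fun h => integrable_shalikaIntegrand dX dk hϖ he hF hηu (max 1 b) h, hR,
    ⟨hRm, σ, fun s hs => ⟨(hR s (hσ s hs)).1, (hR s (hσ s hs)).2.symm⟩⟩, ?_⟩
  rintro Z ⟨hZm, σ', hZ⟩
  refine eq_codiscrete_of_halfPlane hZm hRm (σ := max σ σ') fun s hs => ?_
  rw [(hZ s ((le_max_right _ _).trans_lt hs)).2,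
    (hR s (hσ s ((le_max_left _ _).trans_lt hs))).2]
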